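/- Let $k\in\mathbb{N}$ and let $f\neq 0$ be a cusp form of weight $k+\frac12$ on $\Gamma_0(4)$, i.e. $f$ is holomorphic on the upper half-plane, vanishes at all cusps, and $$f\Big(\frac{az+b}{cz+d}\Big)=\Big(\frac cd\Big)^{2k+1}\epsilon_d^{-2k-1}(cz+d)^{k+\frac12}f(z)\qquad\text{for all }\begin{pmatrix}a&b\\c&d\end{pmatrix}\in\Gamma_0(4),$$ where $\big(\frac cd\big)$ is Shimura's extension of the Jacobi symbol, $\epsilon_d=1$ if $d\equiv1$ and $\epsilon_d=i$ if $d\equiv 3\pmod 4$, and powers are principal. Assume that $f$ is an eigenform of all the Hecke operators $T_{p^2}$, $p$ prime (hence of all $T_{n^2}$), and of the Fricke operator $(f|W_4)(z)=i^{k+\frac12}2^{-k-\frac12}z^{-k-\frac12}f(-\frac1{4z})$. Write $f(z)=\sum_{n\ge1}a_f(n)e^{2\pi i nz}$ and $L(s,f)=\sum_{n\ge1}a_f(n)n^{-s}$. Let $c$ be the least positive integer with $a_f(c)\ne0$ and put $\tilde L(s,f)=\frac{c^{s}}{a_f(c)}L(s,f)$. Call a real number $B$ admissible if it is larger than the abscissa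 of absolute convergence of $L(s,f)$ and $$\sum_{n>c}|a_f(n)|n^{-\sigma}\le\tfrac12|a_f(c)|c^{-\sigma}\qquad\text{for all }\sigma\ge B.$$ Then $L(s,f)$ continues to an entire function, admissible $B$ exist, and there are real numbers $1\le\lambda_1<\lambda_2<\cdots\to\infty$ and complex numbers $b_f(n)$ such that for every admissible $B$ $$\frac{\tilde L'(s,f)}{\tilde L(s,f)}=\sum_{n=1}^\infty\frac{b_f(n)}{\lambda_n^{s}}\qquad(\mathrm{Re}\,s\ge B),$$ with absolute convergence. Moreover, let $B$ be admissible, let $b>B$, and let $(\lambda_n)$, $(b_f(n))$ be any sequences as above for which this expansion holds for $\mathrm{Re}\,s\ge B$. For $T>0$ the function $L(s,f)$ has finitely many zeros inside the rectangle with vertices $B\pm iT$ and $k+\frac12-b\pm iT$. Let $x>0$, $x\neq1$, and let $d$ be the index with $x=\lambda_d$ or $x=\lambda_d^{-1}$ if there is one, and any index otherwise. Then, as $T\to\infty$, $$\sum_{|\gamma|<T}x^{\rho}=\frac{b_f(d)}{\pi}\left(\delta_{x,\lambda_d}+x^{k+\frac12}\delta_{x,\lambda_d^{-1}}\right)T+O(\log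 T),$$ where the sum runs, with multiplicity, over the zeros $\rho=\beta+i\gamma$ of $L(s,f)$ inside the rectangle with vertices $B\pm iT$ and $k+\frac12-b\pm iT$, and $\delta$ is Kronecker's delta. -/

import Mathlib

open UpperHalfPlane
open scoped MatrixGroups Manifold

noncomputable section

namespace HalfIntegral

/-- Shimura's extension `(c/d)` of the Jacobi symbol, for odd `d` of either sign. -/
def shimuraSymbol (c d : ℤ) : ℤ :=
  jacobiSym c d.natAbs * (if c < 0 ∧ d < 0 then -1 else 1)

/-- `ε_d`, for odd `d`: it is `1` if `d ≡ 1 mod 4` and `i` if `d ≡ 3 mod 4`. -/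
def eps (d : ℤ) : ℂ := if d % 4 = 1 then 1 else Complex.I

/-- `f ∈ S_{k+1/2}(Γ₀(4))`. Complex powers are principal, so
`w ^ (k + 1/2) = (w ^ (1/2)) ^ (2k+1)` with `-π/2 < arg (w ^ (1/2)) ≤ π/2`. -/
structure IsCuspForm (k : ℕ) (f : ℍ → ℂ) : Prop where
  holo : MDiff f
  /-- the transformation law under `Γ₀(4)` -/
  transform : ∀ γ ∈ CongruenceSubgroup.Gamma0 4, ∀ z : ℍ,
    f (γ • z) = (shimuraSymbol (γ 1 0) (γ 1 1) : ℂ) ^ (2 * k + 1)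
      * (eps (γ 1 1) ^ (2 * k + 1))⁻¹
      * (((γ 1 0 : ℤ) : ℂ) * (z : ℂ) + ((γ 1 1 : ℤ) : ℂ)) ^ ((k : ℂ) + 1 / 2) * f z
  /-- vanishing at every cusp -/
  zero_at_cusps : ∀ γ : SL(2, ℤ), IsZeroAtImInfty fun z : ℍ =>
    (((γ 1 0 : ℤ) : ℂ) * (z : ℂ) + ((γ 1 1 : ℤ) : ℂ)) ^ (-((k : ℂ) + 1 / 2)) * f (γ • z)

/-- The Fourier coefficients: `f z = ∑ fourierCoeff f n * exp (2 π i n z)`. -/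
def fourierCoeff (f : ℍ → ℂ) (n : ℕ) : ℂ := (qExpansion 1 f).coeff n

theorem fricke_im_pos (z : ℍ) : 0 < (-1 / (4 * (z : ℂ))).im := by
  have h : (-1 / (4 * (z : ℂ))).im = z.im / (4 * Complex.normSq (z : ℂ)) := by
    simp [Complex.div_im, Complex.normSq_mul]
    have := Complex.normSq_pos.mpr (UpperHalfPlane.ne_zero z)
    field_simp
  rw [h]
  have := Complex.normSq_pos.mpr (UpperHalfPlane.ne_zero z)
  have := z.im_pos
  positivity

/-- The Fricke operator:
`(f | W₄)(z) = i^{k+1/2} 2^{-k-1/2} z^{-k-1/2} f(-1/(4z))`. -/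
def fricke (k : ℕ) (f : ℍ → ℂ) (z : ℍ) : ℂ :=
  Complex.I ^ ((k : ℂ) + 1 / 2) * (2 : ℂ) ^ (-(k : ℂ) - 1 / 2) * (z : ℂ) ^ (-(k : ℂ) - 1 / 2)
    * f ⟨-1 / (4 * (z : ℂ)), fricke_im_pos z⟩

/-- `f` is an eigenform of the Fricke operator. -/
def IsFrickeEigen (k : ℕ) (f : ℍ → ℂ) : Prop := ∃ w : ℂ, ∀ z : ℍ, fricke k f z = w * f z

/-- The `n`-th Fourier coefficient of `T_{p²} f`, in weight `k + 1/2` and level `4` with trivial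
character, when `a` are the Fourier coefficients of `f`: it is
`a(p²n) + ((-1)^k n / p) p^{k-1} a(n) + p^{2k-1} a(n/p²)` for odd `p`, and `a(4n)` for `p = 2`. -/
def heckeCoeff (k p : ℕ) (a : ℕ → ℂ) (n : ℕ) : ℂ :=
  a (p ^ 2 * n) +
    if p = 2 then 0
    else (jacobiSym ((-1) ^ k * (n : ℤ)) p : ℂ) * (p : ℂ) ^ ((k : ℤ) - 1) * a n
      + (p : ℂ) ^ (2 * (k : ℤ) - 1) * (if p ^ 2 ∣ n then a (n / p ^ 2) else 0)

/-- `f` is an eigenform of all the Hecke operators `T_{p²}`, `p` prime; these generate the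
algebra of all `T_{n²}`. -/
def IsHeckeEigen (k : ℕ) (f : ℍ → ℂ) : Prop :=
  ∀ p : ℕ, p.Prime → ∃ μ : ℂ, ∀ n : ℕ, 1 ≤ n →
    heckeCoeff k p (fourierCoeff f) n = μ * fourierCoeff f n

/-- `L` is the analytic continuation to the whole plane of the Dirichlet series `∑ a(n) n^{-s}`. -/
structure IsEntireContinuation (a : ℕ → ℂ) (L : ℂ → ℂ) : Prop where
  entire : Differentiable ℂ L
  eq_series : ∀ s : ℂ, LSeries.abscissaOfAbsConv a < (s.re : EReal) → L s = LSeries a s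

/-- The least `c ≥ 1` with `a(c) ≠ 0`. -/
def firstIndex (a : ℕ → ℂ) : ℕ := sInf {n : ℕ | 1 ≤ n ∧ a n ≠ 0}

/-- `B` lies inside the half-plane of absolute convergence, and for every `σ ≥ B` the first term
of the Dirichlet series dominates: `∑_{n > c} |a(n)| n^{-σ} ≤ (1/2) |a(c)| c^{-σ}`. -/
structure IsAdmissible (a : ℕ → ℂ) (B : ℝ) : Prop where
  abs_conv : LSeries.abscissaOfAbsConv a < (B : EReal)
  dominates : ∀ σ : ℝ, B ≤ σ →
    ∑' n : ℕ, (if firstIndex a < n then ‖a n‖ * (n : ℝ) ^ (-σ) else 0)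
      ≤ 1 / 2 * (‖a (firstIndex a)‖ * (firstIndex a : ℝ) ^ (-σ))

/-- The normalized function `c^s / a(c) * L(s)`. -/
def normalized (a : ℕ → ℂ) (L : ℂ → ℂ) (s : ℂ) : ℂ :=
  (firstIndex a : ℂ) ^ s / a (firstIndex a) * L s

/-- `∑ b(n) λ_n^{-s}` is a generalized Dirichlet series, with frequencies `1 ≤ λ₀ < λ₁ < ⋯ → ∞`,
which for `Re s ≥ B` converges absolutely to the logarithmic derivative of `F`. -/
structure IsLogDerivExpansion (F : ℂ → ℂ) (B : ℝ) (lam : ℕ → ℝ) (b : ℕ → ℂ) : Prop where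
  one_le : ∀ n, 1 ≤ lam n
  strictMono : StrictMono lam
  tendsto : Filter.Tendsto lam Filter.atTop Filter.atTop
  hasSum : ∀ s : ℂ, B ≤ s.re → HasSum (fun n => b n * (lam n : ℂ) ^ (-s)) (logDeriv F s)

/-- The zeros of `L` inside the rectangle with vertices `σ₁ ± iT` and `σ₂ ± iT`. -/
def zerosIn (L : ℂ → ℂ) (σ₁ σ₂ T : ℝ) : Set ℂ :=
  {ρ | L ρ = 0 ∧ σ₁ < ρ.re ∧ ρ.re < σ₂ ∧ |ρ.im| < T}

/-- The sum of `x^ρ` over the zeros `ρ` of `L` inside the rectangle, with multiplicity. -/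
def zeroSum (L : ℂ → ℂ) (σ₁ σ₂ T x : ℝ) : ℂ :=
  ∑ᶠ ρ ∈ zerosIn L σ₁ σ₂ T, (analyticOrderNatAt L ρ : ℂ) * (x : ℂ) ^ ρ

/-- The Kronecker delta on the reals. -/
def delta (x y : ℝ) : ℝ := open Classical in if x = y then 1 else 0

end HalfIntegral

end

/-!
The proof is Landau's method for sums `∑ x ^ ρ` over zeros, carried out for the Dirichlet series of
a cusp form of half-integral weight `κ = k + 1/2`.

*From the form to the `L`-function.* Restricting `f` to the imaginary axis, the Fricke eigenvalue
equation becomes `φ(1/t) = w t ^ κ φ(t)` for `φ(t) = f(it/2)`, and `f` decays exponentially at the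
cusp. Hence the Mellin transform `Λ` of `φ` is entire, bounded in vertical strips, and satisfies
`Λ(κ - s) = w Λ(s)`; a polynomial bound for the Fourier coefficients identifies it with
`π ^ (-s) Γ(s) L(s)` (`IsCuspForm.exists_completed`).

*The expansion of `L'/L`.* The normalized series is `1 + E(s)`, where `E` is a generalized Dirichlet
series in the frequencies `n / c > 1`, of size at most `1/2` for `Re s ≥ B`. Expanding
`E' / (1 + E)` into a geometric series and collecting equal products of frequencies gives the
expansion (`exists_quotient_expansion`); the possible products form a locally finite set, so that
they can be listed in increasing order.

*The sum over zeros.* By the argument principle weighted by `x ^ s`, the sum is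
`(2πi)⁻¹ ∮ x ^ s L'/L(s) ds` (`rectIntegral_mul_logDeriv`).

On the right side of the rectangle the expansion is integrated termwise; only the frequency
`λ = x`, where `x ^ s λ ^ (-s)` does not oscillate, contributes more than `O(1)`. On the left side
the functional equation replaces `L'/L(s)` by `H(s) - L'/L(κ - s)`, where
`H(s) = 2 log π - ψ(s) - ψ(κ - s)`. The second term is treated as before and picks out
`λ = x⁻¹`. The term `H` is of logarithmic size and nearly invariant under `s ↦ s - 1`, while
`x ^ s` is multiplied by `x⁻¹ ≠ 1`; shifting the line of integration by one therefore bounds its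
contribution by `O(log T)` (`exists_norm_integral_cpow_mul_le_log`), without Stirling's formula.

For the horizontal sides one needs `∫ |L'/L(σ + iT')| dσ = O(log T)` for some `T'` in `[T, T + 1]`,
together with a bound `O(log T)` for the number of zeros between `T` and `T'`. Both follow from the
polynomial growth of `L` (Phragmén-Lindelöf, `HasFunctionalEquation.hasModerateGrowth`) through the
local partial fraction expansion of `L'/L` (`local_partial_fractions`): averaged over `T'`, each of
the `O(log T)` nearby poles contributes a bounded amount
(`HasModerateGrowth.exists_good_height`).
-/

namespace HalfIntegral

open Filter Topology Set

/-! ### Entire functions: factoring out zeros -/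

theorem analyticOrderAt_ne_top_of_entire {L : ℂ → ℂ} (hL : Differentiable ℂ L) (hL0 : L ≠ 0)
    (z : ℂ) : analyticOrderAt L z ≠ ⊤ := by
  obtain ⟨w, hw⟩ := Function.ne_iff.mp hL0
  have hA : AnalyticOnNhd ℂ L univ := fun z _ => hL.analyticAt z
  refine hA.analyticOrderAt_ne_top_of_isPreconnected isPreconnected_univ (mem_univ w) (mem_univ z) ?_
  rw [(hL.analyticAt w).analyticOrderAt_eq_zero.mpr hw]
  simp

/-- A nonzero entire function has finitely many zeros in a compact set. -/
theorem finite_zeros_of_isCompact {L : ℂ → ℂ} (hL : Differentiable ℂ L) (hL0 : L ≠ 0)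
    {K : Set ℂ} (hK : IsCompact K) : {z ∈ K | L z = 0}.Finite := by
  obtain ⟨w, hw⟩ := Function.ne_iff.mp hL0
  have hA : AnalyticOnNhd ℂ L univ := fun z _ => hL.analyticAt z
  have h := hA.preimage_zero_mem_codiscrete hw
  have h2 := hK.finite_sdiff_of_mem_codiscreteWithin (codiscreteWithin_mono (subset_univ K) h)
  refine h2.subset fun z hz => ⟨hz.1, by simpa using hz.2⟩

/-- An entire function divided by `(z - ρ) ^ m`, where `m` is its order of vanishing at `ρ`. -/
theorem exists_factor_of_entire {L : ℂ → ℂ} (hL : Differentiable ℂ L) {ρ : ℂ}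
    (hρ : analyticOrderAt L ρ ≠ ⊤) :
    ∃ g : ℂ → ℂ, Differentiable ℂ g ∧ g ρ ≠ 0 ∧
      ∀ z, L z = (z - ρ) ^ analyticOrderNatAt L ρ * g z := by
  obtain ⟨h, hh, hh0, hLh⟩ := (hL.analyticAt ρ).analyticOrderAt_ne_top.mp hρ
  set m := analyticOrderNatAt L ρ
  classical
  set g : ℂ → ℂ := fun z => if z = ρ then h ρ else L z / (z - ρ) ^ m with hg
  have hgh : g =ᶠ[𝓝 ρ] h := by
    filter_upwards [hLh] with z hz
    by_cases hzρ : z = ρ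
    · simp [hg, hzρ]
    · have : (z - ρ) ^ m ≠ 0 := pow_ne_zero _ (sub_ne_zero.mpr hzρ)
      simp only [hg, hzρ, if_false, hz, smul_eq_mul]
      field_simp
  refine ⟨g, fun z => ?_, by simpa [hg] using hh0, fun z => ?_⟩
  · by_cases hzρ : z = ρ
    · subst hzρ
      exact (hgh.differentiableAt_iff).mpr hh.differentiableAt
    · have h1 : g =ᶠ[𝓝 z] fun z => L z / (z - ρ) ^ m := by
        filter_upwards [isOpen_ne.mem_nhds hzρ] with y hy
        simp only [hg, show y ≠ ρ from hy, if_false]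
      refine h1.differentiableAt_iff.mpr ((hL z).div (by fun_prop) ?_)
      exact pow_ne_zero _ (sub_ne_zero.mpr hzρ)
  · by_cases hzρ : z = ρ
    · subst hzρ
      have := hLh.self_of_nhds
      simpa [hg] using this
    · have : (z - ρ) ^ m ≠ 0 := pow_ne_zero _ (sub_ne_zero.mpr hzρ)
      simp only [hg, hzρ, if_false]
      field_simp

/-- Factoring finitely many points out of an entire function. -/
theorem exists_entire_factorization {L : ℂ → ℂ} (hL : Differentiable ℂ L) (hL0 : L ≠ 0)
    (Z : Finset ℂ) :
    ∃ g : ℂ → ℂ, Differentiable ℂ g ∧ (∀ ρ ∈ Z, g ρ ≠ 0) ∧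
      ∀ z, L z = (∏ ρ ∈ Z, (z - ρ) ^ analyticOrderNatAt L ρ) * g z := by
  classical
  induction Z using Finset.induction_on with
  | empty => exact ⟨L, hL, by simp, by simp⟩
  | insert ρ Z hρ ih =>
    obtain ⟨g, hg, hgZ, hLg⟩ := ih
    set P : ℂ → ℂ := fun z => ∏ ρ ∈ Z, (z - ρ) ^ analyticOrderNatAt L ρ with hP
    have hPd : Differentiable ℂ P := by fun_prop
    have hPρ : P ρ ≠ 0 := Finset.prod_ne_zero_iff.mpr fun a ha =>
      pow_ne_zero _ (sub_ne_zero.mpr fun h => hρ (h ▸ ha))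
    have hord : analyticOrderAt L ρ = analyticOrderAt g ρ := by
      rw [show L = P * g from funext hLg,
        analyticOrderAt_mul (hPd.analyticAt ρ) (hg.analyticAt ρ),
        (hPd.analyticAt ρ).analyticOrderAt_eq_zero.mpr hPρ, zero_add]
    have htop := analyticOrderAt_ne_top_of_entire hL hL0 ρ
    obtain ⟨h, hh, hh0, hgh⟩ := exists_factor_of_entire hg (hord ▸ htop)
    have hordN : analyticOrderNatAt L ρ = analyticOrderNatAt g ρ := by
      simp only [analyticOrderNatAt, hord]
    refine ⟨h, hh, fun a ha => ?_, fun z => ?_⟩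
    · rcases Finset.mem_insert.mp ha with rfl | ha
      · exact hh0
      · intro h0
        exact hgZ a ha (by rw [hgh, h0, mul_zero])
    · rw [Finset.prod_insert hρ, hLg, hgh, hordN]
      ring

/-- The logarithmic derivative of an entire function with some of its zeros factored out. -/
theorem logDeriv_eq_sum_of_factorization {L g : ℂ → ℂ} (hg : Differentiable ℂ g) {Z : Finset ℂ}
    (hLg : ∀ z, L z = (∏ ρ ∈ Z, (z - ρ) ^ analyticOrderNatAt L ρ) * g z) {s : ℂ} (hs : L s ≠ 0)
    (hsZ : s ∉ Z) :
    logDeriv L s = ∑ ρ ∈ Z, (analyticOrderNatAt L ρ : ℂ) / (s - ρ) + logDeriv g s := by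
  have hprod : ∀ ρ ∈ Z, (s - ρ) ^ analyticOrderNatAt L ρ ≠ 0 := fun ρ hρ =>
    pow_ne_zero _ (sub_ne_zero.mpr fun h => hsZ (h ▸ hρ))
  have hgs : g s ≠ 0 := fun h => hs (by rw [hLg, h, mul_zero])
  conv_lhs => rw [show L = fun z => (∏ ρ ∈ Z, (z - ρ) ^ analyticOrderNatAt L ρ) * g z from
    funext hLg]
  rw [logDeriv_mul s (Finset.prod_ne_zero_iff.mpr hprod) hgs (by fun_prop) (hg s),
    logDeriv_prod hprod (fun ρ _ => by fun_prop)]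
  congr 1
  refine Finset.sum_congr rfl fun ρ hρ => ?_
  have hne : s - ρ ≠ 0 := sub_ne_zero.mpr fun h => hsZ (h ▸ hρ)
  rw [logDeriv_fun_pow (by fun_prop), logDeriv_apply]
  simp [div_eq_mul_inv]

/-! ### Rectangular contours -/

/-- The integral of `f` along the positively oriented boundary of the rectangle
`[a, b] × [c, d]`. -/
noncomputable def rectIntegral (f : ℂ → ℂ) (a b c d : ℝ) : ℂ :=
  (∫ x in a..b, f (x + c * Complex.I)) - (∫ x in a..b, f (x + d * Complex.I))
    + Complex.I * (∫ y in c..d, f (b + y * Complex.I))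
    - Complex.I * ∫ y in c..d, f (a + y * Complex.I)

theorem rectIntegral_eq_zero {f : ℂ → ℂ} {a b c d : ℝ}
    (hf : DifferentiableOn ℂ f (uIcc a b ×ℂ uIcc c d)) : rectIntegral f a b c d = 0 := by
  have := Complex.integral_boundary_rect_eq_zero_of_differentiableOn f ⟨a, c⟩ ⟨b, d⟩ hf
  simpa [rectIntegral] using this

/-- `∮ dz / (z - ρ) = 2πi` around a rectangle containing `ρ` in its interior. -/
theorem rectIntegral_inv_sub {a b c d : ℝ} {ρ : ℂ} (ha : a < ρ.re) (hb : ρ.re < b)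
    (hc : c < ρ.im) (hd : ρ.im < d) :
    rectIntegral (fun z => (z - ρ)⁻¹) a b c d = 2 * Real.pi * Complex.I := by
  have hH : ∀ y : ℝ, y ≠ ρ.im → ∫ x in a..b, ((x + y * Complex.I : ℂ) - ρ)⁻¹
      = Complex.log ((b + y * Complex.I : ℂ) - ρ) - Complex.log ((a + y * Complex.I : ℂ) - ρ) := by
    intro y hy
    have him : ∀ x : ℝ, ((x + y * Complex.I : ℂ) - ρ) ∈ Complex.slitPlane := fun x =>
      Or.inr (by simpa [sub_eq_zero] using hy)
    refine intervalIntegral.integral_eq_sub_of_hasDerivAt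
      (f := fun x : ℝ => Complex.log ((x + y * Complex.I : ℂ) - ρ)) (fun x _ => ?_) ?_
    · have h1 : HasDerivAt (fun x : ℝ => ((x + y * Complex.I : ℂ) - ρ)) 1 x :=
        ((Complex.ofRealCLM.hasDerivAt (x := x)).add_const _).sub_const _
      simpa [one_div] using h1.clog_real (him x)
    · refine (ContinuousOn.inv₀ (by fun_prop) fun x _ => ?_).intervalIntegrable
      exact Complex.slitPlane_ne_zero (him x)
  have hV : ∀ (σ : ℝ) (e : ℂ), (e = 1 ∨ e = -1) →
      (∀ y : ℝ, e * ((σ + y * Complex.I : ℂ) - ρ) ∈ Complex.slitPlane) →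
      Complex.I * ∫ y in c..d, ((σ + y * Complex.I : ℂ) - ρ)⁻¹
      = Complex.log (e * ((σ + d * Complex.I : ℂ) - ρ))
        - Complex.log (e * ((σ + c * Complex.I : ℂ) - ρ)) := by
    intro σ e he hsl
    have he0 : e ≠ 0 := by rcases he with rfl | rfl <;> simp
    rw [← intervalIntegral.integral_const_mul]
    refine intervalIntegral.integral_eq_sub_of_hasDerivAt
      (f := fun y : ℝ => Complex.log (e * ((σ + y * Complex.I : ℂ) - ρ))) (fun y _ => ?_) ?_
    · have h1 : HasDerivAt (fun y : ℝ => e * ((σ + y * Complex.I : ℂ) - ρ)) (e * Complex.I) y := by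
        have := ((((Complex.ofRealCLM.hasDerivAt (x := y)).mul_const Complex.I).const_add
          (σ : ℂ)).sub_const ρ).const_mul e
        simpa using this
      have h2 := h1.clog_real (hsl y)
      rwa [mul_div_mul_left _ _ he0, div_eq_mul_inv] at h2
    · refine (ContinuousOn.mul (by fun_prop) (ContinuousOn.inv₀ (by fun_prop)
        fun y _ h => ?_)).intervalIntegrable
      exact Complex.slitPlane_ne_zero (hsl y) (by rw [h, mul_zero])
  have hR := hV b 1 (Or.inl rfl) fun y => Or.inl (by simpa using hb)
  have hL := hV a (-1) (Or.inr rfl) fun y => Or.inl (by simpa using ha)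
  rw [rectIntegral, hH c hc.ne, hH d hd.ne', hR, hL]
  have e1 : Complex.log (-1 * ((a + d * Complex.I : ℂ) - ρ))
      = Complex.log ((a + d * Complex.I : ℂ) - ρ) - Real.pi * Complex.I := by
    rw [neg_one_mul, Complex.log, Complex.log, norm_neg,
      Complex.arg_neg_eq_arg_sub_pi_of_im_pos (by simpa using hd)]
    push_cast; ring
  have e2 : Complex.log (-1 * ((a + c * Complex.I : ℂ) - ρ))
      = Complex.log ((a + c * Complex.I : ℂ) - ρ) + Real.pi * Complex.I := by
    rw [neg_one_mul, Complex.log, Complex.log, norm_neg,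
      Complex.arg_neg_eq_arg_add_pi_of_im_neg (by simpa using hc)]
    push_cast; ring
  rw [e1, e2, one_mul, one_mul]
  ring

/-- `f` is continuous, as a function on the plane, at every boundary point of the rectangle
`[a, b] × [c, d]`. -/
def ContinuousOnSides (f : ℂ → ℂ) (a b c d : ℝ) : Prop :=
  ∀ z : ℂ, z.re ∈ Icc a b → z.im ∈ Icc c d → (z.re = a ∨ z.re = b ∨ z.im = c ∨ z.im = d) →
    ContinuousAt f z

theorem ContinuousOnSides.intervalIntegrable {f : ℂ → ℂ} {a b c d : ℝ} (hab : a ≤ b) (hcd : c ≤ d)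
    (hf : ContinuousOnSides f a b c d) :
    (∀ y, y = c ∨ y = d → IntervalIntegrable (fun x : ℝ => f (x + y * Complex.I))
      MeasureTheory.volume a b) ∧
    (∀ x, x = a ∨ x = b → IntervalIntegrable (fun y : ℝ => f (x + y * Complex.I))
      MeasureTheory.volume c d) := by
  constructor
  · intro y hy
    refine ContinuousOn.intervalIntegrable fun x hx => ContinuousAt.continuousWithinAt ?_
    rw [uIcc_of_le hab] at hx
    refine ContinuousAt.comp (f := fun x : ℝ => (x + y * Complex.I : ℂ)) (g := f) (hf _ ?_ ?_ ?_)
      (by fun_prop)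
    · simpa using hx
    · rcases hy with rfl | rfl <;> simpa using hcd
    · rcases hy with rfl | rfl <;> simp
  · intro x hx
    refine ContinuousOn.intervalIntegrable fun y hy => ContinuousAt.continuousWithinAt ?_
    rw [uIcc_of_le hcd] at hy
    refine ContinuousAt.comp (f := fun y : ℝ => (x + y * Complex.I : ℂ)) (g := f) (hf _ ?_ ?_ ?_)
      (by fun_prop)
    · rcases hx with rfl | rfl <;> simpa using hab
    · simpa using hy
    · rcases hx with rfl | rfl <;> simp

theorem rectIntegral_add {f g : ℂ → ℂ} {a b c d : ℝ} (hab : a ≤ b) (hcd : c ≤ d)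
    (hf : ContinuousOnSides f a b c d) (hg : ContinuousOnSides g a b c d) :
    rectIntegral (fun z => f z + g z) a b c d = rectIntegral f a b c d + rectIntegral g a b c d := by
  obtain ⟨f1, f2⟩ := hf.intervalIntegrable hab hcd
  obtain ⟨g1, g2⟩ := hg.intervalIntegrable hab hcd
  simp only [rectIntegral]
  rw [intervalIntegral.integral_add (f1 c (.inl rfl)) (g1 c (.inl rfl)),
    intervalIntegral.integral_add (f1 d (.inr rfl)) (g1 d (.inr rfl)),
    intervalIntegral.integral_add (f2 a (.inl rfl)) (g2 a (.inl rfl)),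
    intervalIntegral.integral_add (f2 b (.inr rfl)) (g2 b (.inr rfl))]
  ring

theorem rectIntegral_const_mul (e : ℂ) (f : ℂ → ℂ) (a b c d : ℝ) :
    rectIntegral (fun z => e * f z) a b c d = e * rectIntegral f a b c d := by
  simp only [rectIntegral, intervalIntegral.integral_const_mul]
  ring

theorem rectIntegral_sum {ι : Type*} (s : Finset ι) {f : ι → ℂ → ℂ} {a b c d : ℝ} (hab : a ≤ b)
    (hcd : c ≤ d) (hf : ∀ i ∈ s, ContinuousOnSides (f i) a b c d) :
    rectIntegral (fun z => ∑ i ∈ s, f i z) a b c d = ∑ i ∈ s, rectIntegral (f i) a b c d := by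
  classical
  induction s using Finset.induction_on with
  | empty => simp [rectIntegral]
  | insert i s hi ih =>
    simp only [Finset.sum_insert hi]
    rw [rectIntegral_add hab hcd (hf i (Finset.mem_insert_self i s)), ih]
    · exact fun j hj => hf j (Finset.mem_insert_of_mem hj)
    · intro z h1 h2 h3
      exact tendsto_finsetSum _ fun j hj => hf j (Finset.mem_insert_of_mem hj) z h1 h2 h3

/-- Congruence for contour integrals: only the values on the sides matter. -/
theorem rectIntegral_congr {f g : ℂ → ℂ} {a b c d : ℝ} (hab : a ≤ b) (hcd : c ≤ d)
    (h : ∀ z : ℂ, z.re ∈ Icc a b → z.im ∈ Icc c d →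
      (z.re = a ∨ z.re = b ∨ z.im = c ∨ z.im = d) → f z = g z) :
    rectIntegral f a b c d = rectIntegral g a b c d := by
  have e1 : ∀ y, y = c ∨ y = d → ∫ x in a..b, f (x + y * Complex.I)
      = ∫ x in a..b, g (x + y * Complex.I) := fun y hy => by
    refine intervalIntegral.integral_congr fun x hx => ?_
    rw [uIcc_of_le hab] at hx
    refine h _ (by simpa using hx) ?_ ?_
    · rcases hy with rfl | rfl <;> simpa using hcd
    · rcases hy with rfl | rfl <;> simp
  have e2 : ∀ x, x = a ∨ x = b → ∫ y in c..d, f (x + y * Complex.I)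
      = ∫ y in c..d, g (x + y * Complex.I) := fun x hx => by
    refine intervalIntegral.integral_congr fun y hy => ?_
    rw [uIcc_of_le hcd] at hy
    refine h _ ?_ (by simpa using hy) ?_
    · rcases hx with rfl | rfl <;> simpa using hab
    · rcases hx with rfl | rfl <;> simp
  simp only [rectIntegral, e1 c (.inl rfl), e1 d (.inr rfl), e2 a (.inl rfl), e2 b (.inr rfl)]

/-- Cauchy's formula for a rectangle. -/
theorem rectIntegral_div_sub {φ : ℂ → ℂ} (hφ : Differentiable ℂ φ) {a b c d : ℝ} {ρ : ℂ}
    (ha : a < ρ.re) (hb : ρ.re < b) (hc : c < ρ.im) (hd : ρ.im < d) :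
    rectIntegral (fun z => φ z / (z - ρ)) a b c d = 2 * Real.pi * Complex.I * φ ρ := by
  have hab := (ha.trans hb).le
  have hcd := (hc.trans hd).le
  have hne : ∀ z : ℂ, (z.re = a ∨ z.re = b ∨ z.im = c ∨ z.im = d) → z ≠ ρ := by
    rintro z h rfl
    rcases h with h | h | h | h <;> linarith
  have hds : Differentiable ℂ (dslope φ ρ) := by
    rw [← differentiableOn_univ, Complex.differentiableOn_dslope univ_mem, differentiableOn_univ]
    exact hφ
  have h1 : rectIntegral (fun z => φ z / (z - ρ)) a b c d
      = rectIntegral (fun z => φ ρ * (z - ρ)⁻¹ + dslope φ ρ z) a b c d := by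
    refine rectIntegral_congr hab hcd fun z _ _ hz => ?_
    have hz0 : z - ρ ≠ 0 := sub_ne_zero.mpr (hne z hz)
    rw [dslope_of_ne _ (hne z hz), slope_def_field]
    field_simp
    ring
  rw [h1, rectIntegral_add hab hcd, rectIntegral_const_mul, rectIntegral_inv_sub ha hb hc hd,
    rectIntegral_eq_zero hds.differentiableOn]
  · ring
  · intro z _ _ hz
    have hz0 : z - ρ ≠ 0 := sub_ne_zero.mpr (hne z hz)
    exact continuousAt_const.mul (ContinuousAt.inv₀ (by fun_prop) hz0)
  · exact fun z _ _ _ => hds.continuous.continuousAt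

/-- The argument principle, weighted by an entire function, for a rectangle whose boundary is free
of zeros. -/
theorem rectIntegral_mul_logDeriv {L φ : ℂ → ℂ} (hL : Differentiable ℂ L) (hφ : Differentiable ℂ φ)
    (hL0 : L ≠ 0) {a b c d : ℝ} (hab : a ≤ b) (hcd : c ≤ d) {Z : Finset ℂ}
    (hZ : ∀ z, z ∈ Z ↔ L z = 0 ∧ z.re ∈ Icc a b ∧ z.im ∈ Icc c d)
    (hZi : ∀ z ∈ Z, z.re ∈ Ioo a b ∧ z.im ∈ Ioo c d) :
    rectIntegral (fun z => φ z * logDeriv L z) a b c d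
      = 2 * Real.pi * Complex.I * ∑ ρ ∈ Z, (analyticOrderNatAt L ρ : ℂ) * φ ρ := by
  obtain ⟨g, hg, hgZ, hLg⟩ := exists_entire_factorization hL hL0 Z
  have hside : ∀ z : ℂ, (z.re = a ∨ z.re = b ∨ z.im = c ∨ z.im = d) → z ∉ Z := by
    intro z h hz
    obtain ⟨⟨h1, h2⟩, h3, h4⟩ := hZi z hz
    rcases h with h | h | h | h <;> linarith
  have hg0 : ∀ z : ℂ, z.re ∈ Icc a b → z.im ∈ Icc c d → g z ≠ 0 := by
    intro z h1 h2 h0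
    have hz : z ∈ Z := (hZ z).mpr ⟨by rw [hLg, h0, mul_zero], h1, h2⟩
    exact hgZ z hz h0
  have hdg : ∀ z, g z ≠ 0 → DifferentiableAt ℂ (fun z => φ z * logDeriv g z) z := fun z hz =>
    (hφ z).mul ((((hg.differentiableOn.deriv isOpen_univ).differentiableAt univ_mem)).div (hg z) hz)
  have hc1 : ∀ ρ ∈ Z, ContinuousOnSides
      (fun z => (analyticOrderNatAt L ρ : ℂ) * (φ z / (z - ρ))) a b c d := by
    intro ρ hρ z _ _ hz
    have hz0 : z - ρ ≠ 0 := sub_ne_zero.mpr fun h => hside z hz (h ▸ hρ)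
    exact continuousAt_const.mul (hφ.continuous.continuousAt.div (by fun_prop) hz0)
  have h1 : rectIntegral (fun z => φ z * logDeriv L z) a b c d
      = rectIntegral (fun z => (∑ ρ ∈ Z, (analyticOrderNatAt L ρ : ℂ) * (φ z / (z - ρ)))
        + φ z * logDeriv g z) a b c d := by
    refine rectIntegral_congr hab hcd fun z hz1 hz2 hz => ?_
    have hzZ := hside z hz
    have hLz : L z ≠ 0 := fun h => hzZ ((hZ z).mpr ⟨h, hz1, hz2⟩)
    rw [logDeriv_eq_sum_of_factorization hg hLg hLz hzZ, mul_add, Finset.mul_sum]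
    congr 1
    exact Finset.sum_congr rfl fun ρ _ => by ring
  rw [h1, rectIntegral_add hab hcd, rectIntegral_sum Z hab hcd hc1, rectIntegral_eq_zero
    (f := fun z => φ z * logDeriv g z), add_zero, Finset.mul_sum]
  · refine Finset.sum_congr rfl fun ρ hρ => ?_
    obtain ⟨⟨h1, h2⟩, h3, h4⟩ := hZi ρ hρ
    rw [rectIntegral_const_mul, rectIntegral_div_sub hφ h1 h2 h3 h4]
    ring
  · rw [uIcc_of_le hab, uIcc_of_le hcd]
    exact fun z hz => (hdg z (hg0 z hz.1 hz.2)).differentiableWithinAt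
  · intro z h1 h2 h3
    exact tendsto_finsetSum _ fun ρ hρ => hc1 ρ hρ z h1 h2 h3
  · intro z h1 h2 _
    exact (hdg z (hg0 z h1 h2)).continuousAt

end HalfIntegral

namespace HalfIntegral

open Filter Topology Set Metric

/-! ### Logarithmic derivative near a point: local partial fractions -/

/-- A zero-free holomorphic function on a disc of radius `2R` that exceeds its value at the centre
by at most a factor `exp Y` has logarithmic derivative `O(Y / R)` on the concentric disc of radius
`R` (Borel-Carathéodory applied to a logarithm). -/
theorem norm_logDeriv_le_of_zeroFree {g : ℂ → ℂ} (hg : Differentiable ℂ g) {s₀ : ℂ} {R Y : ℝ}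
    (hR : 0 < R) (hY : 0 < Y) (hg0 : ∀ z ∈ ball s₀ (2 * R), g z ≠ 0)
    (hgY : ∀ z ∈ ball s₀ (2 * R), ‖g z‖ ≤ Real.exp Y * ‖g s₀‖) {s : ℂ}
    (hs : s ∈ closedBall s₀ R) : ‖logDeriv g s‖ ≤ 12 / R * Y := by
  have hgd : Differentiable ℂ (deriv g) := fun z =>
    (hg.differentiableOn.deriv isOpen_univ).differentiableAt univ_mem
  have hld : DifferentiableOn ℂ (logDeriv g) (ball s₀ (2 * R)) := fun z hz =>
    ((hgd z).div (hg z) (hg0 z hz)).differentiableWithinAt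
  have hs0 : s₀ ∈ ball s₀ (2 * R) := mem_ball_self (by linarith)
  obtain ⟨ℓ, hℓ0, hℓ⟩ := hld.isExactOn_ball.with_val_at s₀ 0
  have hℓd : DifferentiableOn ℂ ℓ (ball s₀ (2 * R)) := fun z hz =>
    (hℓ z hz).differentiableAt.differentiableWithinAt
  -- `exp ℓ` and `g / g s₀` have the same logarithmic derivative and the same value at `s₀`
  have hexp : ∀ z ∈ ball s₀ (2 * R), g z * Complex.exp (-ℓ z) = g s₀ := by
    intro z hz
    have hder : ∀ y ∈ ball s₀ (2 * R),
        HasDerivAt (fun y => g y * Complex.exp (-ℓ y)) 0 y := by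
      intro y hy
      refine ((hg y).hasDerivAt.fun_mul (hℓ y hy).fun_neg.cexp).congr_deriv ?_
      rw [logDeriv_apply]
      have := hg0 y hy
      field_simp
      ring
    have := (convex_ball s₀ (2 * R)).is_const_of_fderivWithin_eq_zero (𝕜 := ℂ)
      (f := fun y => g y * Complex.exp (-ℓ y))
      (fun y hy => (hder y hy).differentiableAt.differentiableWithinAt) (fun y hy => by
        rw [fderivWithin_of_isOpen isOpen_ball hy]
        ext
        simpa using (hder y hy).deriv) hz hs0
    simpa [hℓ0] using this
  have hre : ∀ z ∈ ball s₀ (2 * R), (ℓ z).re ≤ Y := by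
    intro z hz
    have h1 := hgY z hz
    have h2 : ‖g s₀‖ * Real.exp (ℓ z).re = ‖g z‖ := by
      rw [← hexp z hz, norm_mul, Complex.norm_exp, Complex.neg_re, mul_assoc, ← Real.exp_add]
      simp
    rw [← h2, mul_comm] at h1
    exact Real.exp_le_exp.mp (le_of_mul_le_mul_right h1 (norm_pos_iff.mpr (hg0 s₀ hs0)))
  have hbc : ∀ z ∈ ball s₀ (2 * R), ‖ℓ z‖ ≤ 2 * Y * ‖z - s₀‖ / (2 * R - ‖z - s₀‖) := by
    intro z hz
    have hm : MapsTo (fun w : ℂ => w + s₀) (ball 0 (2 * R)) (ball s₀ (2 * R)) := fun w hw => by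
      simpa using hw
    have := Complex.borelCaratheodory_zero (f := fun w => ℓ (w + s₀)) (z := z - s₀) hY
      (hℓd.comp (by fun_prop) hm) (fun w hw => hre _ (hm hw)) (by linarith)
      (by simpa [dist_eq_norm] using hz) (by simpa using hℓ0)
    simpa using this
  have hsR : ‖s - s₀‖ ≤ R := by simpa [dist_eq_norm] using hs
  have hsub : closedBall s (R / 2) ⊆ ball s₀ (2 * R) := fun z hz => by
    rw [mem_closedBall, dist_eq_norm] at hz
    rw [mem_ball, dist_eq_norm]
    have := norm_add_le (z - s) (s - s₀)
    rw [sub_add_sub_cancel] at this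
    linarith
  have hsph : ∀ z ∈ sphere s (R / 2), ‖ℓ z‖ ≤ 6 * Y := by
    intro z hz
    have hz' := sphere_subset_closedBall hz
    refine (hbc z (hsub hz')).trans ?_
    rw [mem_sphere, dist_eq_norm] at hz
    have := norm_add_le (z - s) (s - s₀)
    rw [sub_add_sub_cancel] at this
    rw [div_le_iff₀ (by linarith)]
    nlinarith
  have hder := Complex.norm_deriv_le_of_forall_mem_sphere_norm_le (half_pos hR)
    ((hℓd.mono hsub).diffContOnCl_ball subset_rfl) hsph
  rw [(hℓ s (hsub (mem_closedBall_self (by linarith)))).deriv] at hder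
  refine hder.trans (le_of_eq ?_)
  field_simp
  norm_num

/-- Let `L` be entire and at most `exp Y` times as large on the disc of radius `6R` about `s₀` as at
its centre. Then `L` has at most `2Y` zeros in the disc of radius `2R`, and on the disc of radius
`R` its logarithmic derivative is `∑ m_ρ / (s - ρ)` over these zeros up to `O(Y / R)`. -/
theorem local_partial_fractions {L : ℂ → ℂ} (hL : Differentiable ℂ L) {s₀ : ℂ} {R Y : ℝ}
    (hR : 0 < R) (hY : 0 < Y) (h0 : L s₀ ≠ 0)
    (hLY : ∀ z ∈ closedBall s₀ (6 * R), ‖L z‖ ≤ Real.exp Y * ‖L s₀‖) {Z : Finset ℂ}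
    (hZ : ∀ z, z ∈ Z ↔ L z = 0 ∧ z ∈ closedBall s₀ (2 * R)) :
    (∑ ρ ∈ Z, (analyticOrderNatAt L ρ : ℝ)) ≤ 2 * Y ∧
    ∀ s ∈ closedBall s₀ R, L s ≠ 0 →
      ‖logDeriv L s - ∑ ρ ∈ Z, (analyticOrderNatAt L ρ : ℂ) / (s - ρ)‖ ≤ 12 / R * Y := by
  have hL0 : L ≠ 0 := fun h => h0 (by rw [h]; rfl)
  obtain ⟨g, hg, hgZ, hLg⟩ := exists_entire_factorization hL hL0 Z
  set N := ∑ ρ ∈ Z, analyticOrderNatAt L ρ with hN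
  have hs0 : s₀ ∈ closedBall s₀ (6 * R) := mem_closedBall_self (by linarith)
  have hgs0 : g s₀ ≠ 0 := fun h => h0 (by rw [hLg, h, mul_zero])
  -- on the circle of radius `6R` each factor `z - ρ` is at least twice as large as at the centre
  have hsphere : ∀ z ∈ sphere s₀ (6 * R), ‖g z‖ * 2 ^ N ≤ Real.exp Y * ‖g s₀‖ := by
    intro z hz
    have hP : (∏ ρ ∈ Z, ‖s₀ - ρ‖ ^ analyticOrderNatAt L ρ) * 2 ^ N
        ≤ ∏ ρ ∈ Z, ‖z - ρ‖ ^ analyticOrderNatAt L ρ := by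
      rw [hN, ← Finset.prod_pow_eq_pow_sum, ← Finset.prod_mul_distrib]
      refine Finset.prod_le_prod (fun ρ _ => by positivity) fun ρ hρ => ?_
      rw [← mul_pow]
      refine pow_le_pow_left₀ (by positivity) ?_ _
      have h1 : ‖s₀ - ρ‖ ≤ 2 * R := by
        have := ((hZ ρ).mp hρ).2
        rwa [mem_closedBall, dist_comm, dist_eq_norm] at this
      have h2 : ‖z - s₀‖ = 6 * R := by simpa [dist_eq_norm] using hz
      have h3 := norm_sub_le (z - ρ) (s₀ - ρ)
      rw [sub_sub_sub_cancel_right] at h3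
      linarith
    have hP0 : 0 < ∏ ρ ∈ Z, ‖s₀ - ρ‖ ^ analyticOrderNatAt L ρ := by
      refine Finset.prod_pos fun ρ hρ => pow_pos (norm_pos_iff.mpr (sub_ne_zero.mpr ?_)) _
      rintro rfl
      exact h0 ((hZ _).mp hρ).1
    have h4 := hLY z (sphere_subset_closedBall hz)
    rw [hLg z, hLg s₀, norm_mul, norm_mul, norm_prod, norm_prod] at h4
    simp only [norm_pow] at h4
    have h5 := (mul_le_mul_of_nonneg_right hP (norm_nonneg (g z))).trans h4
    refine le_of_mul_le_mul_left ?_ hP0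
    linarith
  have hball : ∀ z ∈ closedBall s₀ (6 * R), ‖g z‖ ≤ Real.exp Y * ‖g s₀‖ / 2 ^ N := by
    intro z hz
    have hcl : closure (ball s₀ (6 * R)) = closedBall s₀ (6 * R) := closure_ball _ (by positivity)
    refine Complex.norm_le_of_forall_mem_frontier_norm_le (isBounded_ball (x := s₀) (r := 6 * R))
      hg.diffContOnCl (fun w hw => ?_) (hcl ▸ hz)
    rw [frontier_ball _ (by positivity)] at hw
    rw [le_div_iff₀ (by positivity)]
    exact hsphere w hw
  have hexp1 : Real.exp Y * ‖g s₀‖ / 2 ^ N ≤ Real.exp Y * ‖g s₀‖ :=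
    div_le_self (by positivity) (one_le_pow₀ (by norm_num))
  refine ⟨?_, fun s hs hLs => ?_⟩
  · have h1 := hball s₀ hs0
    rw [le_div_iff₀ (by positivity), mul_comm] at h1
    have h2 : (2 : ℝ) ^ N ≤ Real.exp Y := le_of_mul_le_mul_right h1 (norm_pos_iff.mpr hgs0)
    have h3 : N * Real.log 2 ≤ Y := by
      have := Real.log_le_log (by positivity) h2
      rwa [Real.log_pow, Real.log_exp] at this
    have h4 := Real.log_two_gt_d9
    have h5 : ((N : ℕ) : ℝ) = ∑ ρ ∈ Z, (analyticOrderNatAt L ρ : ℝ) := by rw [hN]; push_cast; rfl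
    rw [← h5]
    nlinarith [Nat.cast_nonneg (α := ℝ) N]
  · have hsZ : s ∉ Z := fun h => hLs ((hZ s).mp h).1
    rw [logDeriv_eq_sum_of_factorization hg hLg hLs hsZ, add_sub_cancel_left]
    refine norm_logDeriv_le_of_zeroFree hg hR hY (fun z hz h => ?_) (fun z hz => ?_) hs
    · have hzZ : z ∈ Z := (hZ z).mpr ⟨by rw [hLg, h, mul_zero], ball_subset_closedBall hz⟩
      exact hgZ z hzZ h
    · exact (hball z (closedBall_subset_closedBall (by linarith)
        (ball_subset_closedBall hz))).trans hexp1

end HalfIntegral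

namespace HalfIntegral

open Filter Topology Set Metric MeasureTheory

/-! ### Logarithmic derivatives on average over horizontal lines -/

/-- `L` is entire, of polynomial growth on every right half-plane, and bounded away from zero on the
line `Re s = B`. -/
structure HasModerateGrowth (L : ℂ → ℂ) (B : ℝ) : Prop where
  entire : Differentiable ℂ L
  lower : ∃ m > 0, ∀ t : ℝ, m ≤ ‖L (B + t * Complex.I)‖
  growth : ∀ a : ℝ, ∃ (C : ℝ) (A : ℕ), ∀ s : ℂ, a ≤ s.re → ‖L s‖ ≤ C * (1 + |s.im|) ^ A

namespace HasModerateGrowth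

variable {L : ℂ → ℂ} {B : ℝ}

theorem ne_zero_at (h : HasModerateGrowth L B) (t : ℝ) : L (B + t * Complex.I) ≠ 0 := by
  obtain ⟨m, hm, hL⟩ := h.lower
  exact norm_pos_iff.mp (hm.trans_le (hL t))

theorem ne_zero (h : HasModerateGrowth L B) : L ≠ 0 := fun h0 =>
  h.ne_zero_at 0 (by rw [h0]; rfl)

theorem exists_exp_log_bound (h : HasModerateGrowth L B) (R : ℝ) :
    ∃ C > 0, ∀ T : ℝ, 2 ≤ |T| → ∀ z ∈ closedBall (B + T * Complex.I : ℂ) R,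
      ‖L z‖ ≤ Real.exp (C * Real.log |T|) * ‖L (B + T * Complex.I)‖ := by
  obtain ⟨m, hm, hL⟩ := h.lower
  obtain ⟨C, A, hC⟩ := h.growth (B - R)
  have hl2 : 0 < Real.log 2 := Real.log_pos (by norm_num)
  -- `|C| (1 + R + |T|) ^ A / m ≤ exp (D log |T|)` for `|T| ≥ 2`
  set K := |C| * (2 + |R|) ^ A / m + 1 with hK
  have hK1 : 1 ≤ K := by rw [hK]; have : 0 ≤ |C| * (2 + |R|) ^ A / m := by positivity
                         linarith
  refine ⟨A + Real.log K / Real.log 2 + 1, by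
    have := Real.log_nonneg hK1
    positivity, fun T hT z hz => ?_⟩
  have hT0 : 0 < |T| := by linarith
  have hlT : Real.log 2 ≤ Real.log |T| := Real.log_le_log (by norm_num) hT
  rw [mem_closedBall, dist_eq_norm] at hz
  have h1 : |z.re - B| ≤ R := by
    have := (Complex.abs_re_le_norm _).trans hz
    simpa using this
  have h2 : |z.im - T| ≤ R := by
    have := (Complex.abs_im_le_norm _).trans hz
    simpa using this
  have h3 : |z.im| ≤ |T| + |R| := by
    have := abs_sub_abs_le_abs_sub z.im T
    have := le_abs_self R
    linarith
  have h4 : ‖L z‖ ≤ |C| * (1 + |z.im|) ^ A :=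
    (hC z (by have := (abs_le.mp h1).1; linarith)).trans
      (mul_le_mul_of_nonneg_right (le_abs_self C) (by positivity))
  have h5 : (1 + |z.im|) ^ A ≤ ((2 + |R|) * |T|) ^ A := by
    refine pow_le_pow_left₀ (by positivity) ?_ A
    nlinarith [abs_nonneg R]
  have h6 : Real.exp ((A + Real.log K / Real.log 2 + 1) * Real.log |T|) ≥ K * |T| ^ A := by
    have h7 : K * |T| ^ A = Real.exp (Real.log K + A * Real.log |T|) := by
      rw [Real.exp_add, Real.exp_log (by linarith), ← Real.log_pow,
        Real.exp_log (by positivity)]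
    rw [h7]
    refine Real.exp_le_exp.mpr ?_
    have h8 : Real.log K ≤ Real.log K / Real.log 2 * Real.log |T| := by
      rw [div_mul_eq_mul_div, le_div_iff₀ hl2]
      exact mul_le_mul_of_nonneg_left hlT (Real.log_nonneg hK1)
    nlinarith
  have h9 : |C| * (2 + |R|) ^ A ≤ K * m := by
    rw [hK, add_mul, div_mul_cancel₀ _ hm.ne']
    linarith
  calc ‖L z‖ ≤ |C| * ((2 + |R|) * |T|) ^ A :=
        h4.trans (mul_le_mul_of_nonneg_left h5 (abs_nonneg C))
    _ = (|C| * (2 + |R|) ^ A) * |T| ^ A := by rw [mul_pow]; ring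
    _ ≤ (K * m) * |T| ^ A := mul_le_mul_of_nonneg_right h9 (by positivity)
    _ = (K * |T| ^ A) * m := by ring
    _ ≤ _ := mul_le_mul h6 (hL T) hm.le (by positivity)

/-- The zeros of `L` in a closed disc. -/
noncomputable def zerosBall (h : HasModerateGrowth L B) (s : ℂ) (R : ℝ) : Finset ℂ :=
  (finite_zeros_of_isCompact h.entire h.ne_zero (isCompact_closedBall s R)).toFinset

theorem mem_zerosBall (h : HasModerateGrowth L B) {s : ℂ} {R : ℝ} {z : ℂ} :
    z ∈ h.zerosBall s R ↔ L z = 0 ∧ z ∈ closedBall s R := by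
  simp [zerosBall, and_comm]

/-- Near height `T`, the function `L` has `O(log |T|)` zeros, and `L'/L` is given by its principal
parts at these zeros up to `O(log |T|)`. -/
theorem partial_fractions (h : HasModerateGrowth L B) {R : ℝ} (hR : 0 < R) :
    ∃ C > 0, ∀ T : ℝ, 2 ≤ |T| →
      (∑ ρ ∈ h.zerosBall (B + T * Complex.I) (2 * R), (analyticOrderNatAt L ρ : ℝ))
        ≤ C * Real.log |T| ∧
      ∀ s ∈ closedBall (B + T * Complex.I : ℂ) R, L s ≠ 0 →
        ‖logDeriv L s - ∑ ρ ∈ h.zerosBall (B + T * Complex.I) (2 * R),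
          (analyticOrderNatAt L ρ : ℂ) / (s - ρ)‖ ≤ C * Real.log |T| := by
  obtain ⟨C, hC, hb⟩ := h.exists_exp_log_bound (6 * R)
  refine ⟨max (2 * C) (12 / R * C), by positivity, fun T hT => ?_⟩
  have hl : 0 < Real.log |T| := Real.log_pos (by linarith)
  obtain ⟨h1, h2⟩ := local_partial_fractions h.entire hR (mul_pos hC hl) (h.ne_zero_at T)
    (hb T hT) (Z := h.zerosBall (B + T * Complex.I) (2 * R)) (fun z => h.mem_zerosBall)
  refine ⟨h1.trans ?_, fun s hs hLs => (h2 s hs hLs).trans ?_⟩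
  · rw [← mul_assoc]
    exact mul_le_mul_of_nonneg_right (le_max_left _ _) hl.le
  · rw [← mul_assoc]
    exact mul_le_mul_of_nonneg_right (le_max_right _ _) hl.le

end HasModerateGrowth

/-- `x ↦ |x - β|^{-1/2}` is integrable on bounded intervals, uniformly in `β`. -/
theorem exists_lintegral_inv_sqrt_le (ℓ : ℝ) :
    ∃ K : ℝ, 0 ≤ K ∧ ∀ u v β : ℝ, v - u ≤ ℓ →
      ∫⁻ x in Icc u v, (ENNReal.ofReal (√|x - β|))⁻¹ ≤ ENNReal.ofReal K := by
  set f : ℝ → ENNReal := fun y => (ENNReal.ofReal (√|y|))⁻¹ with hf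
  have hfm : Measurable f := by
    refine Measurable.inv ?_
    fun_prop
  set g : ℝ → ENNReal := (Icc (-1 : ℝ) 1).indicator f with hg
  have hgm : Measurable g := hfm.indicator measurableSet_Icc
  have hfin : ∫⁻ y, g y ≠ ⊤ := by
    rw [hg, lintegral_indicator measurableSet_Icc]
    have h1 : IntervalIntegrable (fun x : ℝ => (x : ℂ) ^ (-1 / 2 : ℂ)) volume (-1) 1 :=
      intervalIntegral.intervalIntegrable_cpow' (by norm_num)
    rw [intervalIntegrable_iff_integrableOn_Icc_of_le (by norm_num)] at h1
    have h2 := h1.2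
    rw [HasFiniteIntegral] at h2
    refine (lt_of_le_of_lt (lintegral_mono_ae ?_) h2).ne
    have h0 : ∀ᵐ x : ℝ ∂(volume.restrict (Icc (-1 : ℝ) 1)), x ≠ 0 :=
      ae_restrict_of_ae (Measure.ae_ne volume 0)
    filter_upwards [h0] with x hx
    have hx' : 0 < |x| := abs_pos.mpr hx
    have e1 : ‖(x : ℂ) ^ (-1 / 2 : ℂ)‖ = (√|x|)⁻¹ := by
      rw [show (-1 / 2 : ℂ) = ((-1 / 2 : ℝ) : ℂ) by push_cast; ring,
        Complex.norm_cpow_real, Complex.norm_real, Real.norm_eq_abs,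
        Real.sqrt_eq_rpow, ← Real.rpow_neg hx'.le]
      norm_num
    rw [hf, ← ofReal_norm, e1, ENNReal.ofReal_inv_of_pos (Real.sqrt_pos.mpr hx')]
  refine ⟨|ℓ| + (∫⁻ y, g y).toReal, by positivity, fun u v β huv => ?_⟩
  have hle : ∀ y, f y ≤ 1 + g y := by
    intro y
    by_cases hy : y ∈ Icc (-1 : ℝ) 1
    · rw [hg, indicator_of_mem hy]; exact le_add_self
    · refine le_add_right ?_
      rw [hf, ENNReal.inv_le_one, ENNReal.one_le_ofReal, Real.one_le_sqrt]
      by_contra hlt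
      push Not at hlt
      exact hy ⟨(abs_lt.mp hlt).1.le, (abs_lt.mp hlt).2.le⟩
  calc ∫⁻ x in Icc u v, f (x - β) ≤ ∫⁻ x in Icc u v, (1 + g (x - β)) :=
        lintegral_mono fun x => hle _
    _ = volume (Icc u v) + ∫⁻ x in Icc u v, g (x - β) := by
        rw [lintegral_add_left measurable_const]; simp
    _ ≤ ENNReal.ofReal |ℓ| + ∫⁻ x, g (x - β) := by
        refine add_le_add ?_ (setLIntegral_le_lintegral _ _)
        rw [Real.volume_Icc]
        exact ENNReal.ofReal_le_ofReal (huv.trans (le_abs_self ℓ))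
    _ = ENNReal.ofReal |ℓ| + ∫⁻ x, g x := by rw [lintegral_sub_right_eq_self]
    _ = _ := by
        rw [ENNReal.ofReal_add (abs_nonneg _) ENNReal.toReal_nonneg, ENNReal.ofReal_toReal hfin]

/-- By the inequality of arithmetic and geometric means `|x + iy|⁻¹ ≤ |x|^{-1/2} |y|^{-1/2}`, a
majorant that is a product of integrable functions of one variable. -/
theorem enorm_inv_le (z : ℂ) :
    ‖z⁻¹‖ₑ ≤ (ENNReal.ofReal (√|z.re|))⁻¹ * (ENNReal.ofReal (√|z.im|))⁻¹ := by
  by_cases hz : z = 0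
  · simp [hz]
  rw [enorm_inv hz, ← ENNReal.mul_inv (Or.inr ENNReal.ofReal_ne_top)
    (Or.inl ENNReal.ofReal_ne_top), ENNReal.inv_le_inv, ← ENNReal.ofReal_mul (Real.sqrt_nonneg _),
    ← ofReal_norm]
  refine ENNReal.ofReal_le_ofReal ?_
  rw [← Real.sqrt_mul (abs_nonneg _)]
  refine Real.sqrt_le_iff.mpr ⟨norm_nonneg _, ?_⟩
  rw [sq]
  exact mul_le_mul (Complex.abs_re_le_norm z) (Complex.abs_im_le_norm z) (abs_nonneg _)
    (norm_nonneg _)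

namespace HasModerateGrowth

variable {L : ℂ → ℂ} {B : ℝ}

/-- The integral of `|L'/L|` over a box of height two at height `T` is `O(log |T|)`: each of the
`O(log |T|)` zeros nearby contributes a bounded amount. -/
theorem lintegral_logDeriv_le (h : HasModerateGrowth L B) {a : ℝ} (ha : a ≤ B) :
    ∃ C > 0, ∀ T : ℝ, 2 ≤ |T| →
      ∫⁻ t in Icc (T - 1) (T + 1), ∫⁻ σ in Icc a B, ‖logDeriv L (σ + t * Complex.I)‖ₑ
        ≤ ENNReal.ofReal (C * Real.log |T|) := by
  obtain ⟨C, hC, hpf⟩ := h.partial_fractions (R := B - a + 1) (by linarith)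
  obtain ⟨K₁, hK₁, hK₁'⟩ := exists_lintegral_inv_sqrt_le (B - a)
  obtain ⟨K₂, hK₂, hK₂'⟩ := exists_lintegral_inv_sqrt_le 2
  refine ⟨C * (K₁ * K₂) + 2 * (B - a) * C + 1, by
    have : 0 ≤ B - a := by linarith
    positivity, fun T hT => ?_⟩
  have hl : 0 < Real.log |T| := Real.log_pos (by linarith)
  obtain ⟨hN, hs⟩ := hpf T hT
  set Z := h.zerosBall (B + T * Complex.I) (2 * (B - a + 1)) with hZ
  set F : ℂ → ℝ → ℝ → ENNReal := fun ρ t σ => (analyticOrderNatAt L ρ : ENNReal) *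
    ((ENNReal.ofReal (√|σ - ρ.re|))⁻¹ * (ENNReal.ofReal (√|t - ρ.im|))⁻¹) with hF
  have hpt : ∀ t ∈ Icc (T - 1) (T + 1), ∀ σ ∈ Icc a B, ‖logDeriv L (σ + t * Complex.I)‖ₑ
      ≤ (∑ ρ ∈ Z, F ρ t σ) + ENNReal.ofReal (C * Real.log |T|) := by
    intro t ht σ hσ
    set s : ℂ := σ + t * Complex.I with hsdef
    by_cases hLs : L s = 0
    · rw [logDeriv_apply, hLs, div_zero, enorm_zero]; exact zero_le
    have hsb : s ∈ closedBall (B + T * Complex.I : ℂ) (B - a + 1) := by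
      rw [mem_closedBall, dist_eq_norm]
      refine (Complex.norm_le_abs_re_add_abs_im _).trans ?_
      have e1 : |σ - B| ≤ B - a := abs_le.mpr ⟨by linarith [hσ.1], by linarith [hσ.2]⟩
      have e2 : |t - T| ≤ 1 := abs_le.mpr ⟨by linarith [ht.1], by linarith [ht.2]⟩
      simpa [hsdef] using add_le_add e1 e2
    have h1 := hs s hsb hLs
    calc ‖logDeriv L s‖ₑ = ‖(∑ ρ ∈ Z, (analyticOrderNatAt L ρ : ℂ) / (s - ρ))
          + (logDeriv L s - ∑ ρ ∈ Z, (analyticOrderNatAt L ρ : ℂ) / (s - ρ))‖ₑ := by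
            rw [add_sub_cancel]
      _ ≤ _ := enorm_add_le _ _
      _ ≤ _ := by
        refine add_le_add ((enorm_sum_le _ _).trans (Finset.sum_le_sum fun ρ _ => ?_)) ?_
        · rw [div_eq_mul_inv, enorm_mul, hF]
          refine mul_le_mul' ?_ ((enorm_inv_le _).trans (by simp [hsdef]))
          rw [← ofReal_norm]; simp
        · rw [← ofReal_norm]
          exact ENNReal.ofReal_le_ofReal h1
  have hFm : ∀ ρ t, Measurable (F ρ t) := fun ρ t => by
    simp only [hF]
    fun_prop
  have hFint : ∀ ρ, ∫⁻ t in Icc (T - 1) (T + 1), ∫⁻ σ in Icc a B, F ρ t σ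
      ≤ (analyticOrderNatAt L ρ : ENNReal) * ENNReal.ofReal (K₁ * K₂) := by
    intro ρ
    simp only [hF]
    simp_rw [lintegral_const_mul' _ _ (ENNReal.natCast_ne_top _)]
    refine mul_le_mul_right ?_ _
    have e1 : ∀ t : ℝ, ∫⁻ σ in Icc a B, (ENNReal.ofReal (√|σ - ρ.re|))⁻¹
        * (ENNReal.ofReal (√|t - ρ.im|))⁻¹
        = (∫⁻ σ in Icc a B, (ENNReal.ofReal (√|σ - ρ.re|))⁻¹)
          * (ENNReal.ofReal (√|t - ρ.im|))⁻¹ := fun t =>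
      lintegral_mul_const _ (by fun_prop)
    simp_rw [e1]
    rw [lintegral_const_mul _ (by fun_prop), ENNReal.ofReal_mul hK₁]
    exact mul_le_mul' (hK₁' _ _ _ le_rfl) (hK₂' _ _ _ (by linarith))
  have hFm2 : ∀ ρ, Measurable fun t => ∫⁻ σ in Icc a B, F ρ t σ := fun ρ => by
    simp only [hF]
    simp_rw [lintegral_const_mul' _ _ (ENNReal.natCast_ne_top _)]
    refine Measurable.const_mul (Measurable.lintegral_prod_right' (f := fun p : ℝ × ℝ =>
      (ENNReal.ofReal (√|p.2 - ρ.re|))⁻¹ * (ENNReal.ofReal (√|p.1 - ρ.im|))⁻¹) ?_) _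
    fun_prop
  calc ∫⁻ t in Icc (T - 1) (T + 1), ∫⁻ σ in Icc a B, ‖logDeriv L (σ + t * Complex.I)‖ₑ
      ≤ ∫⁻ t in Icc (T - 1) (T + 1), ∫⁻ σ in Icc a B,
          ((∑ ρ ∈ Z, F ρ t σ) + ENNReal.ofReal (C * Real.log |T|)) :=
        setLIntegral_mono' measurableSet_Icc fun t ht =>
          setLIntegral_mono' measurableSet_Icc fun σ hσ => hpt t ht σ hσ
    _ = (∑ ρ ∈ Z, ∫⁻ t in Icc (T - 1) (T + 1), ∫⁻ σ in Icc a B, F ρ t σ)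
        + ENNReal.ofReal (C * Real.log |T|) * ENNReal.ofReal (B - a) * ENNReal.ofReal 2 := by
        simp_rw [lintegral_add_right _ measurable_const,
          lintegral_finsetSum _ (fun ρ _ => hFm ρ _)]
        rw [lintegral_finsetSum _ (fun ρ _ => hFm2 ρ)]
        simp only [lintegral_const, MeasurableSet.univ, Measure.restrict_apply, univ_inter,
          Real.volume_Icc]
        congr 3
        ring
    _ ≤ (∑ ρ ∈ Z, (analyticOrderNatAt L ρ : ENNReal) * ENNReal.ofReal (K₁ * K₂))
        + ENNReal.ofReal (C * Real.log |T|) * ENNReal.ofReal (B - a) * ENNReal.ofReal 2 :=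
        add_le_add (Finset.sum_le_sum fun ρ _ => hFint ρ) le_rfl
    _ = ENNReal.ofReal ((∑ ρ ∈ Z, (analyticOrderNatAt L ρ : ℝ)) * (K₁ * K₂)
        + C * Real.log |T| * (B - a) * 2) := by
        have hBa : 0 ≤ B - a := by linarith
        rw [ENNReal.ofReal_add (by positivity) (by positivity),
          ENNReal.ofReal_mul (p := C * Real.log |T| * (B - a)) (by positivity),
          ENNReal.ofReal_mul (p := C * Real.log |T|) (by positivity), ← Finset.sum_mul,
          ENNReal.ofReal_mul (Finset.sum_nonneg fun _ _ => Nat.cast_nonneg _),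
          ENNReal.ofReal_sum_of_nonneg (fun _ _ => Nat.cast_nonneg _)]
        simp
    _ ≤ _ := by
        refine ENNReal.ofReal_le_ofReal ?_
        have := mul_le_mul_of_nonneg_right hN (mul_nonneg hK₁ hK₂)
        nlinarith

end HasModerateGrowth

end HalfIntegral

namespace HalfIntegral

open Filter Topology Set Metric MeasureTheory

theorem continuousAt_logDeriv {L : ℂ → ℂ} (hL : Differentiable ℂ L) {z : ℂ} (hz : L z ≠ 0) :
    ContinuousAt (logDeriv L) z :=
  (((hL.differentiableOn.deriv isOpen_univ).differentiableAt univ_mem).div (hL z) hz).continuousAt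

/-- Heights `T'` at which the horizontal sides of the contour contribute only `O(log T)`. -/
theorem HasModerateGrowth.exists_good_height {L : ℂ → ℂ} {B : ℝ} (h : HasModerateGrowth L B)
    {a : ℝ} (ha : a ≤ B) :
    ∃ C > 0, ∀ T : ℝ, 2 ≤ T → ∃ T' ∈ Icc T (T + 1),
      (∀ z, L z = 0 → z.re ∈ Icc a B → |z.im| ≠ T') ∧
      (∫ σ in a..B, ‖logDeriv L (σ + T' * Complex.I)‖) ≤ C * Real.log T ∧
      (∫ σ in a..B, ‖logDeriv L (σ + (-T' : ℝ) * Complex.I)‖) ≤ C * Real.log T := by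
  obtain ⟨C, hC, hbd⟩ := h.lintegral_logDeriv_le ha
  refine ⟨2 * C, by positivity, fun T hT => ?_⟩
  have hl : 0 < Real.log T := Real.log_pos (by linarith)
  have hTabs : |T| = T := abs_of_pos (by linarith)
  set G : ℝ → ENNReal := fun t => ∫⁻ σ in Icc a B, ‖logDeriv L (σ + t * Complex.I)‖ₑ with hG
  have hmL : Measurable (logDeriv L) :=
    (measurable_deriv L).div h.entire.continuous.measurable
  have hGm : Measurable G := by
    refine Measurable.lintegral_prod_right' (f := fun p : ℝ × ℝ =>
      ‖logDeriv L (p.2 + p.1 * Complex.I)‖ₑ) ?_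
    exact (hmL.comp (by fun_prop)).enorm
  have h1 : ∫⁻ t in Icc T (T + 1), G t ≤ ENNReal.ofReal (C * Real.log T) := by
    have := hbd T (by rw [hTabs]; exact hT)
    rw [hTabs] at this
    exact (lintegral_mono_set (Icc_subset_Icc (by linarith) le_rfl)).trans this
  have h2 : ∫⁻ t in Icc T (T + 1), G (-t) ≤ ENNReal.ofReal (C * Real.log T) := by
    have := hbd (-T) (by rw [abs_neg, hTabs]; exact hT)
    rw [abs_neg, hTabs] at this
    refine le_trans (le_of_eq ?_) ((lintegral_mono_set (μ := volume)
      (Icc_subset_Icc (show -T - 1 ≤ -(T + 1) by linarith)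
        (show -T ≤ -T + 1 by linarith))).trans this)
    rw [← lintegral_indicator measurableSet_Icc, ← lintegral_indicator measurableSet_Icc,
      ← lintegral_neg_eq_self]
    refine lintegral_congr fun t => ?_
    by_cases ht : t ∈ Icc (-(T + 1)) (-T)
    · rw [indicator_of_mem ht, indicator_of_mem (show -t ∈ Icc T (T + 1) from
        ⟨by linarith [ht.2], by linarith [ht.1]⟩), neg_neg]
    · rw [indicator_of_notMem ht, indicator_of_notMem fun h' => ht
        ⟨by linarith [h'.2], by linarith [h'.1]⟩]
  -- some height outside the null set of heights of zeros does not exceed the average over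
  -- `[T, T + 1]`
  have hfin : {z ∈ Icc a B ×ℂ Icc (-(T + 1)) (T + 1) | L z = 0}.Finite :=
    finite_zeros_of_isCompact h.entire h.ne_zero (isCompact_Icc.reProdIm isCompact_Icc)
  set bad : Set ℝ := (fun z : ℂ => |z.im|) '' {z ∈ Icc a B ×ℂ Icc (-(T + 1)) (T + 1) | L z = 0}
  set μ : Measure ℝ := volume.restrict (Icc T (T + 1)) with hμ
  have hμ1 : μ univ = 1 := by simp [hμ]
  have hμ0 : μ ≠ 0 := fun h0 => by simp [h0] at hμ1
  have hnull : μ (bad ∪ (Icc T (T + 1))ᶜ) = 0 := by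
    refine measure_union_null ?_ ?_
    · exact le_antisymm ((Measure.restrict_apply_le _ _).trans ((hfin.image _).measure_zero volume).le)
        zero_le
    · rw [hμ, Measure.restrict_apply measurableSet_Icc.compl]
      simp
  obtain ⟨T', hT', hle⟩ := exists_notMem_null_le_laverage (f := fun t => G t + G (-t)) hμ0
    (by fun_prop) hnull
  have hmem : T' ∈ Icc T (T + 1) := by
    by_contra hc
    exact hT' (Or.inr hc)
  have hT'0 : 0 < T' := by linarith [hmem.1]
  have hz : ∀ z, L z = 0 → z.re ∈ Icc a B → |z.im| ≠ T' := by
    intro z hz0 hzre hzim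
    refine hT' (Or.inl ⟨z, ⟨⟨hzre, ?_⟩, hz0⟩, hzim⟩)
    exact abs_le.mp (by rw [hzim]; exact hmem.2)
  have hsum : G T' + G (-T') ≤ ENNReal.ofReal (2 * C * Real.log T) := by
    refine hle.trans ?_
    rw [laverage_eq, hμ1, div_one, lintegral_add_left hGm]
    refine (add_le_add h1 h2).trans (le_of_eq ?_)
    rw [← ENNReal.ofReal_add (by positivity) (by positivity)]
    congr 1; ring
  have hconv : ∀ t : ℝ, |t| = T' →
      G t ≤ ENNReal.ofReal (2 * C * Real.log T) →
      (∫ σ in a..B, ‖logDeriv L (σ + t * Complex.I)‖) ≤ 2 * C * Real.log T := by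
    intro t ht hGt
    have hcont : ContinuousOn (fun σ : ℝ => logDeriv L (σ + t * Complex.I)) (Icc a B) := by
      intro σ hσ
      refine ContinuousAt.continuousWithinAt ?_
      refine ContinuousAt.comp (f := fun σ : ℝ => (σ + t * Complex.I : ℂ)) (g := logDeriv L)
        (continuousAt_logDeriv h.entire fun h0 => ?_) (by fun_prop)
      exact hz _ h0 (by simpa using hσ) (by simpa using ht)
    rw [intervalIntegral.integral_of_le ha, ← integral_Icc_eq_integral_Ioc]
    have hint : IntegrableOn (fun σ : ℝ => logDeriv L (σ + t * Complex.I)) (Icc a B) :=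
      hcont.integrableOn_compact isCompact_Icc
    rw [integral_norm_eq_lintegral_enorm hint.1]
    exact ENNReal.toReal_le_of_le_ofReal (by positivity) hGt
  refine ⟨T', hmem, hz, hconv T' (abs_of_pos hT'0) (le_self_add.trans hsum),
    hconv (-T') (by rw [abs_neg, abs_of_pos hT'0]) (le_add_self.trans hsum)⟩

/-! ### Vertical sides: oscillating integrals -/

theorem norm_integral_exp_le {u : ℝ} (hu : u ≠ 0) (a b : ℝ) :
    ‖∫ t in a..b, Complex.exp (u * t * Complex.I)‖ ≤ 2 / |u| := by
  have hc : (u * Complex.I : ℂ) ≠ 0 := by simp [hu]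
  have h1 : ∀ t : ℝ, Complex.exp (u * t * Complex.I) = Complex.exp ((u * Complex.I) * t) :=
    fun t => by ring_nf
  simp_rw [h1]
  rw [integral_exp_mul_complex hc, norm_div]
  have h2 : ‖(u * Complex.I : ℂ)‖ = |u| := by simp
  rw [h2]
  gcongr
  refine (norm_sub_le _ _).trans (le_of_eq ?_)
  rw [Complex.norm_exp, Complex.norm_exp]
  norm_num

/-- The mean value of an absolutely convergent series of oscillations `β n * exp (i u n t)` with
frequencies bounded away from zero, except possibly for `u d = 0`. -/
theorem exists_norm_integral_tsum_exp_le {β : ℕ → ℂ} {u : ℕ → ℝ} (hβ : Summable fun n => ‖β n‖)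
    {δ : ℝ} (hδ : 0 < δ) (hu : ∀ n, u n = 0 ∨ δ ≤ |u n|) {d : ℕ} (hd : ∀ n, u n = 0 → n = d) :
    ∃ C, ∀ T : ℝ, ‖(∫ t in (-T)..T, ∑' n, β n * Complex.exp (u n * t * Complex.I))
      - (if u d = 0 then β d else 0) * (2 * T)‖ ≤ C := by
  refine ⟨∑' n, ‖β n‖ * (2 / δ), fun T => ?_⟩
  have hnorm : ∀ n (t : ℝ), ‖β n * Complex.exp (u n * t * Complex.I)‖ = ‖β n‖ := by
    intro n t
    rw [norm_mul, show (u n * t * Complex.I : ℂ) = ((u n * t : ℝ) : ℂ) * Complex.I by push_cast; rfl,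
      Complex.norm_exp_ofReal_mul_I, mul_one]
  have hS : HasSum (fun n => ∫ t in (-T)..T, β n * Complex.exp (u n * t * Complex.I))
      (∫ t in (-T)..T, ∑' n, β n * Complex.exp (u n * t * Complex.I)) := by
    refine intervalIntegral.hasSum_integral_of_dominated_convergence (fun n _ => ‖β n‖)
      (fun n => Continuous.aestronglyMeasurable (by fun_prop))
      (fun n => ae_of_all _ fun t _ => (hnorm n t).le) (ae_of_all _ fun t _ => hβ) ?_
      (ae_of_all _ fun t _ => (Summable.of_norm (by simpa only [hnorm] using hβ)).hasSum)
    simp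
  have hM : HasSum (fun n => (if u n = 0 then β n else 0) * (2 * T : ℂ))
      ((if u d = 0 then β d else 0) * (2 * T)) := by
    refine hasSum_single d fun n hn => ?_
    rw [if_neg fun h => hn (hd n h), zero_mul]
  have hD := hS.sub hM
  rw [← hD.tsum_eq]
  refine tsum_of_norm_bounded (hβ.mul_right _).hasSum fun n => ?_
  rw [intervalIntegral.integral_const_mul]
  rcases eq_or_ne (u n) 0 with h0 | h0
  · simp only [h0, Complex.ofReal_zero, zero_mul, Complex.exp_zero, if_true,
      intervalIntegral.integral_const, Complex.real_smul]
    rw [← mul_sub]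
    push_cast
    rw [show ((T : ℂ) - -T) * 1 - 2 * T = 0 by ring]
    simp only [mul_zero, norm_zero]
    positivity
  · rw [if_neg h0, zero_mul, sub_zero, norm_mul]
    refine mul_le_mul_of_nonneg_left ((norm_integral_exp_le h0 _ _).trans ?_) (norm_nonneg _)
    exact div_le_div_of_nonneg_left (by norm_num) hδ ((hu n).resolve_left h0)

theorem norm_ofReal_cpow {x : ℝ} (hx : 0 < x) (s : ℂ) : ‖(x : ℂ) ^ s‖ = x ^ s.re :=
  Complex.norm_cpow_eq_rpow_re_of_pos hx s

theorem differentiable_ofReal_cpow {x : ℝ} (hx : 0 < x) :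
    Differentiable ℂ fun s : ℂ => (x : ℂ) ^ s := fun s =>
  (differentiableAt_id).const_cpow (Or.inl (by exact_mod_cast hx.ne'))

theorem rpow_le_add {x : ℝ} (hx : 0 < x) {a b σ : ℝ} (h : σ ∈ Icc a b) : x ^ σ ≤ x ^ a + x ^ b := by
  rcases le_total 1 x with h1 | h1
  · have := Real.rpow_le_rpow_of_exponent_le h1 h.2
    have := Real.rpow_nonneg hx.le a
    linarith
  · have := Real.rpow_le_rpow_of_exponent_ge hx h1 h.1
    have := Real.rpow_nonneg hx.le b
    linarith

/-- Shifting the line of integration by one multiplies `x ^ s` by `x⁻¹ ≠ 1`, so that an almost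
periodic `H` has small integral against `x ^ s`. -/
theorem norm_integral_cpow_mul_le {H : ℂ → ℂ} {σ x t₁ t₂ K E : ℝ} (hx : 0 < x) (ht : t₁ ≤ t₂)
    (hH : ∀ z : ℂ, z.re ∈ Icc (σ - 1) σ → z.im ∈ Icc t₁ t₂ → DifferentiableAt ℂ H z)
    (hK : ∀ z : ℂ, z.re ∈ Icc (σ - 1) σ → (z.im = t₁ ∨ z.im = t₂) → ‖H z‖ ≤ K)
    (hE : ‖∫ y in t₁..t₂, (x : ℂ) ^ (σ + y * Complex.I : ℂ) *
      (H (σ + y * Complex.I) - H (σ + y * Complex.I - 1))‖ ≤ E) :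
    |1 - x⁻¹| * ‖∫ y in t₁..t₂, (x : ℂ) ^ (σ + y * Complex.I : ℂ) * H (σ + y * Complex.I)‖
      ≤ 2 * ((x ^ (σ - 1) + x ^ σ) * K) + x⁻¹ * E := by
  have hxc : (x : ℂ) ≠ 0 := by exact_mod_cast hx.ne'
  set f : ℂ → ℂ := fun s => (x : ℂ) ^ s * H s with hf
  have hfd : ∀ z : ℂ, z.re ∈ Icc (σ - 1) σ → z.im ∈ Icc t₁ t₂ → DifferentiableAt ℂ f z :=
    fun z h1 h2 => (differentiable_ofReal_cpow hx z).mul (hH z h1 h2)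
  have hrect : rectIntegral f (σ - 1) σ t₁ t₂ = 0 := by
    refine rectIntegral_eq_zero fun z hz => (hfd z ?_ ?_).differentiableWithinAt
    · have := hz.1; rwa [uIcc_of_le (by linarith)] at this
    · have := hz.2; rwa [uIcc_of_le ht] at this
  have hhor : ∀ y, (y = t₁ ∨ y = t₂) →
      ‖∫ v in (σ - 1)..σ, f (v + y * Complex.I)‖ ≤ (x ^ (σ - 1) + x ^ σ) * K := by
    intro y hy
    refine (intervalIntegral.norm_integral_le_of_norm_le_const
      (C := (x ^ (σ - 1) + x ^ σ) * K) fun v hv => ?_).trans (le_of_eq ?_)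
    · rw [uIoc_of_le (by linarith)] at hv
      have hv' : v ∈ Icc (σ - 1) σ := ⟨hv.1.le, hv.2⟩
      rw [hf, norm_mul, norm_ofReal_cpow hx]
      refine mul_le_mul ?_ (hK _ (by simpa using hv') (by simpa using hy)) (norm_nonneg _)
        (by positivity)
      simpa using rpow_le_add hx hv'
    · rw [show σ - (σ - 1) = 1 by ring, abs_one, mul_one]
  have hcont : ∀ v ∈ Icc (σ - 1) σ, IntervalIntegrable (fun y : ℝ => f (v + y * Complex.I))
      volume t₁ t₂ := by
    intro v hv
    refine ContinuousOn.intervalIntegrable fun y hy => ContinuousAt.continuousWithinAt ?_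
    rw [uIcc_of_le ht] at hy
    exact ContinuousAt.comp (f := fun y : ℝ => (v + y * Complex.I : ℂ)) (g := f)
      (hfd _ (by simpa using hv) (by simpa using hy)).continuousAt (by fun_prop)
  set J := ∫ y in t₁..t₂, f (σ + y * Complex.I) with hJ
  have hleft : ∫ y in t₁..t₂, f ((σ - 1 : ℝ) + y * Complex.I)
      = (x : ℂ)⁻¹ * J - (x : ℂ)⁻¹ * ∫ y in t₁..t₂, (x : ℂ) ^ (σ + y * Complex.I : ℂ) *
      (H (σ + y * Complex.I) - H (σ + y * Complex.I - 1)) := by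
    have e1 : ∀ y : ℝ, f ((σ - 1 : ℝ) + y * Complex.I) = (x : ℂ)⁻¹ * f (σ + y * Complex.I)
        - (x : ℂ)⁻¹ * ((x : ℂ) ^ (σ + y * Complex.I : ℂ) *
      (H (σ + y * Complex.I) - H (σ + y * Complex.I - 1))) := by
      intro y
      have e2 : (((σ - 1 : ℝ) : ℂ) + y * Complex.I) = (σ + y * Complex.I) - 1 := by
        push_cast; ring
      rw [hf]
      simp only [e2]
      rw [Complex.cpow_sub _ _ hxc, Complex.cpow_one]
      field_simp
      ring
    have hi1 := (hcont (σ - 1) ⟨le_rfl, by linarith⟩)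
    have hi2 := (hcont σ ⟨by linarith, le_rfl⟩).const_mul (x : ℂ)⁻¹
    have hi3 : IntervalIntegrable (fun y : ℝ => (x : ℂ)⁻¹ * ((x : ℂ) ^ (σ + y * Complex.I : ℂ) *
      (H (σ + y * Complex.I) - H (σ + y * Complex.I - 1)))) volume t₁ t₂ := by
      have := hi2.sub hi1
      refine this.congr fun y _ => ?_
      simp only [e1]
      ring
    simp_rw [e1]
    rw [intervalIntegral.integral_sub hi2 hi3, intervalIntegral.integral_const_mul,
      intervalIntegral.integral_const_mul]
  set D := ∫ y in t₁..t₂, (x : ℂ) ^ (σ + y * Complex.I : ℂ) *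
      (H (σ + y * Complex.I) - H (σ + y * Complex.I - 1))
  rw [rectIntegral, hleft] at hrect
  have hkey : Complex.I * ((1 - (x : ℂ)⁻¹) * J) =
      (∫ v in (σ - 1)..σ, f (v + t₂ * Complex.I)) - (∫ v in (σ - 1)..σ, f (v + t₁ * Complex.I))
      - Complex.I * ((x : ℂ)⁻¹ * D) := by
    linear_combination hrect
  have hn := congrArg norm hkey
  rw [norm_mul, Complex.norm_I, one_mul, norm_mul,
    show (1 - (x : ℂ)⁻¹) = ((1 - x⁻¹ : ℝ) : ℂ) by push_cast; rfl, Complex.norm_real,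
    Real.norm_eq_abs] at hn
  rw [hn]
  refine (norm_sub_le _ _).trans (add_le_add ((norm_sub_le _ _).trans ?_) ?_)
  · linarith [hhor t₁ (.inl rfl), hhor t₂ (.inr rfl)]
  · rw [norm_mul, Complex.norm_I, one_mul, norm_mul, norm_inv, Complex.norm_real,
      Real.norm_of_nonneg hx.le]
    exact mul_le_mul_of_nonneg_left hE (by positivity)

theorem norm_integral_le_log {g : ℝ → ℂ} {C T : ℝ} (hT : 2 ≤ T) (hC : 0 ≤ C)
    (hg : ∀ y, 2 ≤ |y| → ‖g y‖ ≤ C / |y|) :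
    ‖∫ y in (2 : ℝ)..T, g y‖ ≤ C * Real.log T ∧ ‖∫ y in (-T)..(-2), g y‖ ≤ C * Real.log T := by
  have main : ∀ g : ℝ → ℂ, (∀ y, 2 ≤ |y| → ‖g y‖ ≤ C / |y|) →
      ‖∫ y in (2 : ℝ)..T, g y‖ ≤ C * Real.log T := by
    intro g hg
    have h1 : ∫ y in (2 : ℝ)..T, C * y⁻¹ = C * Real.log (T / 2) := by
      rw [intervalIntegral.integral_const_mul, integral_inv_of_pos (by norm_num) (by linarith)]
    refine (intervalIntegral.norm_integral_le_of_norm_le hT (g := fun y => C * y⁻¹)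
      (ae_of_all _ fun y hy => ?_) ?_).trans ?_
    · have hy0 : 0 < y := by linarith [hy.1]
      have := hg y (by rw [abs_of_pos hy0]; exact hy.1.le)
      rwa [abs_of_pos hy0, div_eq_mul_inv] at this
    · refine ContinuousOn.intervalIntegrable fun y hy => ContinuousAt.continuousWithinAt ?_
      rw [uIcc_of_le hT] at hy
      exact continuousAt_const.mul (continuousAt_inv₀ (by linarith [hy.1]))
    · rw [h1]
      refine mul_le_mul_of_nonneg_left (Real.log_le_log (by linarith) (by linarith)) hC
  refine ⟨main g hg, ?_⟩
  have := main (fun y => g (-y)) fun y hy => by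
    have := hg (-y) (by rwa [abs_neg])
    rwa [abs_neg] at this
  rwa [intervalIntegral.integral_comp_neg] at this

/-- If `H` is of logarithmic size and changes by `O(1 / |Im s|)` under `s ↦ s - 1`, then the
integrals of `x ^ s * H s` along vertical segments are of logarithmic size. -/
theorem exists_norm_integral_cpow_mul_le_log {H : ℂ → ℂ} {σ x C : ℝ} (hx : 0 < x) (hx1 : x ≠ 1)
    (hC : 0 ≤ C)
    (hH : ∀ z : ℂ, z.re ∈ Icc (σ - 1) σ → 2 ≤ |z.im| → DifferentiableAt ℂ H z)
    (hlog : ∀ z : ℂ, z.re ∈ Icc (σ - 1) σ → 2 ≤ |z.im| → ‖H z‖ ≤ C * Real.log |z.im|)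
    (hshift : ∀ z : ℂ, z.re = σ → 2 ≤ |z.im| → ‖H z - H (z - 1)‖ ≤ C / |z.im|) :
    ∃ D, ∀ T : ℝ, 2 ≤ T →
      ‖∫ y in (2 : ℝ)..T, (x : ℂ) ^ (σ + y * Complex.I : ℂ) * H (σ + y * Complex.I)‖
        ≤ D * Real.log T ∧
      ‖∫ y in (-T)..(-2), (x : ℂ) ^ (σ + y * Complex.I : ℂ) * H (σ + y * Complex.I)‖
        ≤ D * Real.log T := by
  have hx' : 0 < |1 - x⁻¹| := abs_pos.mpr (sub_ne_zero.mpr fun h => hx1 (by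
    rw [← inv_inv x, ← h, inv_one]))
  refine ⟨(2 * ((x ^ (σ - 1) + x ^ σ) * C) + x⁻¹ * (x ^ σ * C)) / |1 - x⁻¹|, fun T hT => ?_⟩
  have hT0 : |T| = T := abs_of_pos (by linarith)
  have hlogT : Real.log 2 ≤ Real.log T := Real.log_le_log (by norm_num) hT
  obtain ⟨he1, he2⟩ := norm_integral_le_log (g := fun y => (x : ℂ) ^ (σ + y * Complex.I : ℂ) *
      (H (σ + y * Complex.I) - H (σ + y * Complex.I - 1))) hT (C := x ^ σ * C) (by positivity)
      (fun y hy => by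
        rw [norm_mul, norm_ofReal_cpow hx, mul_div_assoc]
        have := hshift (σ + y * Complex.I) (by simp) (by simpa using hy)
        have e : (σ + y * Complex.I : ℂ).re = σ := by simp
        rw [e]
        refine mul_le_mul_of_nonneg_left ?_ (by positivity)
        simpa using this)
  have hK : ∀ z : ℂ, z.re ∈ Icc (σ - 1) σ → (|z.im| = 2 ∨ |z.im| = T) →
      ‖H z‖ ≤ C * Real.log T := by
    intro z hz hzi
    refine (hlog z hz (by rcases hzi with h | h <;> rw [h]; exact hT)).trans ?_
    refine mul_le_mul_of_nonneg_left ?_ hC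
    rcases hzi with h | h <;> rw [h]
    exact hlogT
  have habs : ∀ y : ℝ, y ∈ Icc (2 : ℝ) T ∨ y ∈ Icc (-T) (-2) → 2 ≤ |y| := by
    rintro y (h | h)
    · exact h.1.trans (le_abs_self y)
    · exact (by linarith [h.2] : 2 ≤ -y).trans (neg_le_abs y)
  have r1 := norm_integral_cpow_mul_le hx hT
    (fun z h1 h2 => hH z h1 (habs _ (.inl h2)))
    (fun z h1 h2 => hK z h1 (by
      rcases h2 with h | h <;> rw [h]
      · left; norm_num
      · right; exact hT0)) he1
  have r2 := norm_integral_cpow_mul_le hx (show -T ≤ -2 by linarith)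
    (fun z h1 h2 => hH z h1 (habs _ (.inr h2)))
    (fun z h1 h2 => hK z h1 (by
      rcases h2 with h | h <;> rw [h, abs_neg]
      · right; exact hT0
      · left; norm_num)) he2
  constructor
  · rw [div_mul_eq_mul_div, le_div_iff₀ hx']
    linarith
  · rw [div_mul_eq_mul_div, le_div_iff₀ hx']
    linarith

end HalfIntegral

namespace HalfIntegral

open Filter Topology Set Metric MeasureTheory

/-! ### The Gamma function on vertical lines -/

theorem Gamma_add_natCast {s : ℂ} (n : ℕ) (hs : ∀ j < n, s + j ≠ 0) :
    Complex.Gamma (s + n) = (∏ j ∈ Finset.range n, (s + j)) * Complex.Gamma s := by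
  induction n with
  | zero => simp
  | succ n ih =>
    rw [Finset.prod_range_succ, Nat.cast_succ, ← add_assoc, Complex.Gamma_add_one _ (hs n (by simp)),
      ih fun j hj => hs j (hj.trans (by simp))]
    ring

theorem norm_sin_le (z : ℂ) : ‖Complex.sin z‖ ≤ Real.exp |z.im| := by
  rw [Complex.sin, norm_div, norm_mul, Complex.norm_I, mul_one, Complex.norm_ofNat]
  rw [div_le_iff₀ (by norm_num)]
  refine (norm_sub_le _ _).trans ?_
  rw [Complex.norm_exp, Complex.norm_exp]
  have h1 : (-z * Complex.I).re = z.im := by simp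
  have h2 : (z * Complex.I).re = -z.im := by simp
  rw [h1, h2]
  have := Real.exp_le_exp.mpr (le_abs_self z.im)
  have := Real.exp_le_exp.mpr (neg_le_abs z.im)
  linarith

theorem norm_Gamma_le {s : ℂ} (hs : 0 < s.re) : ‖Complex.Gamma s‖ ≤ Real.Gamma s.re := by
  rw [Complex.Gamma_eq_integral hs, Complex.GammaIntegral, Real.Gamma_eq_integral hs]
  refine (norm_integral_le_integral_norm _).trans (le_of_eq ?_)
  refine setIntegral_congr_fun measurableSet_Ioi fun x hx => ?_
  simp only [norm_mul]
  rw [norm_ofReal_cpow hx]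
  simp [Complex.norm_exp]

theorem Gamma_ne_zero_of_im_ne_zero {s : ℂ} (hs : s.im ≠ 0) : Complex.Gamma s ≠ 0 :=
  Complex.Gamma_ne_zero fun m h => hs (by rw [h]; simp)

/-- A crude bound for `1/Γ` in vertical strips, by the reflection formula. -/
theorem exists_norm_inv_Gamma_le (a b : ℝ) :
    ∃ C, ∀ s : ℂ, s.re ∈ Icc a b → 1 ≤ |s.im| →
      ‖(Complex.Gamma s)⁻¹‖ ≤ C * Real.exp (Real.pi * |s.im|) := by
  obtain ⟨N, hN⟩ := exists_nat_gt b
  have hcont : ContinuousOn (fun σ : ℝ => Real.Gamma (1 - σ + N)) (Icc a b) := by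
    intro σ hσ
    refine ContinuousAt.continuousWithinAt ?_
    refine ContinuousAt.comp (f := fun σ : ℝ => 1 - σ + N) (g := Real.Gamma) ?_ (by fun_prop)
    refine (Real.differentiableAt_Gamma fun m => ?_).continuousAt
    have : 0 < 1 - σ + N := by linarith [hσ.2]
    have : (0 : ℝ) ≤ m := Nat.cast_nonneg m
    intro h
    linarith
  obtain ⟨C, hC⟩ := isCompact_Icc.exists_bound_of_continuousOn hcont
  refine ⟨C / Real.pi, fun s hs hi => ?_⟩
  have him : s.im ≠ 0 := fun h => by rw [h] at hi; norm_num at hi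
  have him1 : (1 - s).im ≠ 0 := by simpa using him
  have hG := Gamma_ne_zero_of_im_ne_zero him
  have hG1 := Gamma_ne_zero_of_im_ne_zero him1
  have hrefl := Complex.Gamma_mul_Gamma_one_sub s
  have hpi : (Real.pi : ℂ) ≠ 0 := by exact_mod_cast Real.pi_ne_zero
  have hsin : Complex.sin (Real.pi * s) ≠ 0 := by
    intro h0
    rw [h0, div_zero] at hrefl
    exact mul_ne_zero hG hG1 hrefl
  have hinv : (Complex.Gamma s)⁻¹ = Complex.Gamma (1 - s) * Complex.sin (Real.pi * s) / Real.pi := by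
    rw [eq_div_iff hsin] at hrefl
    rw [eq_div_iff hpi, inv_mul_eq_iff_eq_mul₀ hG]
    linear_combination -hrefl
  have h1 : ‖Complex.Gamma (1 - s)‖ ≤ C := by
    have hne : ∀ j : ℕ, 1 ≤ ‖(1 - s + j : ℂ)‖ := fun j => by
      have := Complex.abs_im_le_norm (1 - s + j : ℂ)
      have e : |(1 - s + j : ℂ).im| = |s.im| := by simp
      rw [e] at this
      linarith
    have h2 := Gamma_add_natCast (s := 1 - s) N fun j _ h => by
      have := hne j
      rw [h, norm_zero] at this
      norm_num at this
    have h3 : ‖Complex.Gamma (1 - s)‖ ≤ ‖Complex.Gamma (1 - s + N)‖ := by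
      rw [h2, norm_mul, norm_prod]
      exact le_mul_of_one_le_left (norm_nonneg _) (by
        simpa using Finset.prod_le_prod (s := Finset.range N) (f := fun _ => (1 : ℝ))
          (fun _ _ => zero_le_one) fun j _ => hne j)
    have hre : (1 - s + N : ℂ).re = 1 - s.re + N := by simp
    refine h3.trans ((norm_Gamma_le (by rw [hre]; linarith [hs.2])).trans ?_)
    rw [hre]
    exact (le_abs_self _).trans (hC s.re hs)
  rw [hinv, norm_div, norm_mul, Complex.norm_real, Real.norm_of_nonneg Real.pi_nonneg,
    div_mul_eq_mul_div]
  have h4 := norm_sin_le (Real.pi * s)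
  have h5 : |(Real.pi * s : ℂ).im| = Real.pi * |s.im| := by
    simp [abs_mul, abs_of_pos Real.pi_pos]
  rw [h5] at h4
  have hC0 : 0 ≤ C := (norm_nonneg _).trans h1
  gcongr

/-- The Beta integral tends to zero along vertical lines (Riemann-Lebesgue). -/
theorem tendsto_betaIntegral_zero (σ : ℝ) (v : ℂ) :
    Tendsto (fun t : ℝ => Complex.betaIntegral (σ + t * Complex.I) v) atTop (𝓝 0) := by
  set g : ℝ → ℂ := (Ioc (0 : ℝ) 1).indicator fun x => (1 - x : ℂ) ^ (v - 1) with hg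
  have h1 : ∀ u : ℂ, Complex.betaIntegral u v = mellin g u := by
    intro u
    rw [Complex.betaIntegral, mellin, intervalIntegral.integral_of_le zero_le_one, hg]
    rw [← integral_indicator measurableSet_Ioc, ← integral_indicator measurableSet_Ioi]
    refine integral_congr_ae (ae_of_all _ fun x => ?_)
    by_cases hx : x ∈ Ioc (0 : ℝ) 1
    · simp [indicator_of_mem hx, indicator_of_mem (show x ∈ Ioi (0 : ℝ) from hx.1)]
    · by_cases hx0 : x ∈ Ioi (0 : ℝ)
      · simp [indicator_of_notMem hx, indicator_of_mem hx0]
      · simp [indicator_of_notMem hx, indicator_of_notMem hx0]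
  have h2 : ∀ t : ℝ, Complex.betaIntegral (σ + t * Complex.I) v
      = FourierTransform.fourier (fun y : ℝ => Real.exp (-σ * y) • g (Real.exp (-y)))
        (t / (2 * Real.pi)) := by
    intro t
    rw [h1, mellin_eq_fourier]
    simp
  simp_rw [h2]
  refine (Real.zero_at_infty_fourier _).comp ?_
  refine Tendsto.mono_right ?_ atTop_le_cocompact
  exact tendsto_id.atTop_div_const (by positivity)

/-! ### `L`-functions with a functional equation -/

/-- An entire function `L` whose completion `Λ(s) = π^{-s} Γ(s) L(s)` is entire, bounded in vertical
strips, and satisfies `Λ(κ - s) = w Λ(s)`; moreover `L` is bounded on `Re s ≥ B`, and bounded away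
from zero on each vertical line of that half-plane. -/
structure HasFunctionalEquation (κ B : ℝ) (w : ℂ) (Λ L : ℂ → ℂ) : Prop where
  κ_pos : 0 < κ
  w_ne : w ≠ 0
  entire : Differentiable ℂ Λ
  fe : ∀ s, Λ (κ - s) = w * Λ s
  bdd_strip : ∀ a b : ℝ, ∃ C, ∀ s : ℂ, s.re ∈ Icc a b → ‖Λ s‖ ≤ C
  eq_completed : ∀ s, L s = (Real.pi : ℂ) ^ s * Λ s * (Complex.Gamma s)⁻¹
  bdd : ∃ M, ∀ s : ℂ, B ≤ s.re → ‖L s‖ ≤ M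
  lower : ∀ σ, B ≤ σ → ∃ m > 0, ∀ t : ℝ, m ≤ ‖L (σ + t * Complex.I)‖

namespace HasFunctionalEquation

variable {κ B : ℝ} {w : ℂ} {Λ L : ℂ → ℂ}

theorem differentiable (h : HasFunctionalEquation κ B w Λ L) : Differentiable ℂ L := by
  rw [show L = fun s => (Real.pi : ℂ) ^ s * Λ s * (Complex.Gamma s)⁻¹ from funext h.eq_completed]
  exact ((differentiable_ofReal_cpow Real.pi_pos).mul h.entire).mul
    Complex.differentiable_one_div_Gamma

theorem pi_cpow_ne (s : ℂ) : (Real.pi : ℂ) ^ s ≠ 0 := by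
  rw [Complex.cpow_def_of_ne_zero (by exact_mod_cast Real.pi_ne_zero)]
  exact Complex.exp_ne_zero _

theorem completed_eq (h : HasFunctionalEquation κ B w Λ L) {s : ℂ} (hs : Complex.Gamma s ≠ 0) :
    Λ s = (Real.pi : ℂ) ^ (-s) * Complex.Gamma s * L s := by
  rw [h.eq_completed, Complex.cpow_neg]
  have := pi_cpow_ne s
  field_simp

theorem ne_zero_of_le_re (h : HasFunctionalEquation κ B w Λ L) {s : ℂ} (hs : B ≤ s.re) :
    L s ≠ 0 := by
  obtain ⟨m, hm, hL⟩ := h.lower s.re hs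
  have := hL s.im
  rw [Complex.re_add_im] at this
  exact norm_pos_iff.mp (hm.trans_le this)

/-- To the left of the strip the only zeros are at poles of `Γ`. -/
theorem ne_zero_of_re_le (h : HasFunctionalEquation κ B w Λ L) {s : ℂ} (hs : s.re ≤ κ - B)
    (hG : Complex.Gamma s ≠ 0) : L s ≠ 0 := by
  have h1 : L (κ - s) ≠ 0 := h.ne_zero_of_le_re (by simp; linarith)
  have h2 : Λ (κ - s) ≠ 0 := fun h0 => h1 (by rw [h.eq_completed, h0]; simp)
  have h3 : Λ s ≠ 0 := fun h0 => h2 (by rw [h.fe, h0, mul_zero])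
  rw [h.eq_completed]
  exact mul_ne_zero (mul_ne_zero (pi_cpow_ne s) h3) (inv_ne_zero hG)

/-- The functional equation for absolute values: `|Γ(s) L(s)| = c |Γ(κ - s̄) L(κ - s)|`. -/
theorem norm_fe (h : HasFunctionalEquation κ B w Λ L) {s : ℂ} (hs : Complex.Gamma s ≠ 0)
    (hs' : Complex.Gamma (κ - s) ≠ 0) :
    ‖Complex.Gamma s‖ * ‖L s‖ = ‖w‖⁻¹ * Real.pi ^ (2 * s.re - κ)
      * (‖Complex.Gamma (κ - s + 2 * (s.im * Complex.I))‖ * ‖L (κ - s)‖) := by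
  have hconj : ‖Complex.Gamma (κ - s + 2 * (s.im * Complex.I))‖ = ‖Complex.Gamma (κ - s)‖ := by
    have e : (κ - s + 2 * (s.im * Complex.I) : ℂ) = (starRingEnd ℂ) (κ - s) := by
      apply Complex.ext <;> simp
      ring
    rw [e, Complex.Gamma_conj, Complex.norm_conj]
  have h1 := congrArg norm (h.fe s)
  rw [h.completed_eq hs, h.completed_eq hs', norm_mul, norm_mul, norm_mul, norm_mul, norm_mul,
    norm_ofReal_cpow Real.pi_pos, norm_ofReal_cpow Real.pi_pos] at h1
  rw [hconj, show 2 * s.re - κ = (-(κ - s)).re - (-s).re by simp; ring, Real.rpow_sub Real.pi_pos]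
  have := norm_pos_iff.mpr h.w_ne
  have := Real.rpow_pos_of_pos Real.pi_pos (-s).re
  field_simp
  linarith

/-- The half-plane in which `L` is bounded away from zero cannot reach to the left of the symmetry
line: there the Gamma quotient in the functional equation is unbounded. -/
theorem half_le (h : HasFunctionalEquation κ B w Λ L) : κ / 2 ≤ B := by
  by_contra! hB
  set σ := max B (κ / 4) with hσ
  have hκ := h.κ_pos
  have hσ0 : 0 < σ := lt_max_of_lt_right (by linarith)
  have hσB : B ≤ σ := le_max_left _ _
  have hσκ : σ < κ / 2 := max_lt hB (by linarith)
  obtain ⟨M, hM⟩ := h.bdd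
  obtain ⟨m, hm, hmL⟩ := h.lower (κ - σ) (by linarith)
  set c : ℝ := ‖w‖⁻¹ * Real.pi ^ (2 * σ - κ) with hc
  have hc0 : 0 < c := mul_pos (inv_pos.mpr (norm_pos_iff.mpr h.w_ne))
    (Real.rpow_pos_of_pos Real.pi_pos _)
  set δ : ℝ := κ - 2 * σ with hδ
  have hδ0 : 0 < δ := by rw [hδ]; linarith
  have hΓδ : 0 < ‖Complex.Gamma δ‖ := norm_pos_iff.mpr (Complex.Gamma_ne_zero_of_re_pos (by simpa))
  have hlow : ∀ t : ℝ, c * m * ‖Complex.Gamma δ‖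
      ≤ M * ‖Complex.betaIntegral (σ + t * Complex.I) δ‖ := by
    intro t
    set s : ℂ := σ + t * Complex.I with hs
    have hsre : s.re = σ := by simp [hs]
    have hsim : s.im = t := by simp [hs]
    have hG : Complex.Gamma s ≠ 0 := Complex.Gamma_ne_zero_of_re_pos (by rwa [hsre])
    have hG' : Complex.Gamma (κ - s) ≠ 0 :=
      Complex.Gamma_ne_zero_of_re_pos (by simp [hsre]; linarith)
    have h1 := h.norm_fe hG hG'
    have e1 : (κ - s + 2 * (s.im * Complex.I) : ℂ) = s + δ := by
      rw [hsim, hs, hδ]; push_cast; ring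
    rw [e1, hsre] at h1
    have h2 := congrArg norm (Complex.Gamma_mul_Gamma_eq_betaIntegral (s := s) (t := δ)
      (by rwa [hsre]) (by simpa))
    rw [norm_mul, norm_mul] at h2
    have hG2 : 0 < ‖Complex.Gamma (s + δ)‖ :=
      norm_pos_iff.mpr (Complex.Gamma_ne_zero_of_re_pos (by simp [hsre]; linarith))
    have h3 : m ≤ ‖L (κ - s)‖ := by
      have := hmL (-t)
      rwa [show ((κ - σ : ℝ) + ((-t : ℝ) : ℂ) * Complex.I : ℂ) = κ - s by
        rw [hs]; push_cast; ring] at this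
    have h4 : ‖L s‖ ≤ M := hM s (by rw [hsre]; exact hσB)
    refine le_of_mul_le_mul_left ?_ hG2
    calc ‖Complex.Gamma (s + δ)‖ * (c * m * ‖Complex.Gamma δ‖)
        ≤ ‖Complex.Gamma (s + δ)‖ * (c * ‖L (κ - s)‖ * ‖Complex.Gamma δ‖) := by gcongr
      _ = (‖Complex.Gamma s‖ * ‖L s‖) * ‖Complex.Gamma δ‖ := by rw [h1]; ring
      _ ≤ (‖Complex.Gamma s‖ * M) * ‖Complex.Gamma δ‖ := by gcongr
      _ = M * (‖Complex.Gamma s‖ * ‖Complex.Gamma δ‖) := by ring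
      _ = _ := by rw [h2]; ring
  have hlim : Tendsto (fun t : ℝ => M * ‖Complex.betaIntegral (σ + t * Complex.I) δ‖) atTop
      (𝓝 (M * 0)) := by
    have := (tendsto_betaIntegral_zero σ δ).norm
    rw [norm_zero] at this
    exact this.const_mul M
  have h5 := ge_of_tendsto' hlim hlow
  have : 0 < c * m * ‖Complex.Gamma δ‖ := by positivity
  linarith

/-- Polynomial growth in vertical strips (Phragmén-Lindelöf). On the line `Re s = κ/2 - m` with `m`
an integer the Gamma quotient has the absolute value of a polynomial of degree `2m`; the condition
`hκ` keeps this line away from the poles of `Γ`. -/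
theorem hasModerateGrowth (h : HasFunctionalEquation κ B w Λ L) (hκ : ∀ n : ℤ, κ / 2 ≠ n) :
    HasModerateGrowth L B where
  entire := h.differentiable
  lower := h.lower B le_rfl
  growth := by
    intro a
    obtain ⟨M, hM⟩ := h.bdd
    have hM0 : 0 ≤ M := (norm_nonneg _).trans (hM B (by simp))
    have hκ0 := h.κ_pos
    obtain ⟨m, hm⟩ := exists_nat_gt (max (max 0 (κ / 2 - a)) (B - κ / 2))
    have hm0 : (0 : ℝ) < m := (le_max_left _ _ |>.trans (le_max_left _ _)).trans_lt hm
    have hma : κ / 2 - m < a := by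
      have := (le_max_right _ _ |>.trans (le_max_left _ _)).trans_lt hm
      linarith
    have hmB : B < κ / 2 + m := by
      have := (le_max_right _ _).trans_lt hm
      linarith
    set p : ℝ := κ / 2 - m - 1 with hp
    set c : ℝ := ‖w‖⁻¹ * Real.pi ^ (2 * (κ / 2 - m) - κ) with hc
    have hc0 : 0 ≤ c := by positivity
    set K := c * ((κ / 2 + m + 1) ^ (2 * m) * M) + M with hK
    have hK0 : 0 ≤ K := by positivity
    have hsp1 : ∀ s : ℂ, κ / 2 - m ≤ s.re → 1 ≤ ‖s - p‖ := fun s hs => by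
      have := (le_abs_self _).trans (Complex.abs_re_le_norm (s - p))
      simp only [Complex.sub_re, Complex.ofReal_re] at this
      linarith
    have hspt : ∀ s : ℂ, |s.im| ≤ ‖s - p‖ := fun s => by
      have := Complex.abs_im_le_norm (s - p)
      simpa using this
    have hline : ∀ s : ℂ, s.re = κ / 2 - m → ‖L s‖ ≤ K * ‖s - p‖ ^ (2 * m) := by
      intro s hs
      have hp1 := hsp1 s hs.ge
      have hG : Complex.Gamma s ≠ 0 := by
        refine Complex.Gamma_ne_zero fun n hn => hκ (m - n) ?_
        have := congrArg Complex.re hn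
        rw [hs] at this
        simp only [Complex.neg_re, Complex.natCast_re] at this
        push_cast
        linarith
      have hG' : Complex.Gamma (κ - s) ≠ 0 :=
        Complex.Gamma_ne_zero_of_re_pos (by simp [hs]; linarith)
      have h1 := h.norm_fe hG hG'
      have e1 : (κ - s + 2 * (s.im * Complex.I) : ℂ) = s + (2 * m : ℕ) := by
        apply Complex.ext <;> simp [hs] <;> ring
      have hne : ∀ j < 2 * m, s + (j : ℂ) ≠ 0 := fun j _ h0 => by
        refine hκ (m - j) ?_
        have := congrArg Complex.re h0
        simp only [Complex.add_re, Complex.natCast_re, hs, Complex.zero_re] at this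
        push_cast
        linarith
      rw [e1, Gamma_add_natCast _ hne, norm_mul, hs] at h1
      have h2 : ‖L s‖ = c * (‖∏ j ∈ Finset.range (2 * m), (s + j)‖ * ‖L (κ - s)‖) := by
        have hGp := norm_pos_iff.mpr hG
        refine mul_left_cancel₀ hGp.ne' ?_
        rw [h1]; ring
      have h3 : ‖∏ j ∈ Finset.range (2 * m), (s + j)‖ ≤ ((κ / 2 + m + 1) * ‖s - p‖) ^ (2 * m) := by
        rw [norm_prod]
        refine (Finset.prod_le_prod (fun _ _ => norm_nonneg _) fun j hj => ?_).trans
          (le_of_eq (Finset.prod_const _) |>.trans (by rw [Finset.card_range]))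
        have hj' : (j : ℝ) < 2 * m := by exact_mod_cast Finset.mem_range.mp hj
        have hj0 : (0 : ℝ) ≤ j := Nat.cast_nonneg j
        refine (Complex.norm_le_abs_re_add_abs_im _).trans ?_
        have e2 : |(s + j : ℂ).re| ≤ κ / 2 + m := by
          simp only [Complex.add_re, Complex.natCast_re, hs]
          exact abs_le.mpr ⟨by linarith, by linarith⟩
        have e3 : |(s + j : ℂ).im| ≤ ‖s - p‖ := by simpa using hspt s
        nlinarith
      have h4 : ‖L (κ - s)‖ ≤ M := hM _ (by simp [hs]; linarith)
      rw [h2]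
      calc c * (‖∏ j ∈ Finset.range (2 * m), (s + j)‖ * ‖L (κ - s)‖)
          ≤ c * (((κ / 2 + m + 1) * ‖s - p‖) ^ (2 * m) * M) := by gcongr
        _ = c * ((κ / 2 + m + 1) ^ (2 * m) * M) * ‖s - p‖ ^ (2 * m) := by rw [mul_pow]; ring
        _ ≤ K * ‖s - p‖ ^ (2 * m) := by
          refine mul_le_mul_of_nonneg_right ?_ (by positivity)
          rw [hK]; linarith
    have hright : ∀ s : ℂ, κ / 2 + m ≤ s.re → ‖L s‖ ≤ K * ‖s - p‖ ^ (2 * m) := by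
      intro s hs
      refine (hM s (by linarith)).trans ?_
      have h1 : M ≤ K := by
        rw [hK]
        have : 0 ≤ c * ((κ / 2 + m + 1) ^ (2 * m) * M) := by positivity
        linarith
      exact h1.trans (le_mul_of_one_le_right hK0 (one_le_pow₀ (hsp1 s (by linarith))))
    set F : ℂ → ℂ := fun s => L s / (s - p) ^ (2 * m) with hF
    have hFle : ∀ s, κ / 2 - m ≤ s.re → (‖F s‖ ≤ K ↔ ‖L s‖ ≤ K * ‖s - p‖ ^ (2 * m)) := by
      intro s hs
      have : 0 < ‖s - p‖ := by linarith [hsp1 s hs]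
      rw [hF, norm_div, norm_pow, div_le_iff₀ (by positivity)]
    have hFd : DiffContOnCl ℂ F (Complex.re ⁻¹' Ioo (κ / 2 - m) (κ / 2 + m)) := by
      refine DifferentiableOn.diffContOnCl fun s hs => ?_
      have hcl := closure_minimal (preimage_mono Ioo_subset_Icc_self)
        (isClosed_Icc.preimage Complex.continuous_re) hs
      have hs1 := hsp1 s hcl.1
      have h0 : (s - p) ^ (2 * m) ≠ 0 := pow_ne_zero _ (norm_pos_iff.mp (by linarith))
      exact ((h.differentiable s).div (by fun_prop) h0).differentiableWithinAt
    have hapriori : ∃ c < Real.pi / ((κ / 2 + m) - (κ / 2 - m)), ∃ D,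
        F =O[comap (_root_.abs ∘ Complex.im) atTop ⊓
          𝓟 (Complex.re ⁻¹' Ioo (κ / 2 - m) (κ / 2 + m))]
        fun z => Real.exp (D * Real.exp (c * |z.im|)) := by
      obtain ⟨C₁, hC₁⟩ := exists_norm_inv_Gamma_le (κ / 2 - m) (κ / 2 + m)
      obtain ⟨C₂, hC₂⟩ := h.bdd_strip (κ / 2 - m) (κ / 2 + m)
      have hcm : 0 < 1 / (2 * (m : ℝ)) := by positivity
      refine ⟨1 / (2 * m), ?_, Real.pi * (2 * m), ?_⟩
      · rw [show (κ / 2 + m) - (κ / 2 - m) = 2 * (m : ℝ) by ring]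
        exact div_lt_div_of_pos_right (by linarith [Real.pi_gt_three]) (by positivity)
      · refine Asymptotics.IsBigO.of_bound
          ((Real.pi ^ (κ / 2 - m) + Real.pi ^ (κ / 2 + m)) * C₂ * C₁) ?_
        rw [eventually_inf_principal]
        have hev : ∀ᶠ z : ℂ in comap (_root_.abs ∘ Complex.im) atTop, 1 ≤ |z.im| :=
          tendsto_comap.eventually (eventually_ge_atTop (1 : ℝ))
        filter_upwards [hev] with s hs1 hs2
        have hs2' : s.re ∈ Icc (κ / 2 - m) (κ / 2 + m) := Ioo_subset_Icc_self hs2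
        have hC₂0 : 0 ≤ C₂ := (norm_nonneg _).trans (hC₂ s hs2')
        have hn1 := hC₁ s hs2' hs1
        have hC₁0 : 0 ≤ C₁ := by
          by_contra! hneg
          have : C₁ * Real.exp (Real.pi * |s.im|) < 0 := mul_neg_of_neg_of_pos hneg (Real.exp_pos _)
          linarith [norm_nonneg (Complex.Gamma s)⁻¹]
        have hFL : ‖F s‖ ≤ ‖L s‖ := by
          rw [hF, norm_div, norm_pow]
          exact div_le_self (norm_nonneg _) (one_le_pow₀ (hsp1 s hs2'.1))
        have hexp : Real.exp (Real.pi * |s.im|)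
            ≤ Real.exp (Real.pi * (2 * m) * Real.exp (1 / (2 * m) * |s.im|)) := by
          refine Real.exp_le_exp.mpr ?_
          have := Real.add_one_le_exp (1 / (2 * (m : ℝ)) * |s.im|)
          have h2 : 1 / (2 * (m : ℝ)) * |s.im| ≤ Real.exp (1 / (2 * m) * |s.im|) := by linarith
          calc Real.pi * |s.im| = Real.pi * (2 * m) * (1 / (2 * m) * |s.im|) := by field_simp
            _ ≤ _ := by gcongr
        rw [Real.norm_of_nonneg (Real.exp_pos _).le]
        calc ‖F s‖ ≤ ‖L s‖ := hFL
          _ = Real.pi ^ s.re * ‖Λ s‖ * ‖(Complex.Gamma s)⁻¹‖ := by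
            rw [h.eq_completed, norm_mul, norm_mul, norm_ofReal_cpow Real.pi_pos]
          _ ≤ (Real.pi ^ (κ / 2 - m) + Real.pi ^ (κ / 2 + m)) * C₂
              * (C₁ * Real.exp (Real.pi * |s.im|)) := by
            refine mul_le_mul (mul_le_mul (rpow_le_add Real.pi_pos hs2') (hC₂ s hs2')
              (norm_nonneg _) (by positivity)) hn1 (norm_nonneg _) (by positivity)
          _ ≤ _ := by
            rw [← mul_assoc]
            gcongr
    have hstrip : ∀ s : ℂ, κ / 2 - m ≤ s.re → ‖L s‖ ≤ K * ‖s - p‖ ^ (2 * m) := by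
      intro s hs
      rcases le_total s.re (κ / 2 + m) with h1 | h1
      · refine (hFle s hs).mp (PhragmenLindelof.vertical_strip hFd hapriori ?_ ?_ hs h1)
        · exact fun z hz => (hFle z hz.ge).mpr (hline z hz)
        · exact fun z hz => (hFle z (by rw [hz]; linarith)).mpr (hright z hz.ge)
      · exact hright s h1
    -- to the right of the strip the trivial bound suffices
    refine ⟨K * (2 * m + 1) ^ (2 * m) + M, 2 * m, fun s hs => ?_⟩
    have hpow1 : 1 ≤ (1 + |s.im|) ^ (2 * m) := one_le_pow₀ (by linarith [abs_nonneg s.im])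
    rcases le_total s.re (κ / 2 + m) with h1 | h1
    · have h2 : ‖s - p‖ ≤ (2 * m + 1) * (1 + |s.im|) := by
        refine (Complex.norm_le_abs_re_add_abs_im _).trans ?_
        have e1 : |(s - p : ℂ).re| ≤ 2 * m + 1 := by
          simp only [Complex.sub_re, Complex.ofReal_re]
          exact abs_le.mpr ⟨by linarith, by linarith⟩
        have e2 : |(s - p : ℂ).im| = |s.im| := by simp
        rw [e2]
        nlinarith [abs_nonneg s.im]
      calc ‖L s‖ ≤ K * ‖s - p‖ ^ (2 * m) := hstrip s (by linarith)
        _ ≤ K * ((2 * m + 1) * (1 + |s.im|)) ^ (2 * m) := by gcongr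
        _ = K * (2 * m + 1) ^ (2 * m) * (1 + |s.im|) ^ (2 * m) := by rw [mul_pow]; ring
        _ ≤ _ := by
          refine mul_le_mul_of_nonneg_right ?_ (by positivity)
          linarith
    · refine (hM s (by linarith)).trans ?_
      have : 0 ≤ K * (2 * m + 1) ^ (2 * m) := by positivity
      nlinarith

end HasFunctionalEquation

end HalfIntegral

namespace HalfIntegral

open Filter Topology Set Metric MeasureTheory

/-! ### Sums over zeros -/

theorem zerosIn_subset (L : ℂ → ℂ) (σ₁ σ₂ T : ℝ) :
    zerosIn L σ₁ σ₂ T ⊆ {z ∈ Icc σ₁ σ₂ ×ℂ Icc (-T) T | L z = 0} := fun _ hz =>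
  ⟨⟨⟨hz.2.1.le, hz.2.2.1.le⟩, abs_le.mp hz.2.2.2.le⟩, hz.1⟩

theorem finite_zerosIn {L : ℂ → ℂ} (hL : Differentiable ℂ L) (hL0 : L ≠ 0) (σ₁ σ₂ T : ℝ) :
    (zerosIn L σ₁ σ₂ T).Finite :=
  (finite_zeros_of_isCompact hL hL0 (isCompact_Icc.reProdIm isCompact_Icc)).subset
    (zerosIn_subset L σ₁ σ₂ T)

theorem zeroSum_eq_sum {L : ℂ → ℂ} {σ₁ σ₂ T x : ℝ} {Z : Finset ℂ}
    (hZ : ∀ z, z ∈ Z ↔ z ∈ zerosIn L σ₁ σ₂ T) :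
    zeroSum L σ₁ σ₂ T x = ∑ ρ ∈ Z, (analyticOrderNatAt L ρ : ℂ) * (x : ℂ) ^ ρ := by
  rw [zeroSum, ← finsum_mem_coe_finset]
  refine finsum_congr fun ρ => ?_
  rw [Finset.mem_coe, hZ]

/-- Two zero sums differ by at most the zeros that are not shared. -/
theorem norm_zeroSum_sub_le {L : ℂ → ℂ} (hL : Differentiable ℂ L) (hL0 : L ≠ 0)
    {σ₁ σ₂ T σ₁' σ₂' T' x M : ℝ} (hsub : zerosIn L σ₁ σ₂ T ⊆ zerosIn L σ₁' σ₂' T') {F : Finset ℂ}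
    (hF : zerosIn L σ₁' σ₂' T' \ zerosIn L σ₁ σ₂ T ⊆ F)
    (hM : ∀ ρ ∈ zerosIn L σ₁' σ₂' T', ‖(x : ℂ) ^ ρ‖ ≤ M) (hM0 : 0 ≤ M) :
    ‖zeroSum L σ₁' σ₂' T' x - zeroSum L σ₁ σ₂ T x‖
      ≤ (∑ ρ ∈ F, (analyticOrderNatAt L ρ : ℝ)) * M := by
  classical
  set Z' := (finite_zerosIn hL hL0 σ₁' σ₂' T').toFinset with hZ'
  set Z := (finite_zerosIn hL hL0 σ₁ σ₂ T).toFinset with hZ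
  have hZZ : Z ⊆ Z' := fun z hz => by
    rw [hZ', Set.Finite.mem_toFinset]
    exact hsub (by rwa [hZ, Set.Finite.mem_toFinset] at hz)
  rw [zeroSum_eq_sum (Z := Z') (by simp [hZ']), zeroSum_eq_sum (Z := Z) (by simp [hZ]),
    ← Finset.sum_sdiff hZZ, add_sub_cancel_right, Finset.sum_mul]
  have hsF : Z' \ Z ⊆ F := fun z hz => by
    rw [Finset.mem_sdiff, hZ', hZ, Set.Finite.mem_toFinset, Set.Finite.mem_toFinset] at hz
    exact hF hz
  refine (norm_sum_le _ _).trans ((Finset.sum_le_sum fun ρ hρ => ?_).trans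
    (Finset.sum_le_sum_of_subset_of_nonneg hsF fun _ _ _ => by positivity))
  rw [norm_mul, Complex.norm_natCast]
  refine mul_le_mul_of_nonneg_left (hM ρ ?_) (Nat.cast_nonneg _)
  have := (Finset.mem_sdiff.mp hρ).1
  rwa [hZ', Set.Finite.mem_toFinset] at this

/-! ### The logarithmic derivative to the left of the strip -/

namespace HasFunctionalEquation

variable {κ B : ℝ} {w : ℂ} {Λ L : ℂ → ℂ}

/-- The logarithmic derivative of the functional equation. -/
theorem logDeriv_add_logDeriv (h : HasFunctionalEquation κ B w Λ L) {s : ℂ} (hs : s.im ≠ 0)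
    (hL : L s ≠ 0) (hL' : L (κ - s) ≠ 0) :
    logDeriv L s + logDeriv L (κ - s)
      = 2 * Complex.log Real.pi - Complex.digamma s - Complex.digamma (κ - s) := by
  have hΛ : ∀ s : ℂ, s.im ≠ 0 → L s ≠ 0 →
      logDeriv Λ s = -Complex.log Real.pi + Complex.digamma s + logDeriv L s := by
    intro s hs hL
    have hG := Gamma_ne_zero_of_im_ne_zero hs
    have hGd : DifferentiableAt ℂ Complex.Gamma s :=
      Complex.differentiableAt_Gamma s fun m h0 => hs (by rw [h0]; simp)
    have hpi : DifferentiableAt ℂ (fun s : ℂ => (Real.pi : ℂ) ^ (-s)) s :=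
      ((differentiable_ofReal_cpow Real.pi_pos) (-s)).comp s differentiableAt_id.neg
    have hpi' : logDeriv (fun s : ℂ => (Real.pi : ℂ) ^ (-s)) s = -Complex.log Real.pi := by
      have h1 := (hasDerivAt_neg s).const_cpow (c := (Real.pi : ℂ))
        (Or.inl (by exact_mod_cast Real.pi_ne_zero))
      rw [logDeriv_apply, h1.deriv]
      have := pi_cpow_ne (-s)
      field_simp
    have hev : Λ =ᶠ[𝓝 s] fun s => (Real.pi : ℂ) ^ (-s) * Complex.Gamma s * L s := by
      filter_upwards [(isOpen_ne.preimage Complex.continuous_im).mem_nhds hs] with z hz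
      exact h.completed_eq (Gamma_ne_zero_of_im_ne_zero hz)
    rw [logDeriv_apply, hev.deriv_eq, hev.self_of_nhds, ← logDeriv_apply
      (fun s => (Real.pi : ℂ) ^ (-s) * Complex.Gamma s * L s),
      logDeriv_mul s (show (Real.pi : ℂ) ^ (-s) * Complex.Gamma s ≠ 0 from
        mul_ne_zero (pi_cpow_ne _) hG) hL (hpi.fun_mul hGd) (h.differentiable s),
      logDeriv_mul s (f := fun s : ℂ => (Real.pi : ℂ) ^ (-s)) (pi_cpow_ne _) hG hpi hGd, hpi',
      Complex.digamma_def]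
  have hfe : logDeriv Λ s = -logDeriv Λ (κ - s) := by
    have h1 : HasDerivAt (fun s => Λ (κ - s)) (-deriv Λ (κ - s)) s := by
      have := (h.entire (κ - s)).hasDerivAt.comp s ((hasDerivAt_id s).const_sub (κ : ℂ))
      exact this.congr_deriv (by simp)
    have h2 : HasDerivAt (fun s => Λ (κ - s)) (w * deriv Λ s) s := by
      rw [show (fun s => Λ (κ - s)) = fun s => w * Λ s from funext h.fe]
      exact (h.entire s).hasDerivAt.const_mul w
    have h3 := h1.unique h2
    rw [logDeriv_apply, logDeriv_apply, h.fe, ← neg_div, h3]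
    have := h.w_ne
    field_simp
  have e1 := hΛ s hs hL
  have e2 := hΛ (κ - s) (by simpa using hs) hL'
  linear_combination -e1 - e2 + hfe

/-- The Gamma factor changes by a rational function under `s ↦ s - 1`, which is what makes
`L'/L(s) + L'/L(κ - s)` almost periodic. -/
theorem norm_shift_le (h : HasFunctionalEquation κ B w Λ L) {s : ℂ} (hs : s.re ≤ κ - B)
    (hi : 2 ≤ |s.im|) :
    ‖(logDeriv L s + logDeriv L (κ - s)) - (logDeriv L (s - 1) + logDeriv L (κ - (s - 1)))‖
      ≤ 2 / |s.im| := by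
  have him : s.im ≠ 0 := fun h0 => by rw [h0] at hi; norm_num at hi
  have him1 : (s - 1).im ≠ 0 := by simpa using him
  have hnz : ∀ z : ℂ, z.im ≠ 0 → ∀ m : ℕ, z ≠ -m := fun z hz m h0 => hz (by rw [h0]; simp)
  rw [h.logDeriv_add_logDeriv him (h.ne_zero_of_re_le hs (Gamma_ne_zero_of_im_ne_zero him))
      (h.ne_zero_of_le_re (by simp; linarith)),
    h.logDeriv_add_logDeriv him1
      (h.ne_zero_of_re_le (by simp; linarith) (Gamma_ne_zero_of_im_ne_zero him1))
      (h.ne_zero_of_le_re (by simp; linarith))]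
  have e1 := Complex.digamma_apply_add_one (s - 1) (hnz _ him1)
  have e2 := Complex.digamma_apply_add_one (κ - s) (hnz _ (by simpa using him))
  rw [sub_add_cancel] at e1
  rw [show (κ - (s - 1) : ℂ) = κ - s + 1 by ring, e2, e1]
  rw [show (2 * Complex.log Real.pi - (Complex.digamma (s - 1) + (s - 1)⁻¹)
    - Complex.digamma (κ - s)) - (2 * Complex.log Real.pi - Complex.digamma (s - 1)
    - (Complex.digamma (κ - s) + (κ - s)⁻¹)) = (κ - s : ℂ)⁻¹ - (s - 1)⁻¹ by ring]
  have hpos : 0 < |s.im| := by linarith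
  have b1 : ‖(κ - s : ℂ)⁻¹‖ ≤ 1 / |s.im| := by
    rw [norm_inv, ← one_div]
    refine one_div_le_one_div_of_le hpos ?_
    simpa using Complex.abs_im_le_norm (κ - s : ℂ)
  have b2 : ‖(s - 1 : ℂ)⁻¹‖ ≤ 1 / |s.im| := by
    rw [norm_inv, ← one_div]
    refine one_div_le_one_div_of_le hpos ?_
    simpa using Complex.abs_im_le_norm (s - 1 : ℂ)
  refine (norm_sub_le _ _).trans ((add_le_add b1 b2).trans (le_of_eq ?_))
  ring

/-- Left of the strip there are no zeros nearby, so `L'/L` is of logarithmic size. -/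
theorem exists_norm_logDeriv_le (h : HasFunctionalEquation κ B w Λ L) (hκ : ∀ n : ℤ, κ / 2 ≠ n)
    {b : ℝ} (hb : B < b) :
    ∃ C > 0, ∀ s : ℂ, s.re ∈ Icc (κ - b - 1) (κ - b) → 2 ≤ |s.im| →
      ‖logDeriv L s‖ ≤ C * Real.log |s.im| := by
  have hG := h.hasModerateGrowth hκ
  have hhalf := h.half_le
  obtain ⟨C, hC, hpf⟩ := hG.partial_fractions (R := B - (κ - b) + 1) (by linarith)
  set η := min (b - B) 2 with hη
  have hη0 : 0 < η := lt_min (by linarith) (by norm_num)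
  refine ⟨C / η + C, by positivity, fun s hs hi => ?_⟩
  have him : s.im ≠ 0 := fun h0 => by rw [h0] at hi; norm_num at hi
  have hLs : L s ≠ 0 := h.ne_zero_of_re_le (by linarith [hs.2]) (Gamma_ne_zero_of_im_ne_zero him)
  obtain ⟨hN, hpf⟩ := hpf s.im hi
  set Z := hG.zerosBall (B + s.im * Complex.I) (2 * (B - (κ - b) + 1))
  have hsb : s ∈ closedBall (B + s.im * Complex.I : ℂ) (B - (κ - b) + 1) := by
    rw [mem_closedBall, dist_eq_norm]
    refine (Complex.norm_le_abs_re_add_abs_im _).trans ?_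
    have : |s.re - B| ≤ B - (κ - b) + 1 := abs_le.mpr ⟨by linarith [hs.1], by linarith [hs.2]⟩
    simpa using this
  have h1 := hpf s hsb hLs
  have h2 : ‖∑ ρ ∈ Z, (analyticOrderNatAt L ρ : ℂ) / (s - ρ)‖ ≤ C * Real.log |s.im| / η := by
    refine (norm_sum_le _ _).trans (le_trans ?_ (div_le_div_of_nonneg_right hN hη0.le))
    rw [Finset.sum_div]
    refine Finset.sum_le_sum fun ρ hρ => ?_
    rw [norm_div, Complex.norm_natCast]
    refine div_le_div_of_nonneg_left (Nat.cast_nonneg _) hη0 ?_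
    have hρ0 : L ρ = 0 := (hG.mem_zerosBall.mp hρ).1
    by_cases hre : ρ.re ≤ κ - B
    · have hΓ : Complex.Gamma ρ = 0 := by
        by_contra hne
        exact h.ne_zero_of_re_le hre hne hρ0
      have hρi : ρ.im = 0 := by
        by_contra hne
        exact Gamma_ne_zero_of_im_ne_zero hne hΓ
      have := Complex.abs_im_le_norm (s - ρ)
      rw [Complex.sub_im, hρi, sub_zero] at this
      exact (min_le_right _ _).trans (hi.trans this)
    · have := Complex.abs_re_le_norm (s - ρ)
      rw [Complex.sub_re, abs_sub_comm] at this
      have h3 := (le_abs_self _).trans this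
      exact (min_le_left _ _).trans (by linarith [hs.2])
  have h4 := norm_add_le (logDeriv L s - ∑ ρ ∈ Z, (analyticOrderNatAt L ρ : ℂ) / (s - ρ))
    (∑ ρ ∈ Z, (analyticOrderNatAt L ρ : ℂ) / (s - ρ))
  rw [sub_add_cancel] at h4
  refine h4.trans ((add_le_add h1 h2).trans (le_of_eq ?_))
  ring

end HasFunctionalEquation

/-! ### The contour integral -/

theorem exists_pos_le_abs_of_tendsto {u : ℕ → ℝ} (hu : Tendsto (fun n => |u n|) atTop atTop) :
    ∃ δ > 0, ∀ n, u n = 0 ∨ δ ≤ |u n| := by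
  obtain ⟨N, hN⟩ := eventually_atTop.mp (hu.eventually (eventually_ge_atTop 1))
  have key : ∀ N : ℕ, ∃ δ : ℝ, 0 < δ ∧ ∀ n < N, u n = 0 ∨ δ ≤ |u n| := by
    intro N
    induction N with
    | zero => exact ⟨1, one_pos, fun n hn => absurd hn (Nat.not_lt_zero n)⟩
    | succ N ih =>
      obtain ⟨δ, hδ, h⟩ := ih
      by_cases h0 : u N = 0
      · refine ⟨δ, hδ, fun n hn => ?_⟩
        rcases Nat.lt_succ_iff_lt_or_eq.mp hn with h' | rfl
        · exact h n h'
        · exact .inl h0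
      · refine ⟨min δ |u N|, lt_min hδ (abs_pos.mpr h0), fun n hn => ?_⟩
        rcases Nat.lt_succ_iff_lt_or_eq.mp hn with h' | rfl
        · exact (h n h').imp_right fun h => (min_le_left _ _).trans h
        · exact .inr (min_le_right _ _)
  obtain ⟨δ, hδ, h⟩ := key N
  refine ⟨min δ 1, lt_min hδ one_pos, fun n => ?_⟩
  rcases lt_or_ge n N with hn | hn
  · exact (h n hn).imp_right fun h => (min_le_left _ _).trans h
  · exact .inr ((min_le_right _ _).trans (hN n hn))

/-- Integral of `x ^ s` against a generalized Dirichlet series along a vertical side. Here `e = -1`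
on the right side of the contour, and `e = 1` on the left side, where the series is evaluated at
`κ - s`. -/
theorem exists_norm_integral_edge_le {x σ r e : ℝ} (hx : 0 < x) (hx1 : x ≠ 1)
    (he : e = 1 ∨ e = -1) {lam : ℕ → ℝ} {bf : ℕ → ℂ} (hlam : ∀ n, 1 ≤ lam n)
    (htend : Tendsto lam atTop atTop) {c₀ : ℂ} {g : ℝ → ℂ} (hg : Continuous g)
    (hsum : ∀ y : ℝ, HasSum (fun n => bf n * (lam n : ℂ) ^ (-(r - e * y * Complex.I : ℂ)))
      (g y + c₀))
    {d : ℕ} (hd : ∀ n, Real.log x + e * Real.log (lam n) = 0 → n = d) :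
    ∃ C, ∀ T : ℝ, ‖(∫ y in (-T)..T, (x : ℂ) ^ (σ + y * Complex.I : ℂ) * g y)
      - (if Real.log x + e * Real.log (lam d) = 0 then
          (x : ℂ) ^ (σ : ℂ) * (bf d * (lam d : ℂ) ^ (-r : ℂ)) else 0) * (2 * T)‖ ≤ C := by
  have hlam0 : ∀ n, 0 < lam n := fun n => one_pos.trans_le (hlam n)
  set u : ℕ → ℝ := fun n => Real.log x + e * Real.log (lam n) with hu
  set β : ℕ → ℂ := fun n => (x : ℂ) ^ (σ : ℂ) * (bf n * (lam n : ℂ) ^ (-r : ℂ)) with hβ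
  have hut : Tendsto (fun n => |u n|) atTop atTop := by
    have h1 : Tendsto (fun n => Real.log (lam n)) atTop atTop := Real.tendsto_log_atTop.comp htend
    have h2 : Tendsto (fun n => Real.log (lam n) - |Real.log x|) atTop atTop :=
      tendsto_atTop_add_const_right _ _ h1
    refine tendsto_atTop_mono (fun n => ?_) h2
    have h3 : |e * Real.log (lam n)| = Real.log (lam n) := by
      rw [abs_mul, abs_of_nonneg (Real.log_nonneg (hlam n))]
      rcases he with rfl | rfl <;> simp
    have h4 := abs_sub_abs_le_abs_sub (e * Real.log (lam n)) (-Real.log x)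
    rw [h3, abs_neg, sub_neg_eq_add, add_comm (e * _)] at h4
    exact h4
  obtain ⟨δ, hδ, hδu⟩ := exists_pos_le_abs_of_tendsto hut
  have hβs : Summable fun n => ‖β n‖ := by
    have := (hsum 0).summable.norm.mul_left ‖(x : ℂ) ^ (σ : ℂ)‖
    simpa [hβ, norm_mul] using this
  have hxexp : ∀ y : ℝ, (x : ℂ) ^ (σ + y * Complex.I : ℂ)
      = (x : ℂ) ^ (σ : ℂ) * Complex.exp (Real.log x * y * Complex.I) := by
    intro y
    have hx0 : (x : ℂ) ≠ 0 := by exact_mod_cast hx.ne'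
    rw [Complex.cpow_add _ _ hx0, Complex.cpow_def_of_ne_zero hx0 (y * Complex.I),
      ← Complex.ofReal_log hx.le, mul_assoc]
  have hlexp : ∀ n (y : ℝ), (lam n : ℂ) ^ (-(r - e * y * Complex.I : ℂ))
      = (lam n : ℂ) ^ (-r : ℂ) * Complex.exp (e * Real.log (lam n) * y * Complex.I) := by
    intro n y
    have hl0 : (lam n : ℂ) ≠ 0 := by exact_mod_cast (hlam0 n).ne'
    rw [show (-(r - e * y * Complex.I : ℂ)) = -r + e * y * Complex.I by ring,
      Complex.cpow_add _ _ hl0, Complex.cpow_def_of_ne_zero hl0 (e * y * Complex.I),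
      ← Complex.ofReal_log (hlam0 n).le]
    congr 2
    ring
  have hint : ∀ y : ℝ, (x : ℂ) ^ (σ + y * Complex.I : ℂ) * g y
      = (∑' n, β n * Complex.exp (u n * y * Complex.I))
        - c₀ * (x : ℂ) ^ (σ : ℂ) * Complex.exp (Real.log x * y * Complex.I) := by
    intro y
    have h1 := (hsum y).mul_left ((x : ℂ) ^ (σ + y * Complex.I : ℂ))
    have h2 : (fun n => (x : ℂ) ^ (σ + y * Complex.I : ℂ)
        * (bf n * (lam n : ℂ) ^ (-(r - e * y * Complex.I : ℂ))))
        = fun n => β n * Complex.exp (u n * y * Complex.I) := by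
      funext n
      rw [hxexp, hlexp, hβ, hu]
      push_cast
      rw [show ((Real.log x + e * Real.log (lam n) : ℂ)) * y * Complex.I
        = Real.log x * y * Complex.I + e * Real.log (lam n) * y * Complex.I by ring,
        Complex.exp_add]
      ring
    rw [h2] at h1
    rw [h1.tsum_eq, hxexp]
    ring
  obtain ⟨C, hC⟩ := exists_norm_integral_tsum_exp_le hβs hδ hδu (d := d) hd
  have hlx : Real.log x ≠ 0 := Real.log_ne_zero_of_pos_of_ne_one hx hx1
  refine ⟨C + ‖c₀ * (x : ℂ) ^ (σ : ℂ)‖ * (2 / |Real.log x|), fun T => ?_⟩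
  have hcx : Continuous fun y : ℝ => (x : ℂ) ^ (σ + y * Complex.I : ℂ) :=
    (differentiable_ofReal_cpow hx).continuous.comp (by fun_prop)
  have hcE : Continuous fun y : ℝ =>
      c₀ * (x : ℂ) ^ (σ : ℂ) * Complex.exp (Real.log x * y * Complex.I) := by fun_prop
  have hcS : Continuous fun y : ℝ => ∑' n, β n * Complex.exp (u n * y * Complex.I) := by
    have : (fun y : ℝ => ∑' n, β n * Complex.exp (u n * y * Complex.I))
        = fun y : ℝ => (x : ℂ) ^ (σ + y * Complex.I : ℂ) * g y
          + c₀ * (x : ℂ) ^ (σ : ℂ) * Complex.exp (Real.log x * y * Complex.I) := by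
      funext y
      rw [hint y, sub_add_cancel]
    rw [this]
    exact (hcx.mul hg).add hcE
  simp_rw [hint]
  rw [intervalIntegral.integral_sub (hcS.intervalIntegrable _ _) (hcE.intervalIntegrable _ _),
    sub_right_comm, intervalIntegral.integral_const_mul]
  refine (norm_sub_le _ _).trans (add_le_add (hC T) ?_)
  rw [norm_mul]
  exact mul_le_mul_of_nonneg_left (norm_integral_exp_le hlx _ _) (norm_nonneg _)

end HalfIntegral

namespace HalfIntegral

open Filter Topology Set Metric MeasureTheory

namespace HasFunctionalEquation

variable {κ B : ℝ} {w : ℂ} {Λ L : ℂ → ℂ}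

/-- Landau's formula when no zero lies on the left side `Re s = κ - b` of the contour. -/
theorem exists_zeroSum_bound (h : HasFunctionalEquation κ B w Λ L) (hκ : ∀ n : ℤ, κ / 2 ≠ n)
    {b : ℝ} (hb : B < b) (hbZ : ∀ n : ℕ, κ - b ≠ -n) {lam : ℕ → ℝ} {bf : ℕ → ℂ} {c₀ : ℂ}
    (hlam : ∀ n, 1 ≤ lam n) (htend : Tendsto lam atTop atTop)
    (hsum : ∀ s : ℂ, B ≤ s.re →
      HasSum (fun n => bf n * (lam n : ℂ) ^ (-s)) (logDeriv L s + c₀))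
    {x : ℝ} (hx : 0 < x) (hx1 : x ≠ 1) {d : ℕ}
    (hd : ∀ n : ℕ, x = lam n ∨ x = (lam n)⁻¹ → n = d) :
    ∃ C, ∀ T : ℝ, 2 ≤ T →
      ‖zeroSum L (κ - b) B T x - bf d / (Real.pi : ℂ)
        * ((delta x (lam d) + x ^ κ * delta x (lam d)⁻¹ : ℝ) : ℂ) * (T : ℂ)‖
        ≤ C * Real.log T := by
  have hG := h.hasModerateGrowth hκ
  have hhalf := h.half_le
  have hent := h.differentiable
  have hL0 := hG.ne_zero
  set σ := κ - b with hσ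
  have hσB : σ < B := by rw [hσ]; linarith
  have hlam0 : ∀ n, 0 < lam n := fun n => one_pos.trans_le (hlam n)
  -- `L` does not vanish on the two vertical sides
  have hnR : ∀ y : ℝ, L (B + y * Complex.I) ≠ 0 := hG.ne_zero_at
  have hnL : ∀ s : ℂ, s.re = σ → L s ≠ 0 := fun s hs =>
    h.ne_zero_of_re_le (by rw [hs]; linarith) (Complex.Gamma_ne_zero fun m h0 => hbZ m (by
      rw [← hs, h0]; simp))
  have hnL' : ∀ s : ℂ, s.re = σ → L (κ - s) ≠ 0 := fun s hs =>
    h.ne_zero_of_le_re (by simp [hs, hσ]; linarith)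
  have hcR : Continuous fun y : ℝ => logDeriv L (B + y * Complex.I) :=
    continuous_iff_continuousAt.mpr fun y => ContinuousAt.comp
      (f := fun y : ℝ => (B + y * Complex.I : ℂ)) (g := logDeriv L)
      (continuousAt_logDeriv hent (hnR y)) (by fun_prop)
  have hcL' : Continuous fun y : ℝ => logDeriv L (κ - (σ + y * Complex.I)) :=
    continuous_iff_continuousAt.mpr fun y => ContinuousAt.comp
      (f := fun y : ℝ => (κ - (σ + y * Complex.I) : ℂ)) (g := logDeriv L)
      (continuousAt_logDeriv hent (hnL' _ (by simp))) (by fun_prop)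
  have hcL : Continuous fun y : ℝ => logDeriv L (σ + y * Complex.I) :=
    continuous_iff_continuousAt.mpr fun y => ContinuousAt.comp
      (f := fun y : ℝ => (σ + y * Complex.I : ℂ)) (g := logDeriv L)
      (continuousAt_logDeriv hent (hnL _ (by simp))) (by fun_prop)
  -- on the right side the oscillation `x ^ s * λ ^ (-s)` is constant for `λ = x`
  have hlog0 : ∀ n, (Real.log x + (-1) * Real.log (lam n) = 0 ↔ x = lam n) := fun n => by
    rw [neg_one_mul, ← sub_eq_add_neg, sub_eq_zero]
    exact ⟨fun h0 => Real.log_injOn_pos hx (hlam0 n) h0, fun h0 => by rw [h0]⟩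
  have hlog1 : ∀ n, (Real.log x + 1 * Real.log (lam n) = 0 ↔ x = (lam n)⁻¹) := fun n => by
    rw [one_mul, ← sub_neg_eq_add, ← Real.log_inv, sub_eq_zero]
    exact ⟨fun h0 => Real.log_injOn_pos hx (inv_pos.mpr (hlam0 n)) h0, fun h0 => by rw [h0]⟩
  obtain ⟨C₁, hC₁⟩ := exists_norm_integral_edge_le (σ := B) (r := B) (e := -1) hx hx1 (.inr rfl)
    hlam htend (c₀ := c₀) hcR (fun y => by
      have := hsum (B + y * Complex.I) (by simp)
      rwa [show (B + y * Complex.I : ℂ) = B - (-1 : ℝ) * y * Complex.I by push_cast; ring] at this ⊢)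
    (d := d) (fun n h0 => hd n (.inl ((hlog0 n).mp h0)))
  -- on the left side `L'/L(s) = H(s) - L'/L(κ - s)`, and `x ^ s * λ ^ (s - κ)` is constant in
  -- `Im s` for `λ = x⁻¹`
  obtain ⟨C₂, hC₂⟩ := exists_norm_integral_edge_le (σ := σ) (r := b) (e := 1) hx hx1 (.inl rfl)
    hlam htend (c₀ := c₀) hcL' (fun y => by
      have := hsum (κ - (σ + y * Complex.I)) (by simp [hσ]; linarith)
      rwa [show (κ - (σ + y * Complex.I) : ℂ) = b - (1 : ℝ) * y * Complex.I by
        rw [hσ]; push_cast; ring] at this ⊢)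
    (d := d) (fun n h0 => hd n (.inr ((hlog1 n).mp h0)))
  set H : ℂ → ℂ := fun s => logDeriv L s + logDeriv L (κ - s) with hH
  obtain ⟨C₃, hC₃0, hC₃⟩ := h.exists_norm_logDeriv_le hκ hb
  set M := (∑' n, ‖bf n‖ * lam n ^ (-b)) + ‖c₀‖ with hM
  have hbsum : Summable fun n => ‖bf n‖ * lam n ^ (-b) := by
    have := (hsum b (by simpa using hb.le)).summable.norm
    refine this.congr fun n => ?_
    rw [norm_mul, norm_ofReal_cpow (hlam0 n)]
    simp
  have hM0 : 0 ≤ M := add_nonneg (tsum_nonneg fun n => by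
    have := (hlam0 n).le
    positivity) (norm_nonneg _)
  have hMb : ∀ s : ℂ, b ≤ s.re → ‖logDeriv L s‖ ≤ M := by
    intro s hs
    have h1 : ‖logDeriv L s + c₀‖ ≤ ∑' n, ‖bf n‖ * lam n ^ (-b) := by
      rw [← (hsum s (hb.le.trans hs)).tsum_eq]
      refine tsum_of_norm_bounded hbsum.hasSum fun n => ?_
      rw [norm_mul, norm_ofReal_cpow (hlam0 n)]
      refine mul_le_mul_of_nonneg_left ?_ (norm_nonneg _)
      exact Real.rpow_le_rpow_of_exponent_le (hlam n) (by simpa using hs)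
    have h2 := norm_sub_le (logDeriv L s + c₀) c₀
    rw [add_sub_cancel_right] at h2
    linarith
  have hl2 : 0 < Real.log 2 := Real.log_pos (by norm_num)
  set K := max (C₃ + M / Real.log 2) 2 with hK
  obtain ⟨C₄, hC₄⟩ := exists_norm_integral_cpow_mul_le_log (H := H) (σ := σ) (C := K) hx hx1
    (le_max_of_le_right (by norm_num))
    (fun z hz hi => by
      have him : z.im ≠ 0 := fun h0 => by rw [h0] at hi; norm_num at hi
      have hLz := h.ne_zero_of_re_le (s := z) (by rw [hσ] at hz; linarith [hz.2])
        (Gamma_ne_zero_of_im_ne_zero him)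
      have hLz' := h.ne_zero_of_le_re (s := κ - z) (by
        simp only [Complex.sub_re, Complex.ofReal_re]; rw [hσ] at hz; linarith [hz.2])
      have hd' : Differentiable ℂ (deriv L) := fun z =>
        (hent.differentiableOn.deriv isOpen_univ).differentiableAt univ_mem
      refine ((hd' z).div (hent z) hLz).add ?_
      exact ((hd'.comp (by fun_prop : Differentiable ℂ fun z : ℂ => κ - z)) z).div
        ((hent.comp (by fun_prop : Differentiable ℂ fun z : ℂ => κ - z)) z) hLz')
    (fun z hz hi => by
      have h1 := hC₃ z hz hi
      have h2 := hMb (κ - z) (by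
        simp only [Complex.sub_re, Complex.ofReal_re]; rw [hσ] at hz; linarith [hz.2])
      have h3 : M ≤ M / Real.log 2 * Real.log |z.im| := by
        rw [div_mul_eq_mul_div, le_div_iff₀ hl2]
        exact mul_le_mul_of_nonneg_left (Real.log_le_log (by norm_num) hi) hM0
      have hlz : 0 ≤ Real.log |z.im| := Real.log_nonneg (by linarith)
      calc ‖H z‖ ≤ ‖logDeriv L z‖ + ‖logDeriv L (κ - z)‖ := norm_add_le _ _
        _ ≤ (C₃ + M / Real.log 2) * Real.log |z.im| := by linarith
        _ ≤ _ := mul_le_mul_of_nonneg_right (le_max_left _ _) hlz)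
    (fun z hz hi => (h.norm_shift_le (by rw [hz]; linarith) hi).trans
      (div_le_div_of_nonneg_right (le_max_right _ _) (abs_nonneg _)))
  have hcx : ∀ v : ℝ, Continuous fun y : ℝ => (x : ℂ) ^ (v + y * Complex.I : ℂ) := fun v =>
    (differentiable_ofReal_cpow hx).continuous.comp (by fun_prop)
  have hcH : Continuous fun y : ℝ => (x : ℂ) ^ (σ + y * Complex.I : ℂ) * H (σ + y * Complex.I) :=
    (hcx σ).fun_mul (hcL.fun_add hcL')
  set C₅ := ‖∫ y in (-2 : ℝ)..2, (x : ℂ) ^ (σ + y * Complex.I : ℂ) * H (σ + y * Complex.I)‖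
  obtain ⟨C₆, hC₆0, hC₆⟩ := hG.exists_good_height hσB.le
  obtain ⟨C₇, hC₇0, hC₇⟩ := hG.partial_fractions (R := B - σ + 1) (by linarith)
  set X := x ^ σ + x ^ B with hX
  have hX0 : 0 ≤ X := by positivity
  -- `mR` and `mL` are the mean values of the integrands on the right and on the left side
  set mR : ℂ := if Real.log x + (-1) * Real.log (lam d) = 0 then
          (x : ℂ) ^ (B : ℂ) * (bf d * (lam d : ℂ) ^ (-B : ℂ)) else 0 with hmR
  set mL : ℂ := if Real.log x + 1 * Real.log (lam d) = 0 then
          (x : ℂ) ^ (σ : ℂ) * (bf d * (lam d : ℂ) ^ (-b : ℂ)) else 0 with hmL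
  have hxc : (x : ℂ) ≠ 0 := by exact_mod_cast hx.ne'
  have hmR' : mR = bf d * (delta x (lam d) : ℂ) := by
    by_cases hxd : x = lam d
    · rw [hmR, if_pos ((hlog0 d).mpr hxd), delta, if_pos hxd, ← hxd, Complex.cpow_neg]
      have : (x : ℂ) ^ (B : ℂ) ≠ 0 := by simp [Complex.cpow_eq_zero_iff, hxc]
      field_simp
      simp
    · rw [hmR, if_neg (fun h0 => hxd ((hlog0 d).mp h0)), delta, if_neg hxd]
      simp
  have hmL' : mL = bf d * ((x ^ κ * delta x (lam d)⁻¹ : ℝ) : ℂ) := by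
    by_cases hxd : x = (lam d)⁻¹
    · have hld : (lam d : ℂ) ^ (-b : ℂ) = (x : ℂ) ^ (b : ℂ) := by
        rw [hxd, Complex.ofReal_inv, Complex.inv_cpow, Complex.cpow_neg]
        rw [Complex.arg_ofReal_of_nonneg (hlam0 d).le]
        exact Real.pi_pos.ne
      rw [hmL, if_pos ((hlog1 d).mpr hxd), delta, if_pos hxd, hld, mul_one,
        Complex.ofReal_cpow hx.le, hσ, mul_left_comm, ← Complex.cpow_add _ _ hxc]
      congr 2
      push_cast; ring
    · rw [hmL, if_neg (fun h0 => hxd ((hlog1 d).mp h0)), delta, if_neg hxd]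
      simp
  have hmain : bf d / (Real.pi : ℂ)
        * ((delta x (lam d) + x ^ κ * delta x (lam d)⁻¹ : ℝ) : ℂ) = (mR + mL) / Real.pi := by
    rw [hmR', hmL']; push_cast; ring
  rw [hmain]
  refine ⟨(2 * (X * C₆) + C₁ / Real.log 2 + (2 * (C₄ * 2) + C₅ / Real.log 2 + C₂ / Real.log 2))
    + (2 * C₇ * X) + ‖(mR + mL) / Real.pi‖ / Real.log 2, fun T hT => ?_⟩
  obtain ⟨T', ⟨hT1, hT2⟩, hnz, hh1, hh2⟩ := hC₆ T hT
  have hlT : Real.log 2 ≤ Real.log T := Real.log_le_log (by norm_num) hT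
  have hlT0 : 0 < Real.log T := hl2.trans_le hlT
  have hconst : ∀ c : ℝ, 0 ≤ c → c ≤ c / Real.log 2 * Real.log T := fun c hc => by
    rw [div_mul_eq_mul_div, le_div_iff₀ hl2]
    exact mul_le_mul_of_nonneg_left hlT hc
  have hT'2 : 2 ≤ T' := hT.trans hT1
  have hTT' : -T' ≤ T' := by linarith
  have hlT' : Real.log T' ≤ 2 * Real.log T := by
    rw [← Real.log_rpow (by linarith)]
    refine Real.log_le_log (by linarith) ?_
    rw [Real.rpow_two]
    nlinarith
  have hnormx : ∀ ρ : ℂ, ρ.re ∈ Icc σ B → ‖(x : ℂ) ^ ρ‖ ≤ X := fun ρ hρ => by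
    rw [norm_ofReal_cpow hx]; exact rpow_le_add hx hρ
  -- no zero lies on the boundary at height `T'`, so the argument principle applies
  set Z := (finite_zerosIn hent hL0 σ B T').toFinset with hZ
  have hZmem : ∀ z, z ∈ Z ↔ z ∈ zerosIn L σ B T' := by simp [hZ]
  have hZ1 : ∀ z, z ∈ Z ↔ L z = 0 ∧ z.re ∈ Icc σ B ∧ z.im ∈ Icc (-T') T' := by
    intro z
    rw [hZmem]
    refine ⟨fun hz => ⟨hz.1, ⟨hz.2.1.le, hz.2.2.1.le⟩, abs_le.mp hz.2.2.2.le⟩, ?_⟩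
    rintro ⟨h0, ⟨h1, h2⟩, h3⟩
    refine ⟨h0, lt_of_le_of_ne h1 fun he => hnL z he.symm h0, lt_of_le_of_ne h2 fun he => ?_,
      lt_of_le_of_ne (abs_le.mpr h3) (hnz z h0 ⟨h1, h2⟩)⟩
    exact h.ne_zero_of_le_re he.ge h0
  have hZ2 : ∀ z ∈ Z, z.re ∈ Ioo σ B ∧ z.im ∈ Ioo (-T') T' := fun z hz => by
    have := (hZmem z).mp hz
    exact ⟨⟨this.2.1, this.2.2.1⟩, abs_lt.mp this.2.2.2⟩
  have hres :=
    rectIntegral_mul_logDeriv hent (differentiable_ofReal_cpow hx) hL0 hσB.le hTT' hZ1 hZ2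
  rw [← zeroSum_eq_sum (x := x) hZmem] at hres
  have hhor : ∀ y : ℝ, |y| = T' →
      (∫ v in σ..B, ‖logDeriv L (v + y * Complex.I)‖) ≤ C₆ * Real.log T →
      ‖∫ v in σ..B, (x : ℂ) ^ (v + y * Complex.I : ℂ) * logDeriv L (v + y * Complex.I)‖
        ≤ X * (C₆ * Real.log T) := by
    intro y hy hle
    have hii : IntervalIntegrable (fun v : ℝ => X * ‖logDeriv L (v + y * Complex.I)‖)
        volume σ B := by
      refine ContinuousOn.intervalIntegrable fun v hv => ContinuousAt.continuousWithinAt ?_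
      rw [uIcc_of_le hσB.le] at hv
      refine continuousAt_const.mul (ContinuousAt.norm (ContinuousAt.comp
        (f := fun v : ℝ => (v + y * Complex.I : ℂ)) (g := logDeriv L)
        (continuousAt_logDeriv hent fun h0 => ?_) (by fun_prop)))
      exact hnz _ h0 (by simpa using hv) (by simpa using hy)
    refine (intervalIntegral.norm_integral_le_of_norm_le hσB.le (ae_of_all _ fun v hv => ?_)
      hii).trans ?_
    · rw [norm_mul]
      exact mul_le_mul_of_nonneg_right (hnormx _ (by simpa using Ioc_subset_Icc_self hv))
        (norm_nonneg _)
    · rw [intervalIntegral.integral_const_mul]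
      exact mul_le_mul_of_nonneg_left hle hX0
  have hbot := hhor (-T') (by rw [abs_neg, abs_of_pos (by linarith)]) hh2
  have htop := hhor T' (abs_of_pos (by linarith)) hh1
  have hright := hC₁ T'
  have hleft := hC₂ T'
  have hHint : ‖∫ y in (-T')..T', (x : ℂ) ^ (σ + y * Complex.I : ℂ) * H (σ + y * Complex.I)‖
      ≤ 2 * (C₄ * 2) * Real.log T + C₅ := by
    have hi := fun a b => hcH.intervalIntegrable (μ := volume) a b
    rw [← intervalIntegral.integral_add_adjacent_intervals (hi (-T') 2) (hi 2 T'),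
      ← intervalIntegral.integral_add_adjacent_intervals (hi (-T') (-2)) (hi (-2) 2)]
    obtain ⟨p1, p2⟩ := hC₄ T' hT'2
    have hC₄0 : 0 ≤ C₄ := by
      by_contra! hneg
      have : C₄ * Real.log T' < 0 := mul_neg_of_neg_of_pos hneg (Real.log_pos (by linarith))
      linarith [norm_nonneg (∫ y in (2 : ℝ)..T',
        (x : ℂ) ^ (σ + y * Complex.I : ℂ) * H (σ + y * Complex.I))]
    have := mul_le_mul_of_nonneg_left hlT' hC₄0
    refine (norm_add_le _ _).trans ?_
    have := norm_add_le (∫ y in (-T')..(-2),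
      (x : ℂ) ^ (σ + y * Complex.I : ℂ) * H (σ + y * Complex.I))
      (∫ y in (-2 : ℝ)..2, (x : ℂ) ^ (σ + y * Complex.I : ℂ) * H (σ + y * Complex.I))
    linarith
  have hleft' : ∫ y in (-T')..T', (x : ℂ) ^ (σ + y * Complex.I : ℂ) * logDeriv L (σ + y * Complex.I)
      = (∫ y in (-T')..T', (x : ℂ) ^ (σ + y * Complex.I : ℂ) * H (σ + y * Complex.I))
        - ∫ y in (-T')..T', (x : ℂ) ^ (σ + y * Complex.I : ℂ)
          * logDeriv L (κ - (σ + y * Complex.I)) := by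
    rw [← intervalIntegral.integral_sub (hcH.intervalIntegrable _ _)
      (((hcx σ).fun_mul hcL').intervalIntegrable _ _)]
    refine intervalIntegral.integral_congr fun y _ => ?_
    simp only [hH]
    ring
  have hC₁0 : 0 ≤ C₁ := (norm_nonneg _).trans hright
  have hC₂0 : 0 ≤ C₂ := (norm_nonneg _).trans hleft
  have hmainT' : ‖zeroSum L σ B T' x - (mR + mL) / Real.pi * T'‖ ≤
      (2 * (X * C₆) + C₁ / Real.log 2 + (2 * (C₄ * 2) + C₅ / Real.log 2 + C₂ / Real.log 2))
        * Real.log T := by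
    simp only [rectIntegral] at hres
    rw [hleft'] at hres
    set I₁ := ∫ v in σ..B, (x : ℂ) ^ (v + (-T' : ℝ) * Complex.I : ℂ)
      * logDeriv L (v + (-T' : ℝ) * Complex.I)
    set I₂ := ∫ v in σ..B, (x : ℂ) ^ (v + T' * Complex.I : ℂ) * logDeriv L (v + T' * Complex.I)
    set I₃ := ∫ y in (-T')..T', (x : ℂ) ^ (B + y * Complex.I : ℂ) * logDeriv L (B + y * Complex.I)
    set I₄ := ∫ y in (-T')..T', (x : ℂ) ^ (σ + y * Complex.I : ℂ) * H (σ + y * Complex.I)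
    set I₅ := ∫ y in (-T')..T', (x : ℂ) ^ (σ + y * Complex.I : ℂ)
          * logDeriv L (κ - (σ + y * Complex.I))
    have hpi : (Real.pi : ℂ) ≠ 0 := by exact_mod_cast Real.pi_ne_zero
    have hkey : 2 * Real.pi * Complex.I * (zeroSum L σ B T' x - (mR + mL) / Real.pi * T')
        = I₁ - I₂ + Complex.I * (I₃ - mR * (2 * T')) - Complex.I * I₄
          + Complex.I * (I₅ - mL * (2 * T')) := by
      rw [mul_sub, ← hres]
      field_simp
      ring
    have hn := congrArg norm hkey
    rw [norm_mul] at hn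
    have h2pi : ‖(2 * Real.pi * Complex.I : ℂ)‖ = 2 * Real.pi := by
      simp [abs_of_pos Real.pi_pos]
    rw [h2pi] at hn
    have hI : ∀ z : ℂ, ‖Complex.I * z‖ = ‖z‖ := fun z => by simp
    have hle : ‖I₁ - I₂ + Complex.I * (I₃ - mR * (2 * T')) - Complex.I * I₄
          + Complex.I * (I₅ - mL * (2 * T'))‖ ≤ ‖I₁‖ + ‖I₂‖ + ‖I₃ - mR * (2 * T')‖ + ‖I₄‖
          + ‖I₅ - mL * (2 * T')‖ := by
      refine (norm_add_le _ _).trans (add_le_add ((norm_sub_le _ _).trans (add_le_add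
        ((norm_add_le _ _).trans (add_le_add (norm_sub_le _ _) ?_)) ?_)) ?_) <;> rw [hI]
    have hc1 := hconst C₁ hC₁0
    have hc2 := hconst C₂ hC₂0
    have hc5 := hconst C₅ (norm_nonneg _)
    have hnn := norm_nonneg (zeroSum L σ B T' x - (mR + mL) / Real.pi * T')
    have hpi3 := Real.pi_gt_three
    nlinarith
  -- replacing `T'` by `T` costs the `O(log T)` zeros in between
  have hTT : ‖zeroSum L σ B T' x - zeroSum L σ B T x‖ ≤ 2 * C₇ * X * Real.log T := by
    classical
    have hT0 : |T| = T := abs_of_pos (by linarith)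
    obtain ⟨n1, -⟩ := hC₇ T (by rwa [hT0])
    obtain ⟨n2, -⟩ := hC₇ (-T) (by rwa [abs_neg, hT0])
    rw [abs_neg, hT0] at n2
    rw [hT0] at n1
    set F₁ := hG.zerosBall (B + T * Complex.I) (2 * (B - σ + 1)) with hF₁
    set F₂ := hG.zerosBall (B + (-T : ℝ) * Complex.I) (2 * (B - σ + 1)) with hF₂
    have hball : ∀ (y : ℝ) (z : ℂ), z.re ∈ Icc σ B → |z.im - y| ≤ 1 →
        z ∈ closedBall (B + y * Complex.I : ℂ) (2 * (B - σ + 1)) := by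
      intro y z hz hy
      rw [mem_closedBall, dist_eq_norm]
      refine (Complex.norm_le_abs_re_add_abs_im _).trans ?_
      have e1 : |(z - (B + y * Complex.I)).re| ≤ B - σ := by
        simp only [Complex.sub_re, Complex.add_re, Complex.ofReal_re, Complex.mul_re, Complex.I_re,
          mul_zero, Complex.ofReal_im, Complex.I_im, mul_one, sub_zero, add_zero]
        exact abs_le.mpr ⟨by linarith [hz.1], by linarith [hz.2]⟩
      have e2 : |(z - (B + y * Complex.I)).im| ≤ 1 := by simpa using hy
      linarith
    refine (norm_zeroSum_sub_le hent hL0 (F := F₁ ∪ F₂) (M := X) ?_ ?_ ?_ hX0).trans ?_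
    · exact fun z hz => ⟨hz.1, hz.2.1, hz.2.2.1, hz.2.2.2.trans_le hT1⟩
    · rintro z ⟨⟨h0, h1, h2, h3⟩, h4⟩
      have h5 : T ≤ |z.im| := by
        by_contra! hlt
        exact h4 ⟨h0, h1, h2, hlt⟩
      have hre : z.re ∈ Icc σ B := ⟨h1.le, h2.le⟩
      rw [Finset.mem_coe, Finset.mem_union]
      rcases le_total 0 z.im with hi | hi
      · rw [abs_of_nonneg hi] at h3 h5
        exact .inl (hG.mem_zerosBall.mpr ⟨h0, hball T z hre
          (abs_le.mpr ⟨by linarith, by linarith⟩)⟩)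
      · rw [abs_of_nonpos hi] at h3 h5
        exact .inr (hG.mem_zerosBall.mpr ⟨h0, hball (-T) z hre
          (abs_le.mpr ⟨by linarith, by linarith⟩)⟩)
    · exact fun ρ hρ => hnormx ρ ⟨hρ.2.1.le, hρ.2.2.1.le⟩
    · have hu : (∑ ρ ∈ F₁ ∪ F₂, (analyticOrderNatAt L ρ : ℝ)) ≤ 2 * C₇ * Real.log T := by
        have := Finset.sum_union_inter (s₁ := F₁) (s₂ := F₂)
          (f := fun ρ => (analyticOrderNatAt L ρ : ℝ))
        have h0 : 0 ≤ ∑ ρ ∈ F₁ ∩ F₂, (analyticOrderNatAt L ρ : ℝ) :=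
          Finset.sum_nonneg fun _ _ => Nat.cast_nonneg _
        linarith
      have := mul_le_mul_of_nonneg_right hu hX0
      linarith
  have hT'T : ‖(mR + mL) / Real.pi * T' - (mR + mL) / Real.pi * T‖
      ≤ ‖(mR + mL) / Real.pi‖ / Real.log 2 * Real.log T := by
    rw [← mul_sub, norm_mul]
    have e : ‖(T' : ℂ) - T‖ ≤ 1 := by
      rw [← Complex.ofReal_sub, Complex.norm_real, Real.norm_eq_abs]
      exact abs_le.mpr ⟨by linarith, by linarith⟩
    refine (mul_le_of_le_one_right (norm_nonneg _) e).trans (hconst _ (norm_nonneg _))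
  have hsplit : zeroSum L σ B T x - (mR + mL) / Real.pi * T
      = (zeroSum L σ B T' x - (mR + mL) / Real.pi * T')
        - (zeroSum L σ B T' x - zeroSum L σ B T x)
        + ((mR + mL) / Real.pi * T' - (mR + mL) / Real.pi * T) := by ring
  rw [hsplit]
  refine (norm_add_le _ _).trans ?_
  have := norm_sub_le (zeroSum L σ B T' x - (mR + mL) / Real.pi * T')
    (zeroSum L σ B T' x - zeroSum L σ B T x)
  linarith

/-- Landau's formula for `L`: the sum of `x ^ ρ` over the zeros up to height `T`. -/
theorem zeroSum_isBigO (h : HasFunctionalEquation κ B w Λ L) (hκ : ∀ n : ℤ, κ / 2 ≠ n)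
    {b : ℝ} (hb : B < b) {lam : ℕ → ℝ} {bf : ℕ → ℂ} {c₀ : ℂ}
    (hlam : ∀ n, 1 ≤ lam n) (htend : Tendsto lam atTop atTop)
    (hsum : ∀ s : ℂ, B ≤ s.re →
      HasSum (fun n => bf n * (lam n : ℂ) ^ (-s)) (logDeriv L s + c₀))
    {x : ℝ} (hx : 0 < x) (hx1 : x ≠ 1) {d : ℕ}
    (hd : ∀ n : ℕ, x = lam n ∨ x = (lam n)⁻¹ → n = d) :
    (fun T : ℝ => zeroSum L (κ - b) B T x - bf d / (Real.pi : ℂ)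
        * ((delta x (lam d) + x ^ κ * delta x (lam d)⁻¹ : ℝ) : ℂ) * (T : ℂ))
      =O[atTop] Real.log := by
  have hG := h.hasModerateGrowth hκ
  have hent := h.differentiable
  have hhalf := h.half_le
  -- move the left side so that it avoids the zeros at the poles of `Γ`
  obtain ⟨b', hbb', hb'Z⟩ : ∃ b', b < b' ∧ ∀ n : ℕ, κ - b' ≠ -n := by
    by_contra! hcon
    obtain ⟨m, hm⟩ := hcon (b + 1 / 2) (by linarith)
    obtain ⟨n, hn⟩ := hcon (b + 1 / 3) (by linarith)
    have h1 : (6 : ℝ) * (m - n) = 1 := by linarith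
    have h2 : 6 * ((m : ℤ) - n) = 1 := by exact_mod_cast h1
    omega
  obtain ⟨C, hC⟩ := h.exists_zeroSum_bound hκ (hb.trans hbb') hb'Z hlam htend hsum hx hx1 hd
  have hfin := finite_zeros_of_isCompact hent hG.ne_zero
    (isCompact_Icc.reProdIm isCompact_Icc : IsCompact (Icc (κ - b') (κ - b) ×ℂ Icc (0 : ℝ) 0))
  set F := hfin.toFinset with hF
  have hX0 : 0 ≤ x ^ (κ - b') + x ^ B := by positivity
  have hdiff : ∀ T, ‖zeroSum L (κ - b') B T x - zeroSum L (κ - b) B T x‖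
      ≤ (∑ ρ ∈ F, (analyticOrderNatAt L ρ : ℝ)) * (x ^ (κ - b') + x ^ B) := by
    intro T
    refine norm_zeroSum_sub_le hent hG.ne_zero
      (fun z hz => ⟨hz.1, (by linarith : κ - b' < κ - b).trans hz.2.1, hz.2.2⟩) ?_ ?_ hX0
    · rintro z ⟨⟨h0, h1, h2, h3⟩, h4⟩
      have hre : z.re ≤ κ - b := by
        by_contra! hlt
        exact h4 ⟨h0, hlt, h2, h3⟩
      have hΓ : Complex.Gamma z = 0 := by
        by_contra hne
        exact h.ne_zero_of_re_le (by linarith) hne h0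
      have him : z.im = 0 := by
        by_contra hne
        exact Gamma_ne_zero_of_im_ne_zero hne hΓ
      rw [hF, Set.Finite.coe_toFinset]
      exact ⟨⟨⟨h1.le, hre⟩, by rw [mem_preimage, him]; simp⟩, h0⟩
    · intro ρ hρ
      rw [norm_ofReal_cpow hx]
      exact rpow_le_add hx ⟨hρ.2.1.le, hρ.2.2.1.le⟩
  set E := (∑ ρ ∈ F, (analyticOrderNatAt L ρ : ℝ)) * (x ^ (κ - b') + x ^ B)
  have hE0 : 0 ≤ E := (norm_nonneg _).trans (hdiff 0)
  have hl2 : 0 < Real.log 2 := Real.log_pos (by norm_num)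
  refine Asymptotics.IsBigO.of_bound (C + E / Real.log 2) ?_
  filter_upwards [eventually_ge_atTop 2] with T hT
  have hlT : Real.log 2 ≤ Real.log T := Real.log_le_log (by norm_num) hT
  rw [Real.norm_of_nonneg (hl2.le.trans hlT)]
  have h1 : E ≤ E / Real.log 2 * Real.log T := by
    rw [div_mul_eq_mul_div, le_div_iff₀ hl2]
    exact mul_le_mul_of_nonneg_left hlT hE0
  have h2 := hC T hT
  have h3 := hdiff T
  set m := bf d / (Real.pi : ℂ)
        * ((delta x (lam d) + x ^ κ * delta x (lam d)⁻¹ : ℝ) : ℂ) * (T : ℂ)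
  have h4 := norm_sub_le (zeroSum L (κ - b') B T x - m)
    (zeroSum L (κ - b') B T x - zeroSum L (κ - b) B T x)
  rw [sub_sub_sub_cancel_left] at h4
  rw [show zeroSum L (κ - b) B T x - m = (zeroSum L (κ - b') B T x - m)
    - (zeroSum L (κ - b') B T x - zeroSum L (κ - b) B T x) by ring]
  refine (norm_sub_le _ _).trans ?_
  linarith

end HasFunctionalEquation

end HalfIntegral

namespace HalfIntegral

open Filter Topology Asymptotics Set MeasureTheory

/-! ### Growth of cusp forms of half-integral weight -/

theorem norm_shimuraSymbol (γ : SL(2, ℤ)) :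
    ‖(shimuraSymbol (γ 1 0) (γ 1 1) : ℂ)‖ = 1 := by
  have hdet := γ.det_coe
  rw [Matrix.det_fin_two] at hdet
  have hg : (γ 1 0).gcd (((γ 1 1).natAbs : ℕ) : ℤ) = 1 := by
    have h1 : IsCoprime (γ 1 0) (γ 1 1) := ⟨-γ 0 1, γ 0 0, by linarith⟩
    rw [Int.gcd, Int.natAbs_natCast]
    exact Int.isCoprime_iff_gcd_eq_one.mp h1
  rw [shimuraSymbol]
  rcases jacobiSym.eq_one_or_neg_one hg with h | h <;> rw [h] <;> split_ifs <;> simp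

theorem norm_eps (d : ℤ) : ‖eps d‖ = 1 := by
  rw [eps]; split_ifs <;> simp

theorem half_weight_cast (k : ℕ) : (k : ℂ) + 1 / 2 = (((k : ℝ) + 1 / 2 : ℝ) : ℂ) := by
  push_cast; ring

namespace IsCuspForm

variable {k : ℕ} {f : ℍ → ℂ}

theorem norm_smul (hf : IsCuspForm k f) {γ : SL(2, ℤ)} (hγ : γ ∈ CongruenceSubgroup.Gamma0 4)
    (z : ℍ) : ‖f (γ • z)‖ =
      ‖((γ 1 0 : ℤ) : ℂ) * (z : ℂ) + ((γ 1 1 : ℤ) : ℂ)‖ ^ ((k : ℝ) + 1 / 2) * ‖f z‖ := by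
  rw [hf.transform γ hγ z, half_weight_cast]
  simp only [norm_mul, norm_pow, norm_inv, norm_shimuraSymbol γ, norm_eps, one_pow, inv_one,
    one_mul, Complex.norm_cpow_real]

theorem im_smul_rpow (γ : SL(2, ℤ)) (z : ℍ) (κ : ℝ) : (γ • z).im ^ (κ / 2) =
    z.im ^ (κ / 2) * ‖((γ 1 0 : ℤ) : ℂ) * (z : ℂ) + ((γ 1 1 : ℤ) : ℂ)‖ ^ (-κ) := by
  have h : (γ • z).im =
      z.im / ‖((γ 1 0 : ℤ) : ℂ) * (z : ℂ) + ((γ 1 1 : ℤ) : ℂ)‖ ^ 2 := by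
    rw [ModularGroup.im_smul_eq_div_normSq, ModularGroup.denom_apply,
      Complex.normSq_eq_norm_sq]
  rw [h, Real.div_rpow z.im_pos.le (by positivity), ← Real.rpow_natCast,
    ← Real.rpow_mul (norm_nonneg _), Real.rpow_neg (norm_nonneg _), div_eq_mul_inv]
  congr 3
  push_cast; ring

theorem continuous (hf : IsCuspForm k f) : Continuous f := hf.holo.continuous

/-- The function `‖f z‖ (im z) ^ (κ/2)` is invariant under `Γ₀(4)`, and it is
`O((im z) ^ (κ/2))` at all cusps; this bounds it on the whole half-plane. -/
theorem exists_norm_le (hf : IsCuspForm k f) :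
    ∃ C, ∀ z : ℍ, z.im ≤ 1 → ‖f z‖ ≤ C * z.im ^ (-((k : ℝ) + 1 / 2)) := by
  set κ : ℝ := (k : ℝ) + 1 / 2 with hκ
  have hκ0 : 0 ≤ κ := by positivity
  obtain ⟨C, hC⟩ := ModularGroup.exists_bound_of_subgroup_invariant_of_isBigO
    (f := fun z : ℍ => ‖f z‖ * z.im ^ (κ / 2)) (t := κ / 2)
    (hf.continuous.norm.mul (continuous_im.rpow_const fun z => .inl z.im_ne_zero)) (by positivity)
    (fun γ => by
      have h0 := (hf.zero_at_cusps γ).isBoundedAtImInfty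
      have h1 := h0.norm_left.mul (isBigO_refl (fun z : ℍ => z.im ^ (κ / 2)) atImInfty)
      refine (h1.congr (fun z => ?_) (fun z => ?_))
      · rw [im_smul_rpow, norm_mul, half_weight_cast, ← Complex.ofReal_neg, Complex.norm_cpow_real]
        ring
      · simp)
    (Γ := CongruenceSubgroup.Gamma0 4)
    (fun γ hγ z => by
      rw [im_smul_rpow, hf.norm_smul hγ, ← hκ]
      have h0 : 0 < ‖((γ 1 0 : ℤ) : ℂ) * (z : ℂ) + ((γ 1 1 : ℤ) : ℂ)‖ := by
        rw [← ModularGroup.denom_apply]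
        exact norm_pos_iff.mpr (denom_ne_zero _ z)
      rw [Real.rpow_neg h0.le]
      have := (Real.rpow_pos_of_pos h0 κ).ne'
      field_simp)
  refine ⟨C, fun z hz => ?_⟩
  have h1 := hC z
  have hy := z.im_pos
  rw [max_eq_right ((hz.trans (by rw [le_div_iff₀ hy]; linarith))), Real.norm_of_nonneg
    (by positivity), one_div, Real.inv_rpow hy.le, ← le_div_iff₀ (by positivity)] at h1
  refine h1.trans (le_of_eq ?_)
  rw [Real.rpow_neg hy.le, mul_div_assoc, ← one_div, div_div, ← Real.rpow_add hy, add_halves,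
    one_div]

theorem periodic (hf : IsCuspForm k f) : Function.Periodic (f ∘ ofComplex) 1 := by
  intro w
  by_cases! hw : 0 < w.im
  · have hw' : 0 < (w + 1).im := by simpa using hw
    simp only [Function.comp_apply, ofComplex_apply_of_im_pos hw', ofComplex_apply_of_im_pos hw]
    have h := hf.transform ModularGroup.T (by simp [CongruenceSubgroup.Gamma0_mem,
      ModularGroup.coe_T]) ⟨w, hw⟩
    rw [modular_T_smul] at h
    have e : (1 : ℝ) +ᵥ (⟨w, hw⟩ : ℍ) = ⟨w + 1, hw'⟩ := by
      ext; simp [add_comm]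
    rw [e] at h
    simpa [ModularGroup.coe_T, shimuraSymbol, eps] using h
  · have : (w + 1).im ≤ 0 := by simpa using hw
    simp [ofComplex_apply_of_im_nonpos this, ofComplex_apply_of_im_nonpos hw]

theorem isZeroAtImInfty (hf : IsCuspForm k f) : IsZeroAtImInfty f := by
  simpa using hf.zero_at_cusps 1

theorem isBoundedAtImInfty (hf : IsCuspForm k f) : IsBoundedAtImInfty f :=
  hf.isZeroAtImInfty.isBoundedAtImInfty

theorem fourierCoeff_zero (hf : IsCuspForm k f) : fourierCoeff f 0 = 0 := by
  simp [fourierCoeff, qExpansion_coeff, hf.isZeroAtImInfty.cuspFunction_apply_zero one_pos]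

theorem hasSum_fourierCoeff (hf : IsCuspForm k f) (z : ℍ) :
    HasSum (fun n : ℕ => fourierCoeff f n * Function.Periodic.qParam 1 z ^ n) (f z) :=
  hasSum_qExpansion one_pos (by simpa using hf.periodic) hf.holo hf.isBoundedAtImInfty z

theorem isBigO_atImInfty (hf : IsCuspForm k f) :
    f =O[atImInfty] fun z => Real.exp (-2 * Real.pi * z.im) := by
  simpa using hf.isZeroAtImInfty.exp_decay_atImInfty one_pos (by simpa using hf.periodic) hf.holo
    hf.isBoundedAtImInfty

/-- A polynomial bound for the Fourier coefficients, from the integral over the segment of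
height `1 / n`. -/
theorem exists_norm_fourierCoeff_le (hf : IsCuspForm k f) :
    ∃ C, ∀ n : ℕ, n ≠ 0 → ‖fourierCoeff f n‖ ≤ C * (n : ℝ) ^ ((k : ℝ) + 1 / 2) := by
  obtain ⟨C, hC⟩ := hf.exists_norm_le
  refine ⟨Real.exp (2 * Real.pi) * C, fun n hn => ?_⟩
  have hn0 : (0 : ℝ) < n := by positivity
  obtain ⟨t, ht, htn⟩ : ∃ t : ℝ, 0 < t ∧ t = (n : ℝ)⁻¹ := ⟨_, by positivity, rfl⟩
  rw [fourierCoeff, qExpansion_coeff_eq_intervalIntegral one_pos (by simpa using hf.periodic)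
    hf.holo hf.isBoundedAtImInfty n ht]
  have hb : ∀ u ∈ Set.uIoc (0 : ℝ) 1, ‖1 / Function.Periodic.qParam 1
      ((u : ℂ) + (t : ℂ) * Complex.I) ^ n * f ⟨(u : ℂ) + (t : ℂ) * Complex.I,
        by simpa using ht⟩‖ ≤ Real.exp (2 * Real.pi) * C * (n : ℝ) ^ ((k : ℝ) + 1 / 2) := by
    intro u _
    have him : (⟨(u : ℂ) + (t : ℂ) * Complex.I, by simpa using ht⟩ : ℍ).im = t := by
      rw [← UpperHalfPlane.coe_im]; simp
    have h1 := hC ⟨(u : ℂ) + (t : ℂ) * Complex.I, by simpa using ht⟩ (by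
      rw [him, htn]
      exact inv_le_one_of_one_le₀ (by exact_mod_cast Nat.one_le_iff_ne_zero.mpr hn))
    have e : t ^ (-((k : ℝ) + 1 / 2)) = (n : ℝ) ^ ((k : ℝ) + 1 / 2) := by
      rw [htn, Real.inv_rpow hn0.le, Real.rpow_neg hn0.le, inv_inv]
    rw [him, e] at h1
    rw [norm_mul, norm_div, norm_one, norm_pow, Function.Periodic.norm_qParam, ← Real.exp_nat_mul,
      one_div, ← Real.exp_neg, mul_assoc (Real.exp _) C]
    refine mul_le_mul (le_of_eq ?_) h1 (norm_nonneg _) (Real.exp_pos _).le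
    congr 1
    simp [htn]
    field_simp
  have := intervalIntegral.norm_integral_le_of_norm_le_const hb
  simpa using this

theorem abscissaOfAbsConv_le (hf : IsCuspForm k f) :
    LSeries.abscissaOfAbsConv (fourierCoeff f) ≤ (((k : ℝ) + 1 / 2 + 1 : ℝ) : EReal) := by
  have := LSeries.abscissaOfAbsConv_le_of_le_const_mul_rpow hf.exists_norm_fourierCoeff_le
  exact_mod_cast this

end IsCuspForm

end HalfIntegral

namespace HalfIntegral

open Filter Topology Asymptotics Set MeasureTheory

/-! ### Mellin transform and functional equation -/

/-- The function `t ↦ f (i t / 2)` on the positive reals; the factor `1/2` moves the fixed point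
`i / 2` of the Fricke involution to `t = 1`. -/
noncomputable def imagAxis (f : ℍ → ℂ) (t : ℝ) : ℂ := f (ofComplex ((t / 2 : ℝ) * Complex.I))

theorem imagAxis_of_pos (f : ℍ → ℂ) {t : ℝ} (ht : 0 < t) :
    imagAxis f t = f ⟨(t / 2 : ℝ) * Complex.I, by simpa using ht⟩ := by
  rw [imagAxis, ofComplex_apply_of_im_pos (by simpa using ht)]

theorem ofReal_mul_I_cpow {y : ℝ} (hy : 0 < y) (s : ℂ) :
    ((y : ℂ) * Complex.I) ^ s = (y : ℂ) ^ s * Complex.I ^ s := by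
  have hy' : (y : ℂ) ≠ 0 := by exact_mod_cast hy.ne'
  rw [Complex.cpow_def_of_ne_zero (mul_ne_zero hy' Complex.I_ne_zero),
    Complex.cpow_def_of_ne_zero hy', Complex.cpow_def_of_ne_zero Complex.I_ne_zero,
    Complex.log_ofReal_mul hy Complex.I_ne_zero, Complex.ofReal_log hy.le, add_mul, Complex.exp_add]

/-- Every point of the upper half-plane has the form `-1 / (4 z)`, so the Fricke eigenvalue of a
nonzero function cannot vanish. -/
theorem fricke_eigenvalue_ne_zero {k : ℕ} {f : ℍ → ℂ} (hf0 : f ≠ 0) {w : ℂ}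
    (hw : ∀ z, fricke k f z = w * f z) : w ≠ 0 := by
  rintro rfl
  apply hf0
  funext z
  have h := hw ⟨-1 / (4 * (z : ℂ)), fricke_im_pos z⟩
  have hz := UpperHalfPlane.ne_zero z
  have e : (⟨-1 / (4 * (((⟨-1 / (4 * (z : ℂ)), fricke_im_pos z⟩ : ℍ)) : ℂ)),
      fricke_im_pos _⟩ : ℍ) = z := by
    ext
    simp only
    field_simp
  rw [fricke, zero_mul, e] at h
  simpa [Complex.cpow_eq_zero_iff, hz] using h

namespace IsCuspForm

variable {k : ℕ} {f : ℍ → ℂ}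

theorem hasSum_imagAxis (hf : IsCuspForm k f) {t : ℝ} (ht : 0 < t) :
    HasSum (fun n : ℕ => fourierCoeff f n * Real.exp (-Real.pi * n * t)) (imagAxis f t) := by
  rw [imagAxis_of_pos f ht]
  refine (hf.hasSum_fourierCoeff _).congr_fun fun n => ?_
  rw [Function.Periodic.qParam, ← Complex.exp_nat_mul, Complex.ofReal_exp]
  congr 2
  push_cast
  linear_combination (-(Real.pi : ℂ) * n * t) * Complex.I_sq

theorem continuousOn_imagAxis (hf : IsCuspForm k f) : ContinuousOn (imagAxis f) (Ioi 0) := by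
  have h := (UpperHalfPlane.mdifferentiable_iff.mp hf.holo).continuousOn
  exact h.comp (f := fun t : ℝ => ((t / 2 : ℝ) : ℂ) * Complex.I) (by fun_prop)
    (fun t ht => by simpa using ht)

theorem isBigO_imagAxis (hf : IsCuspForm k f) (r : ℝ) :
    imagAxis f =O[atTop] fun t : ℝ => t ^ r := by
  have h1 : Tendsto (fun t : ℝ => ofComplex (((t / 2 : ℝ) : ℂ) * Complex.I)) atTop atImInfty := by
    rw [atImInfty, tendsto_comap_iff]
    refine (tendsto_id.atTop_div_const two_pos).congr' ?_
    filter_upwards [eventually_gt_atTop 0] with t ht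
    rw [Function.comp_apply, ofComplex_apply_of_im_pos (by simpa using ht),
      ← UpperHalfPlane.coe_im]
    simp
  have h2 := hf.isBigO_atImInfty.comp_tendsto h1
  refine IsBigO.trans (g := fun t : ℝ => Real.exp (-Real.pi * t)) ?_
    (isLittleO_exp_neg_mul_rpow_atTop Real.pi_pos r).isBigO
  refine h2.congr' .rfl ?_
  filter_upwards [eventually_gt_atTop 0] with t ht
  rw [Function.comp_apply, ofComplex_apply_of_im_pos (by simpa using ht), ← UpperHalfPlane.coe_im]
  congr 1
  simp
  ring

end IsCuspForm

theorem imagAxis_one_div {k : ℕ} {f : ℍ → ℂ} {w : ℂ} (hw : ∀ z, fricke k f z = w * f z) {t : ℝ}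
    (ht : 0 < t) :
    imagAxis f (1 / t) = w * ((t ^ ((k : ℝ) + 1 / 2) : ℝ) : ℂ) * imagAxis f t := by
  have h := hw ⟨(t / 2 : ℝ) * Complex.I, by simpa using ht⟩
  have ht' : (t : ℂ) ≠ 0 := by exact_mod_cast ht.ne'
  have e : (⟨-1 / (4 * (((⟨(t / 2 : ℝ) * Complex.I, by simpa using ht⟩ : ℍ)) : ℂ)),
      fricke_im_pos _⟩ : ℍ) = ⟨(1 / t / 2 : ℝ) * Complex.I, by simpa using ht⟩ := by
    ext
    simp only
    push_cast
    field_simp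
    rw [Complex.I_sq]; norm_num
  rw [fricke, e, ← imagAxis_of_pos f ht, ← imagAxis_of_pos f (by positivity)] at h
  simp only at h
  rw [ofReal_mul_I_cpow (by positivity)] at h
  set κ : ℝ := (k : ℝ) + 1 / 2 with hκ
  have hκ1 : (k : ℂ) + 1 / 2 = κ := by rw [hκ]; push_cast; ring
  have hκ2 : -(k : ℂ) - 1 / 2 = -κ := by rw [hκ]; push_cast; ring
  have h2 : (2 : ℂ) ^ (-κ : ℂ) * ((t / 2 : ℝ) : ℂ) ^ (-κ : ℂ) = ((t ^ κ : ℝ) : ℂ)⁻¹ := by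
    rw [show (2 : ℂ) = ((2 : ℝ) : ℂ) by norm_num, ← Complex.mul_cpow_ofReal_nonneg zero_le_two
      (by positivity), ← Complex.ofReal_mul, mul_div_cancel₀ _ two_ne_zero, Complex.cpow_neg,
      Complex.ofReal_cpow ht.le]
  have hI : Complex.I ^ (κ : ℂ) * Complex.I ^ (-κ : ℂ) = 1 := by
    rw [← Complex.cpow_add _ _ Complex.I_ne_zero, add_neg_cancel, Complex.cpow_zero]
  have hT : ((t ^ κ : ℝ) : ℂ) ≠ 0 := by exact_mod_cast (Real.rpow_pos_of_pos ht κ).ne'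
  rw [hκ1, hκ2] at h
  have h3 : ((t ^ κ : ℝ) : ℂ)⁻¹ * imagAxis f (1 / t) = w * imagAxis f t := by
    rw [← h, ← h2]
    linear_combination (-((2 : ℂ) ^ (-κ : ℂ) * ((t / 2 : ℝ) : ℂ) ^ (-κ : ℂ) *
      imagAxis f (1 / t))) * hI
  field_simp at h3
  rw [h3]; ring

namespace IsCuspForm

variable {k : ℕ} {f : ℍ → ℂ}

/-- The pair of functions `f (i t / 2)`, `f (i t / 2)`, whose Mellin transform is the completed
`L`-function of `f`. -/
noncomputable def fePair (hf : IsCuspForm k f) {w : ℂ} (hw0 : w ≠ 0)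
    (hw : ∀ z, fricke k f z = w * f z) : WeakFEPair ℂ where
  f := imagAxis f
  g := imagAxis f
  k := (k : ℝ) + 1 / 2
  ε := w
  f₀ := 0
  g₀ := 0
  hf_int := hf.continuousOn_imagAxis.locallyIntegrableOn measurableSet_Ioi
  hg_int := hf.continuousOn_imagAxis.locallyIntegrableOn measurableSet_Ioi
  hk := by positivity
  hε := hw0
  h_feq := fun t ht => imagAxis_one_div hw ht
  hf_top := fun r => by simpa using hf.isBigO_imagAxis r
  hg_top := fun r => by simpa using hf.isBigO_imagAxis r

/-- The Mellin transform of `f (i t / 2)` is entire, satisfies a functional equation, is bounded in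
vertical strips, and completes the Dirichlet series of `f`. -/
theorem exists_completed (hf : IsCuspForm k f) (hf0 : f ≠ 0) (hw : IsFrickeEigen k f) :
    ∃ (w : ℂ) (Λ : ℂ → ℂ), w ≠ 0 ∧ Differentiable ℂ Λ ∧
      (∀ s, Λ (((k : ℝ) + 1 / 2 : ℝ) - s) = w * Λ s) ∧
      (∀ a b : ℝ, ∃ C, ∀ s : ℂ, s.re ∈ Icc a b → ‖Λ s‖ ≤ C) ∧
      IsEntireContinuation (fourierCoeff f)
        (fun s => (Real.pi : ℂ) ^ s * Λ s * (Complex.Gamma s)⁻¹) := by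
  obtain ⟨w, hw⟩ := hw
  have hw0 := fricke_eigenvalue_ne_zero hf0 hw
  set P := hf.fePair hw0 hw with hP
  have hS : IsStrongFEPair P := ⟨rfl, rfl⟩
  have hM : ∀ s, HasMellin (imagAxis f) s (P.Λ s) := hS.hasMellin
  have hdiff : Differentiable ℂ fun s => (Real.pi : ℂ) ^ s * P.Λ s * (Complex.Gamma s)⁻¹ :=
    ((differentiable_ofReal_cpow Real.pi_pos).mul hS.differentiable_Λ).mul
      Complex.differentiable_one_div_Gamma
  refine ⟨w, P.Λ, hw0, hS.differentiable_Λ, fun s => ?_, fun a b => ?_, hdiff, fun s hs => ?_⟩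
  · refine (P.functional_equation s).trans ?_
    rw [← (hS.symm.hasMellin s).2, ← (hM s).2]
    rfl
  · have hint : ∀ σ : ℝ, IntegrableOn (fun t : ℝ => t ^ (σ - 1) * ‖imagAxis f t‖) (Ioi 0) := by
      intro σ
      refine IntegrableOn.congr_fun (hM σ).1.norm (fun t ht => ?_) measurableSet_Ioi
      have ht : (0 : ℝ) < t := ht
      simp only [_root_.norm_smul]
      rw [norm_ofReal_cpow ht]
      simp
    refine ⟨∫ t in Ioi (0 : ℝ), (t ^ (a - 1) * ‖imagAxis f t‖ + t ^ (b - 1) * ‖imagAxis f t‖),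
      fun s hs => ?_⟩
    rw [← (hM s).2, mellin]
    refine norm_integral_le_of_norm_le ((hint a).add (hint b)) ?_
    refine (ae_restrict_iff' measurableSet_Ioi).mpr (.of_forall fun t ht => ?_)
    have ht : (0 : ℝ) < t := ht
    rw [_root_.norm_smul, norm_ofReal_cpow ht, ← add_mul]
    refine mul_le_mul_of_nonneg_right (rpow_le_add ht ?_) (norm_nonneg _)
    simpa using hs
  · set a := fourierCoeff f with ha
    have key : ∀ s : ℂ, (k : ℝ) + 1 / 2 + 1 < s.re →
        (Real.pi : ℂ) ^ s * P.Λ s * (Complex.Gamma s)⁻¹ = LSeries a s := by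
      intro s hs
      have hs0 : 0 < s.re := lt_trans (by positivity) hs
      have hsum : LSeriesSummable a s := LSeriesSummable_of_abscissaOfAbsConv_lt_re
        (hf.abscissaOfAbsConv_le.trans_lt (by exact_mod_cast hs))
      have h1 := hasSum_mellin_pi_mul (a := a) (q := fun n : ℕ => (n : ℝ)) (F := imagAxis f)
        (s := s) (fun n => by
          rcases Nat.eq_zero_or_pos n with rfl | h
          · exact Or.inl hf.fourierCoeff_zero
          · exact Or.inr (by exact_mod_cast h)) hs0
        (fun t ht => hf.hasSum_imagAxis ht) (by
          refine hsum.norm.congr fun n => ?_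
          rcases Nat.eq_zero_or_pos n with rfl | h
          · simp [ha, hf.fourierCoeff_zero]
          · rw [LSeries.norm_term_eq, if_neg h.ne'])
      have h2 : HasSum (fun n : ℕ => (Real.pi : ℂ) ^ (-s) * Complex.Gamma s * a n /
          ((n : ℝ) : ℂ) ^ s) ((Real.pi : ℂ) ^ (-s) * Complex.Gamma s * LSeries a s) := by
        refine (hsum.hasSum.mul_left ((Real.pi : ℂ) ^ (-s) * Complex.Gamma s)).congr_fun fun n => ?_
        rcases Nat.eq_zero_or_pos n with rfl | h
        · simp [ha, hf.fourierCoeff_zero]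
        · rw [LSeries.term_of_ne_zero h.ne', mul_div_assoc, Complex.ofReal_natCast]
      rw [← (hM s).2, h1.unique h2, Complex.cpow_neg]
      have h3 : Complex.Gamma s ≠ 0 := Complex.Gamma_ne_zero_of_re_pos hs0
      have h4 : (Real.pi : ℂ) ^ s ≠ 0 := by simp [Complex.cpow_eq_zero_iff, Real.pi_ne_zero]
      field_simp
    have hpre : IsPreconnected {s : ℂ | LSeries.abscissaOfAbsConv a < (s.re : EReal)} := by
      refine Convex.isPreconnected fun x hx y hy p q hp hq hpq => ?_
      have h1 : min x.re y.re ≤ (p • x + q • y).re := by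
        simp only [Complex.add_re, Complex.smul_re, smul_eq_mul]
        calc min x.re y.re = p * min x.re y.re + q * min x.re y.re := by
              rw [← add_mul, hpq, one_mul]
          _ ≤ p * x.re + q * y.re := by gcongr <;> simp
      refine lt_of_lt_of_le ?_ (EReal.coe_le_coe_iff.mpr h1)
      rcases min_choice x.re y.re with h | h <;> rw [h] <;> assumption
    have hz : (k : ℝ) + 1 / 2 + 1 < ((((k : ℝ) + 1 / 2 + 2 : ℝ) : ℂ)).re := by
      rw [Complex.ofReal_re]; linarith
    refine AnalyticOnNhd.eqOn_of_preconnected_of_eventuallyEq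
      (hdiff.differentiableOn.analyticOnNhd isOpen_univ |>.mono (subset_univ _))
      (LSeries_analyticOnNhd a) hpre (z₀ := (((k : ℝ) + 1 / 2 + 2 : ℝ) : ℂ))
      (hf.abscissaOfAbsConv_le.trans_lt (by exact_mod_cast hz)) ?_ hs
    filter_upwards [(isOpen_lt continuous_const Complex.continuous_re).mem_nhds hz] with s hs
    exact key s hs

end IsCuspForm

end HalfIntegral

namespace HalfIntegral

open Filter Topology Set

/-! ### Powers and geometric series of absolutely convergent sums -/

theorem hasSum_prod_tuple {ι R : Type*} [NormedField R] [CompleteSpace R] {g : ι → R} {S : R}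
    (hg : Summable fun i => ‖g i‖) (hS : HasSum g S) (n : ℕ) :
    HasSum (fun v : Fin n → ι => ∏ i, g (v i)) (S ^ n) ∧
      Summable fun v : Fin n → ι => ‖∏ i, g (v i)‖ := by
  induction n with
  | zero => exact ⟨by simp [hasSum_unique], Summable.of_finite⟩
  | succ n ih =>
    have h1 := hg.mul_norm ih.2
    have h2 := hS.mul ih.1 h1.of_norm
    refine ⟨?_, ?_⟩
    · rw [← (Fin.consEquiv fun _ : Fin (n + 1) => ι).hasSum_iff, pow_succ']
      refine h2.congr_fun fun p => ?_
      simp [Fin.prod_univ_succ, Fin.consEquiv]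
    · rw [← (Fin.consEquiv fun _ : Fin (n + 1) => ι).summable_iff]
      refine h1.congr fun p => ?_
      simp [Fin.prod_univ_succ, Fin.consEquiv]

/-- The geometric series `∑ₙ (∑ᵢ g i) ^ n`, multiplied out into a sum over all finite tuples. -/
theorem hasSum_prod_tuples {ι : Type*} {g : ι → ℂ} {S : ℂ} (hg : Summable fun i => ‖g i‖)
    (hg1 : ∑' i, ‖g i‖ < 1) (hS : HasSum g S) :
    HasSum (fun p : Σ n, Fin n → ι => ∏ i, g (p.2 i)) (1 - S)⁻¹ ∧
      Summable fun p : Σ n, Fin n → ι => ‖∏ i, g (p.2 i)‖ := by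
  have hn : ∀ n, HasSum (fun v : Fin n → ι => ‖∏ i, g (v i)‖) ((∑' i, ‖g i‖) ^ n) := fun n => by
    have := (hasSum_prod_tuple (g := fun i => ‖g i‖) (by simpa using hg) hg.hasSum n).1
    simpa [norm_prod] using this
  have h0 : 0 ≤ ∑' i, ‖g i‖ := tsum_nonneg fun _ => norm_nonneg _
  have hs : Summable fun p : Σ n, Fin n → ι => ‖∏ i, g (p.2 i)‖ := by
    refine (summable_sigma_of_nonneg fun _ => norm_nonneg _).mpr ⟨fun n => (hn n).summable, ?_⟩
    refine (summable_geometric_of_lt_one h0 hg1).congr fun n => ?_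
    exact (hn n).tsum_eq.symm
  refine ⟨?_, hs⟩
  have hS1 : ‖S‖ < 1 := by
    rw [← hS.tsum_eq]
    exact (norm_tsum_le_tsum_norm hg).trans_lt hg1
  have h1 := hs.of_norm.hasSum
  have h2 := h1.sigma fun n => (hasSum_prod_tuple hg hS n).1
  rw [← h2.unique (hasSum_geometric_of_norm_lt_one hS1)]
  exact h1

/-! ### Enumeration of locally finite sets of frequencies -/

/-- An infinite set of reals with finitely many elements below each bound is the range of a strictly
increasing sequence tending to infinity. -/
theorem exists_strictMono_range_eq {V : Set ℝ} (hV : V.Infinite)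
    (hfin : ∀ R, {v ∈ V | v ≤ R}.Finite) :
    ∃ lam : ℕ → ℝ, StrictMono lam ∧ range lam = V ∧ Tendsto lam atTop atTop := by
  -- the next element of `V` above `u`
  have hnext : ∀ u : ℝ, ∃ v ∈ V, u < v ∧ ∀ w ∈ V, u < w → v ≤ w := by
    intro u
    obtain ⟨v₀, hv₀, huv₀⟩ : ∃ v₀ ∈ V, u < v₀ := by
      by_contra! h
      exact hV ((hfin u).subset fun v hv => ⟨hv, h v hv⟩)
    obtain ⟨v, ⟨⟨hv, hvv₀⟩, huv⟩, hmin⟩ := ((hfin v₀).subset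
      (fun _ h => h.1 : {v | v ∈ {v ∈ V | v ≤ v₀} ∧ u < v} ⊆ _)).exists_minimalFor id _
        ⟨v₀, ⟨hv₀, le_rfl⟩, huv₀⟩
    refine ⟨v, hv, huv, fun w hw huw => ?_⟩
    by_contra! h
    exact (hmin ⟨⟨hw, h.le.trans hvv₀⟩, huw⟩ h.le).not_gt h
  obtain ⟨v₁, hv₁, hmin₁⟩ : ∃ v ∈ V, ∀ w ∈ V, v ≤ w := by
    obtain ⟨v₀, hv₀⟩ := hV.nonempty
    obtain ⟨v, hv, hmin⟩ := (hfin v₀).exists_minimalFor id _ ⟨v₀, hv₀, le_rfl⟩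
    refine ⟨v, hv.1, fun w hw => ?_⟩
    by_contra! h
    exact (hmin ⟨hw, h.le.trans hv.2⟩ h.le).not_gt h
  choose nxt hnV hnlt hnmin using hnext
  set lam : ℕ → ℝ := fun n => nxt^[n] v₁ with hlam
  have hsucc : ∀ n, lam (n + 1) = nxt (lam n) := fun n => Function.iterate_succ_apply' nxt n v₁
  have hmem : ∀ n, lam n ∈ V := fun n => by
    cases n with
    | zero => exact hv₁
    | succ n => rw [hsucc]; exact hnV _
  have hmono : StrictMono lam := strictMono_nat_of_lt_succ fun n => by
    rw [hsucc]; exact hnlt _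
  have htend : Tendsto lam atTop atTop := by
    refine tendsto_atTop_atTop_of_monotone hmono.monotone fun R => ?_
    by_contra! h
    exact (infinite_range_of_injective hmono.injective)
      ((hfin R).subset (range_subset_iff.mpr fun n => ⟨hmem n, (h n).le⟩))
  refine ⟨lam, hmono, subset_antisymm (range_subset_iff.mpr hmem) fun v hv => ?_, htend⟩
  have hex : ∃ n, v ≤ lam n := (htend.eventually_ge_atTop v).exists
  classical
  refine ⟨Nat.find hex, le_antisymm ?_ (Nat.find_spec hex)⟩
  rcases h : Nat.find hex with _ | m
  · exact hmin₁ v hv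
  · rw [hsucc]
    exact hnmin _ v hv (not_le.mp (Nat.find_min hex (by omega)))

/-! ### The quotient of two generalized Dirichlet series -/

variable {ι : Type*}

/-- The products `x i * x i₁ ⋯ x iₙ`: the frequencies of `D / (1 + E)`, when `D` and `E` have the
frequencies `x i`. -/
noncomputable def prodFreq (x : ι → ℝ) (j : ι × Σ n, Fin n → ι) : ℝ :=
  x j.1 * ∏ i, x (j.2.2 i)

theorem le_prodFreq {x : ι → ℝ} {q : ℝ} (hq : 1 < q) (hx : ∀ i, q ≤ x i)
    (j : ι × Σ n, Fin n → ι) : q ^ (j.2.1 + 1) ≤ prodFreq x j ∧ x j.1 ≤ prodFreq x j ∧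
      ∀ i, x (j.2.2 i) ≤ prodFreq x j := by
  have h1 : ∀ i, 1 ≤ x i := fun i => hq.le.trans (hx i)
  have hp : q ^ j.2.1 ≤ ∏ i, x (j.2.2 i) := by
    have := Finset.prod_le_prod (s := Finset.univ) (f := fun _ : Fin j.2.1 => q)
      (g := fun i => x (j.2.2 i)) (fun _ _ => by linarith) (fun i _ => hx _)
    simpa using this
  have hp1 : 1 ≤ ∏ i, x (j.2.2 i) := (one_le_pow₀ hq.le).trans hp
  refine ⟨?_, ?_, fun i => ?_⟩
  · rw [pow_succ', prodFreq]
    exact mul_le_mul (hx _) hp (by positivity) (by linarith [h1 j.1])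
  · exact le_mul_of_one_le_right (by linarith [h1 j.1]) hp1
  · have h2 := Finset.prod_le_prod_of_subset_of_one_le (s := {i}) (t := Finset.univ)
      (f := fun i => x (j.2.2 i)) (by simp) (by intro i _; linarith [h1 (j.2.2 i)])
      (fun i _ _ => h1 _)
    rw [Finset.prod_singleton] at h2
    exact h2.trans (le_mul_of_one_le_left (by linarith) (h1 _))

theorem prod_ofReal_cpow {n : ℕ} {y : Fin n → ℝ} (hy : ∀ i, 0 ≤ y i) (s : ℂ) :
    ((∏ i, y i : ℝ) : ℂ) ^ s = ∏ i, (y i : ℂ) ^ s := by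
  induction n with
  | zero => simp
  | succ n ih =>
    rw [Fin.prod_univ_succ, Fin.prod_univ_succ, Complex.ofReal_mul,
      Complex.mul_cpow_ofReal_nonneg (hy _) (Finset.prod_nonneg fun i _ => hy _), ih fun i => hy _]

theorem finite_prodFreq_le {x : ι → ℝ} {q : ℝ} (hq : 1 < q) (hx : ∀ i, q ≤ x i)
    (hfin : ∀ R, {i | x i ≤ R}.Finite) (R : ℝ) : {j | prodFreq x j ≤ R}.Finite := by
  obtain ⟨N, hN⟩ := pow_unbounded_of_one_lt R hq
  refine Set.Finite.subset (s := {i | x i ≤ R} ×ˢ ⋃ n ∈ Iio N,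
    Sigma.mk n '' {v : Fin n → ι | ∀ i, v i ∈ {i | x i ≤ R}}) ?_ ?_
  · exact (hfin R).prod ((finite_Iio N).biUnion fun n _ => (Set.Finite.pi' fun _ => hfin R).image _)
  · intro j hj
    obtain ⟨h1, h2, h3⟩ := le_prodFreq hq hx j
    have hj : prodFreq x j ≤ R := hj
    refine ⟨h2.trans hj, mem_biUnion (x := j.2.1) ?_ ⟨j.2.2, fun i => (h3 i).trans hj, rfl⟩⟩
    by_contra h
    have h4 : q ^ N ≤ q ^ (j.2.1 + 1) := pow_le_pow_right₀ hq.le (by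
      have : N ≤ j.2.1 := not_lt.mp h
      omega)
    linarith

/-- Collecting equal frequencies turns the expansion of `D / (1 + E)` by the geometric series into
a generalized Dirichlet series; its frequencies and coefficients do not depend on `s`. -/
theorem exists_quotient_expansion [Nonempty ι] {x : ι → ℝ} {q : ℝ} (hq : 1 < q)
    (hx : ∀ i, q ≤ x i) (hfin : ∀ R, {i | x i ≤ R}.Finite) (d e : ι → ℂ) :
    ∃ (lam : ℕ → ℝ) (b : ℕ → ℂ), (∀ n, 1 ≤ lam n) ∧ StrictMono lam ∧ Tendsto lam atTop atTop ∧
      ∀ (s D E : ℂ), HasSum (fun i => d i * (x i : ℂ) ^ (-s)) D →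
        HasSum (fun i => e i * (x i : ℂ) ^ (-s)) E →
        (∑' i, ‖e i * (x i : ℂ) ^ (-s)‖ < 1) →
        HasSum (fun n => b n * (lam n : ℂ) ^ (-s)) (D / (1 + E)) := by
  have hx1 : ∀ i, 1 ≤ x i := fun i => hq.le.trans (hx i)
  have hfr := finite_prodFreq_le hq hx hfin
  obtain ⟨lam, hmono, hrange, htend⟩ := exists_strictMono_range_eq (V := range (prodFreq x))
    (fun hV => by
      obtain ⟨R, hR⟩ := hV.bddAbove
      obtain ⟨N, hN⟩ := pow_unbounded_of_one_lt R hq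
      obtain ⟨i⟩ := ‹Nonempty ι›
      have h1 := (le_prodFreq hq hx (i, ⟨N, fun _ => i⟩)).1
      have h2 := hR ⟨(i, ⟨N, fun _ => i⟩), rfl⟩
      have h3 : q ^ N ≤ q ^ (N + 1) := pow_le_pow_right₀ hq.le N.le_succ
      simp only at h1
      linarith)
    (fun R => ((hfr R).image (prodFreq x)).subset (by rintro _ ⟨⟨j, rfl⟩, hj⟩; exact ⟨j, hj, rfl⟩))
  have hidx : ∀ j, ∃ n, lam n = prodFreq x j := fun j => by
    rw [← mem_range, hrange]; exact mem_range_self j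
  choose idx hidx using hidx
  set β : (ι × Σ n, Fin n → ι) → ℂ := fun j => d j.1 * ∏ i, -e (j.2.2 i) with hβ
  refine ⟨lam, fun n => ∑' j : {j // idx j = n}, β j, fun n => ?_, hmono, htend, ?_⟩
  · obtain ⟨j, hj⟩ : lam n ∈ range (prodFreq x) := hrange ▸ mem_range_self n
    rw [← hj]
    exact (hx1 _).trans (le_prodFreq hq hx j).2.1
  intro s D E hD hE h1
  have hg := hasSum_prod_tuples (g := fun i => -e i * (x i : ℂ) ^ (-s)) (S := -E)
    (by simpa using hE.summable.norm) (by simpa using h1) (by simpa using hE.neg)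
  rw [sub_neg_eq_add] at hg
  have hsum : HasSum (fun j => β j * (prodFreq x j : ℂ) ^ (-s)) (D / (1 + E)) := by
    refine (hD.mul hg.1 (hD.summable.norm.mul_norm hg.2).of_norm).congr_fun fun j => ?_
    have hpow : (prodFreq x j : ℂ) ^ (-s) =
        (x j.1 : ℂ) ^ (-s) * ∏ i, (x (j.2.2 i) : ℂ) ^ (-s) := by
      rw [prodFreq, Complex.ofReal_mul, Complex.mul_cpow_ofReal_nonneg (by linarith [hx1 j.1])
        (Finset.prod_nonneg fun i _ => by linarith [hx1 (j.2.2 i)]),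
        prod_ofReal_cpow fun i => by linarith [hx1 (j.2.2 i)]]
    rw [hpow, hβ, Finset.prod_mul_distrib]
    ring
  rw [← (Equiv.sigmaFiberEquiv idx).hasSum_iff] at hsum
  refine hsum.sigma fun n => ?_
  have hfib : Finite {j // idx j = n} := ((hfr (lam n)).subset fun j (hj : idx j = n) =>
    (show prodFreq x j ≤ lam n by rw [← hidx j, hj])).to_subtype
  refine ((Summable.of_finite (f := fun j : {j // idx j = n} => β j)).hasSum.mul_right
    ((lam n : ℂ) ^ (-s))).congr_fun fun j => ?_
  simp only [Function.comp_apply, Equiv.sigmaFiberEquiv, Equiv.coe_fn_mk]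
  rw [← hidx, j.2]

end HalfIntegral

namespace HalfIntegral

open Filter Topology Set

/-! ### Dirichlet series dominated by their first term -/

variable {a : ℕ → ℂ} {L : ℂ → ℂ} {B : ℝ}

theorem firstIndex_spec (ha : ∃ n, 1 ≤ n ∧ a n ≠ 0) : 1 ≤ firstIndex a ∧ a (firstIndex a) ≠ 0 :=
  Nat.sInf_mem (s := {n : ℕ | 1 ≤ n ∧ a n ≠ 0}) ha

theorem eq_zero_of_lt_firstIndex {n : ℕ} (hn : 1 ≤ n) (h : n < firstIndex a) : a n = 0 := by
  by_contra h0
  exact Nat.notMem_of_lt_sInf h ⟨hn, h0⟩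

/-- The frequencies `n / c`, `n > c`, of the normalized Dirichlet series. -/
noncomputable def tailFreq (a : ℕ → ℂ) (i : {n // firstIndex a < n}) : ℝ :=
  (i : ℝ) / firstIndex a

theorem hasSum_tail {c : ℕ} {g : ℕ → ℂ} {N : ℂ} (h : HasSum g N) (h0 : ∀ n < c, g n = 0) :
    HasSum (fun i : {n // c < n} => g i) (N - g c) := by
  have h1 := h.sub (hasSum_ite_eq c (g c))
  rw [← hasSum_subtype_iff_of_support_subset (s := {n | c < n})] at h1
  · refine h1.congr_fun fun i => ?_
    have : (i : ℕ) ≠ c := ne_of_gt i.2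
    simp [this]
  · intro n hn
    by_contra h2
    rcases (not_lt.mp (show ¬ c < n from fun h => h2 h)).lt_or_eq with h3 | rfl
    · simp [h0 n h3, h3.ne] at hn
    · simp at hn

theorem tailFreq_cpow (ha : ∃ n, 1 ≤ n ∧ a n ≠ 0) (i : {n // firstIndex a < n}) (s : ℂ) :
    (tailFreq a i : ℂ) ^ (-s) = (firstIndex a : ℂ) ^ s / ((i : ℕ) : ℂ) ^ s := by
  have hc : (0 : ℝ) < firstIndex a := by exact_mod_cast (firstIndex_spec ha).1
  rw [tailFreq, div_eq_mul_inv, Complex.ofReal_mul, Complex.mul_cpow_ofReal_nonneg (by positivity)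
    (by positivity), Complex.ofReal_inv, Complex.inv_cpow _ _ (by
      rw [Complex.arg_ofReal_of_nonneg hc.le]; exact Real.pi_pos.ne), Complex.cpow_neg,
    Complex.cpow_neg, inv_inv, Complex.ofReal_natCast, Complex.ofReal_natCast]
  ring

theorem term_eq_zero {n : ℕ} (s : ℂ) (h : n < firstIndex a) : LSeries.term a s n = 0 := by
  rcases Nat.eq_zero_or_pos n with rfl | hn
  · exact LSeries.term_zero _ _
  · rw [LSeries.term_of_ne_zero hn.ne', eq_zero_of_lt_firstIndex hn h, zero_div]

theorem natCast_cpow_ne_zero {c : ℕ} (hc : 1 ≤ c) (s : ℂ) : (c : ℂ) ^ s ≠ 0 := by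
  have : (c : ℂ) ≠ 0 := by exact_mod_cast (Nat.one_le_iff_ne_zero.mp hc)
  simp [Complex.cpow_eq_zero_iff, this]

theorem hasSum_normalized_sub_one (ha : ∃ n, 1 ≤ n ∧ a n ≠ 0) (hL : IsEntireContinuation a L)
    {s : ℂ} (hs : LSeries.abscissaOfAbsConv a < (s.re : EReal)) :
    HasSum (fun i : {n // firstIndex a < n} => a i / a (firstIndex a) * (tailFreq a i : ℂ) ^ (-s))
      (normalized a L s - 1) := by
  obtain ⟨hc, hac⟩ := firstIndex_spec ha
  have h := (LSeriesSummable_of_abscissaOfAbsConv_lt_re hs).hasSum.mul_left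
    ((firstIndex a : ℂ) ^ s / a (firstIndex a))
  have h1 := hasSum_tail (c := firstIndex a) h fun n hn => by rw [term_eq_zero s hn, mul_zero]
  have h2 : (firstIndex a : ℂ) ^ s / a (firstIndex a) * LSeries.term a s (firstIndex a) = 1 := by
    rw [LSeries.term_of_ne_zero (by omega)]
    have := natCast_cpow_ne_zero hc s
    field_simp
  rw [h2] at h1
  rw [normalized, hL.eq_series s hs, LSeries]
  refine h1.congr_fun fun i => ?_
  rw [tailFreq_cpow ha, LSeries.term_of_ne_zero (by have := i.2; omega)]
  ring

theorem IsEntireContinuation.hasDerivAt (hL : IsEntireContinuation a L) {s : ℂ}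
    (hs : LSeries.abscissaOfAbsConv a < (s.re : EReal)) :
    HasDerivAt L (-LSeries (LSeries.logMul a) s) s := by
  refine (LSeries_hasDerivAt hs).congr_of_eventuallyEq ?_
  have ho : IsOpen {z : ℂ | LSeries.abscissaOfAbsConv a < (z.re : EReal)} :=
    isOpen_Ioi.preimage (continuous_coe_real_ereal.comp Complex.continuous_re)
  filter_upwards [ho.mem_nhds hs] with z hz using hL.eq_series z hz

/-- The Dirichlet series of the derivative of the normalized function. -/
theorem hasSum_deriv_normalized (ha : ∃ n, 1 ≤ n ∧ a n ≠ 0) (hL : IsEntireContinuation a L)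
    {s : ℂ} (hs : LSeries.abscissaOfAbsConv a < (s.re : EReal)) :
    HasSum (fun i : {n // firstIndex a < n} =>
      a i / a (firstIndex a) * (Complex.log (firstIndex a) - Complex.log (i : ℕ)) *
        (tailFreq a i : ℂ) ^ (-s)) (deriv (normalized a L) s) := by
  obtain ⟨hc, hac⟩ := firstIndex_spec ha
  have hc0 : (firstIndex a : ℂ) ≠ 0 := by exact_mod_cast (Nat.one_le_iff_ne_zero.mp hc)
  have hd : HasDerivAt (normalized a L) ((firstIndex a : ℂ) ^ s / a (firstIndex a) *
      (Complex.log (firstIndex a) * LSeries a s + -LSeries (LSeries.logMul a) s)) s := by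
    have h1 := (((hasDerivAt_id s).const_cpow (Or.inl hc0)).div_const (a (firstIndex a))).mul
      (hL.hasDerivAt hs)
    refine HasDerivAt.congr_deriv h1 ?_
    rw [hL.eq_series s hs]
    simp only [id]
    ring
  rw [hd.deriv]
  have hlog : LSeriesSummable (LSeries.logMul a) s :=
    LSeriesSummable_of_abscissaOfAbsConv_lt_re (by rwa [LSeries.abscissaOfAbsConv_logMul])
  have h := ((LSeriesSummable_of_abscissaOfAbsConv_lt_re hs).hasSum.mul_left
    (Complex.log (firstIndex a))).add hlog.hasSum.neg |>.mul_left
    ((firstIndex a : ℂ) ^ s / a (firstIndex a))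
  have hterm : ∀ n : ℕ, LSeries.term (LSeries.logMul a) s n =
      Complex.log n * LSeries.term a s n := fun n => by
    rcases Nat.eq_zero_or_pos n with rfl | hn
    · simp
    · rw [LSeries.term_of_ne_zero hn.ne', LSeries.term_of_ne_zero hn.ne', LSeries.logMul]
      ring
  have h1 := hasSum_tail (c := firstIndex a) h fun n hn => by
    rw [hterm, term_eq_zero s hn]; ring
  rw [hterm (firstIndex a), add_neg_cancel, mul_zero, sub_zero] at h1
  refine h1.congr_fun fun i => ?_
  rw [tailFreq_cpow ha, hterm, LSeries.term_of_ne_zero (by have := i.2; omega)]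
  ring

theorem tsum_norm_tail_le (ha : ∃ n, 1 ≤ n ∧ a n ≠ 0) (hB : IsAdmissible a B) {s : ℂ}
    (hs : B ≤ s.re) : ∑' i : {n // firstIndex a < n},
      ‖a i / a (firstIndex a) * (tailFreq a i : ℂ) ^ (-s)‖ ≤ 1 / 2 := by
  obtain ⟨hc, hac⟩ := firstIndex_spec ha
  have hc0 : (0 : ℝ) < firstIndex a := by exact_mod_cast hc
  have h := hB.dominates s.re hs
  have hK : (0 : ℝ) < ‖a (firstIndex a)‖ * (firstIndex a : ℝ) ^ (-s.re) :=
    mul_pos (norm_pos_iff.mpr hac) (Real.rpow_pos_of_pos hc0 _)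
  have e1 : ∑' i : {n // firstIndex a < n},
      ‖a i / a (firstIndex a) * (tailFreq a i : ℂ) ^ (-s)‖ =
      (∑' n : ℕ, (if firstIndex a < n then ‖a n‖ * (n : ℝ) ^ (-s.re) else 0)) *
        (‖a (firstIndex a)‖ * (firstIndex a : ℝ) ^ (-s.re))⁻¹ := by
    rw [← tsum_mul_right]
    have := tsum_subtype {n : ℕ | firstIndex a < n} fun n : ℕ => ‖a n‖ * (n : ℝ) ^ (-s.re) *
      (‖a (firstIndex a)‖ * (firstIndex a : ℝ) ^ (-s.re))⁻¹
    refine Eq.trans ?_ (this.trans ?_)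
    · refine tsum_congr fun i => ?_
      have hi : (0 : ℝ) < ((i : ℕ) : ℝ) := by exact_mod_cast (Nat.zero_le _).trans_lt i.2
      rw [norm_mul, norm_div, tailFreq, norm_ofReal_cpow (by positivity), Complex.neg_re,
        Real.div_rpow hi.le hc0.le]
      field_simp
    · refine tsum_congr fun n => ?_
      by_cases hn : firstIndex a < n <;> simp [hn, indicator]
  rw [e1, ← div_eq_mul_inv, div_le_iff₀ hK]
  exact h

theorem norm_normalized_sub_one_le (ha : ∃ n, 1 ≤ n ∧ a n ≠ 0) (hL : IsEntireContinuation a L)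
    (hB : IsAdmissible a B) {s : ℂ} (hs : B ≤ s.re) : ‖normalized a L s - 1‖ ≤ 1 / 2 := by
  have h := hasSum_normalized_sub_one ha hL
    (hB.abs_conv.trans_le (EReal.coe_le_coe_iff.mpr hs))
  rw [← h.tsum_eq]
  exact (norm_tsum_le_tsum_norm h.summable.norm).trans (tsum_norm_tail_le ha hB hs)

theorem norm_normalized (ha : ∃ n, 1 ≤ n ∧ a n ≠ 0) (s : ℂ) :
    ‖L s‖ = ‖a (firstIndex a)‖ * (firstIndex a : ℝ) ^ (-s.re) * ‖normalized a L s‖ := by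
  obtain ⟨hc, hac⟩ := firstIndex_spec ha
  have hc0 : (0 : ℝ) < firstIndex a := by exact_mod_cast hc
  have := (Real.rpow_pos_of_pos hc0 s.re).ne'
  have := norm_ne_zero_iff.mpr hac
  rw [normalized, norm_mul, norm_div, Complex.norm_natCast_cpow_of_pos (by omega),
    Real.rpow_neg hc0.le]
  field_simp

/-- As `σ → ∞` the first term of a Dirichlet series dominates all the others. -/
theorem exists_isAdmissible (ha : ∃ n, 1 ≤ n ∧ a n ≠ 0) {A : ℝ}
    (hA : LSeries.abscissaOfAbsConv a ≤ (A : EReal)) : ∃ B, IsAdmissible a B := by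
  obtain ⟨hc, hac⟩ := firstIndex_spec ha
  set c := firstIndex a with hcdef
  have hc0 : (0 : ℝ) < c := by exact_mod_cast hc
  have habs : ∀ σ : ℝ, A + 1 ≤ σ → LSeries.abscissaOfAbsConv a < (σ : EReal) := fun σ hσ =>
    hA.trans_lt (EReal.coe_lt_coe_iff.mpr (by linarith))
  set t : ℝ → ℕ → ℝ := fun σ n => if c < n then ‖a n‖ * (n : ℝ) ^ (-σ) else 0 with ht
  have ht0 : ∀ σ n, 0 ≤ t σ n := fun σ n => by
    simp only [ht]; split_ifs <;> positivity
  have hsum : Summable (t (A + 1)) := by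
    have h := (LSeriesSummable_of_abscissaOfAbsConv_lt_re (f := a) (s := ((A + 1 : ℝ) : ℂ))
      (by rw [Complex.ofReal_re]; exact habs _ le_rfl)).norm
    refine h.of_nonneg_of_le (ht0 _) fun n => ?_
    simp only [ht]
    split_ifs with hn
    · rw [LSeries.norm_term_eq, if_neg (by omega), Complex.ofReal_re,
        Real.rpow_neg (by positivity), div_eq_mul_inv]
    · exact norm_nonneg _
  -- every term with `n > c` decays at least by the factor `(c / (c + 1)) ^ (σ - A - 1)`
  -- relative to the first one
  have hle : ∀ σ, A + 1 ≤ σ → ∀ n, t σ n ≤ t (A + 1) n * ((c : ℝ) + 1) ^ (-(σ - (A + 1))) := by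
    intro σ hσ n
    simp only [ht]
    split_ifs with hn
    · have hn' : (c : ℝ) + 1 ≤ n := by exact_mod_cast hn
      have hn0 : (0 : ℝ) < n := by linarith
      rw [show -σ = -(A + 1) + -(σ - (A + 1)) by ring, Real.rpow_add hn0, mul_assoc]
      gcongr ?_ * (_ * ?_)
      exact Real.rpow_le_rpow_of_nonpos (by linarith) hn' (by linarith)
    · simp
  have hlim : Tendsto (fun u : ℝ => (∑' n, t (A + 1) n) * (c : ℝ) ^ (A + 1) *
      ((c : ℝ) / (c + 1)) ^ u) atTop (𝓝 0) := by
    have h := tendsto_rpow_atTop_of_base_lt_one ((c : ℝ) / (c + 1))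
      (by have : (0 : ℝ) < c / (c + 1) := by positivity
          linarith)
      (by rw [div_lt_one (by positivity)]; linarith)
    simpa using h.const_mul ((∑' n, t (A + 1) n) * (c : ℝ) ^ (A + 1))
  have hpos : 0 < 1 / 2 * ‖a c‖ := by have := norm_pos_iff.mpr hac; positivity
  obtain ⟨U, hU⟩ := eventually_atTop.mp (hlim.eventually (gt_mem_nhds hpos))
  refine ⟨A + 1 + max U 0, habs _ (by simp), fun σ hσ => ?_⟩
  have hσ1 : A + 1 ≤ σ := by linarith [le_max_right U 0]
  have h1 := hU (σ - (A + 1)) (by linarith [le_max_left U 0])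
  have h2 : ∑' n, t σ n ≤ (∑' n, t (A + 1) n) * ((c : ℝ) + 1) ^ (-(σ - (A + 1))) := by
    rw [← tsum_mul_right]
    have h3 := hsum.mul_right (((c : ℝ) + 1) ^ (-(σ - (A + 1))))
    exact (h3.of_nonneg_of_le (ht0 σ) (hle σ hσ1)).tsum_le_tsum (hle σ hσ1) h3
  have h4 : (∑' n, t (A + 1) n) * ((c : ℝ) + 1) ^ (-(σ - (A + 1))) =
      ((∑' n, t (A + 1) n) * (c : ℝ) ^ (A + 1) * ((c : ℝ) / (c + 1)) ^ (σ - (A + 1))) *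
        (c : ℝ) ^ (-σ) := by
    rw [Real.div_rpow hc0.le (by positivity), Real.rpow_neg (by positivity),
      Real.rpow_neg hc0.le, Real.rpow_sub hc0]
    have := (Real.rpow_pos_of_pos hc0 σ).ne'
    have := (Real.rpow_pos_of_pos hc0 (A + 1)).ne'
    field_simp
  refine h2.trans (h4.trans_le ?_)
  rw [← mul_assoc]
  exact mul_le_mul_of_nonneg_right h1.le (by positivity)

/-- The expansion of the logarithmic derivative; neither the frequencies nor the coefficients depend
on the abscissa `B`. -/
theorem exists_isLogDerivExpansion (ha : ∃ n, 1 ≤ n ∧ a n ≠ 0) (hL : IsEntireContinuation a L) :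
    ∃ (lam : ℕ → ℝ) (b : ℕ → ℂ), ∀ B : ℝ, IsAdmissible a B →
      IsLogDerivExpansion (normalized a L) B lam b := by
  obtain ⟨hc, hac⟩ := firstIndex_spec ha
  have hc0 : (0 : ℝ) < firstIndex a := by exact_mod_cast hc
  have : Nonempty {n // firstIndex a < n} := ⟨⟨_, Nat.lt_succ_self _⟩⟩
  obtain ⟨lam, b, h1, h2, h3, h4⟩ := exists_quotient_expansion (x := tailFreq a)
    (q := ((firstIndex a : ℝ) + 1) / firstIndex a) (by rw [lt_div_iff₀ hc0]; linarith)
    (fun i => by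
      have : ((firstIndex a : ℝ) + 1) ≤ (i : ℕ) := by exact_mod_cast i.2
      rw [tailFreq]; gcongr)
    (fun R => by
      refine Set.Finite.of_finite_image (f := fun i => (i : ℕ))
        ((finite_Iic ⌊R * firstIndex a⌋₊).subset ?_) Subtype.val_injective.injOn
      rintro _ ⟨i, hi, rfl⟩
      refine Nat.le_floor ?_
      rwa [mem_ofPred_eq, tailFreq, div_le_iff₀ hc0] at hi)
    (fun i => a i / a (firstIndex a) * (Complex.log (firstIndex a) - Complex.log (i : ℕ)))
    (fun i => a i / a (firstIndex a))
  refine ⟨lam, b, fun B hB => ⟨h1, h2, h3, fun s hs => ?_⟩⟩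
  have hs' := hB.abs_conv.trans_le (EReal.coe_le_coe_iff.mpr hs)
  have h5 := h4 s _ _ (hasSum_deriv_normalized ha hL hs') (hasSum_normalized_sub_one ha hL hs')
    ((tsum_norm_tail_le ha hB hs).trans_lt (by norm_num))
  rwa [add_sub_cancel] at h5

theorem normalized_ne_zero (ha : ∃ n, 1 ≤ n ∧ a n ≠ 0) (hL : IsEntireContinuation a L)
    (hB : IsAdmissible a B) {s : ℂ} (hs : B ≤ s.re) : normalized a L s ≠ 0 := fun h => by
  have := norm_normalized_sub_one_le ha hL hB hs
  rw [h] at this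
  norm_num at this

theorem logDeriv_normalized (ha : ∃ n, 1 ≤ n ∧ a n ≠ 0) (hL : IsEntireContinuation a L)
    (hB : IsAdmissible a B) {s : ℂ} (hs : B ≤ s.re) :
    logDeriv (normalized a L) s = logDeriv L s + Complex.log (firstIndex a) := by
  obtain ⟨hc, hac⟩ := firstIndex_spec ha
  have hc0 : (firstIndex a : ℂ) ≠ 0 := by exact_mod_cast (Nat.one_le_iff_ne_zero.mp hc)
  have h0 := normalized_ne_zero ha hL hB hs
  have hL0 : L s ≠ 0 := right_ne_zero_of_mul h0
  have hd := (((hasDerivAt_id s).const_cpow (Or.inl hc0)).div_const (a (firstIndex a))).mul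
    (hL.entire s).hasDerivAt
  have hd' : deriv (normalized a L) s = _ := hd.deriv
  have hcs := natCast_cpow_ne_zero hc s
  rw [logDeriv_apply, logDeriv_apply, hd', normalized]
  simp only [id]
  field_simp
  ring

/-- The `L`-function of a cusp form satisfies the analytic hypotheses that the estimates for the sum
over zeros rest on. -/
theorem hasFunctionalEquation {κ : ℝ} {w : ℂ} {Λ : ℂ → ℂ} (ha : ∃ n, 1 ≤ n ∧ a n ≠ 0)
    (hκ : 0 < κ) (hw : w ≠ 0) (hΛ : Differentiable ℂ Λ) (hfe : ∀ s, Λ (κ - s) = w * Λ s)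
    (hbdd : ∀ a b : ℝ, ∃ C, ∀ s : ℂ, s.re ∈ Icc a b → ‖Λ s‖ ≤ C)
    (hLΛ : ∀ s, L s = (Real.pi : ℂ) ^ s * Λ s * (Complex.Gamma s)⁻¹)
    (hL : IsEntireContinuation a L) (hB : IsAdmissible a B) :
    HasFunctionalEquation κ B w Λ L := by
  obtain ⟨hc, hac⟩ := firstIndex_spec ha
  have hc0 : (0 : ℝ) < firstIndex a := by exact_mod_cast hc
  refine ⟨hκ, hw, hΛ, hfe, hbdd, hLΛ, ?_, fun σ hσ => ?_⟩
  · refine ⟨‖a (firstIndex a)‖ * (firstIndex a : ℝ) ^ (-B) * (3 / 2), fun s hs => ?_⟩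
    rw [norm_normalized ha s]
    have h1 := norm_normalized_sub_one_le ha hL hB hs
    have h2 := norm_le_norm_add_norm_sub' (normalized a L s) 1
    rw [norm_one] at h2
    have h3 : (1 : ℝ) ≤ firstIndex a := by exact_mod_cast hc
    gcongr
    linarith
  · refine ⟨‖a (firstIndex a)‖ * (firstIndex a : ℝ) ^ (-σ) * (1 / 2), ?_, fun t => ?_⟩
    · have := norm_pos_iff.mpr hac
      positivity
    · rw [norm_normalized ha (σ + t * Complex.I)]
      have hre : ((σ : ℂ) + t * Complex.I).re = σ := by simp
      have h1 := norm_normalized_sub_one_le ha hL hB (s := σ + t * Complex.I) (by rwa [hre])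
      have h2 := norm_sub_norm_le (1 : ℂ) (normalized a L (σ + t * Complex.I))
      rw [norm_one, norm_sub_rev] at h2
      rw [hre]
      gcongr
      linarith

theorem IsCuspForm.exists_fourierCoeff_ne_zero {k : ℕ} {f : ℍ → ℂ} (hf : IsCuspForm k f)
    (hf0 : f ≠ 0) : ∃ n, 1 ≤ n ∧ fourierCoeff f n ≠ 0 := by
  by_contra! h
  apply hf0
  funext z
  refine (hf.hasSum_fourierCoeff z).unique ?_
  have : (fun n : ℕ => fourierCoeff f n * Function.Periodic.qParam 1 z ^ n) = fun _ => 0 := by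
    funext n
    rcases Nat.eq_zero_or_pos n with rfl | hn
    · rw [hf.fourierCoeff_zero, zero_mul]
    · rw [h n hn, zero_mul]
  rw [this]
  exact hasSum_zero

end HalfIntegral

theorem proposition1 (k : ℕ) (f : ℍ → ℂ) (hf : HalfIntegral.IsCuspForm k f) (hf0 : f ≠ 0)
    (hHecke : HalfIntegral.IsHeckeEigen k f) (hFricke : HalfIntegral.IsFrickeEigen k f) :
    -- the `L`-function is entire, and the abscissas `B` and the expansion of `L'/L` exist
    ∃ L : ℂ → ℂ, HalfIntegral.IsEntireContinuation (HalfIntegral.fourierCoeff f) L ∧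
      (∃ B : ℝ, HalfIntegral.IsAdmissible (HalfIntegral.fourierCoeff f) B) ∧
      (∃ (lam : ℕ → ℝ) (bf : ℕ → ℂ), ∀ B : ℝ,
        HalfIntegral.IsAdmissible (HalfIntegral.fourierCoeff f) B →
        HalfIntegral.IsLogDerivExpansion
          (HalfIntegral.normalized (HalfIntegral.fourierCoeff f) L) B lam bf) ∧
      -- the formula
      ∀ B : ℝ, HalfIntegral.IsAdmissible (HalfIntegral.fourierCoeff f) B →
      ∀ b : ℝ, B < b →
      ∀ (lam : ℕ → ℝ) (bf : ℕ → ℂ),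
        HalfIntegral.IsLogDerivExpansion
          (HalfIntegral.normalized (HalfIntegral.fourierCoeff f) L) B lam bf →
        (∀ T : ℝ, (HalfIntegral.zerosIn L ((k : ℝ) + 1 / 2 - b) B T).Finite) ∧
        ∀ x : ℝ, 0 < x → x ≠ 1 →
        ∀ d : ℕ, (∀ n : ℕ, x = lam n ∨ x = (lam n)⁻¹ → n = d) →
          (fun T : ℝ =>
            HalfIntegral.zeroSum L ((k : ℝ) + 1 / 2 - b) B T x
              - bf d / (Real.pi : ℂ)
                * ((HalfIntegral.delta x (lam d)
                    + x ^ ((k : ℝ) + 1 / 2) * HalfIntegral.delta x (lam d)⁻¹ : ℝ) : ℂ) * (T : ℂ))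
            =O[Filter.atTop] Real.log := by
  obtain ⟨w, Λ, hw, hΛ, hfe, hbdd, hL⟩ := hf.exists_completed hf0 hFricke
  have ha := hf.exists_fourierCoeff_ne_zero hf0
  refine ⟨_, hL, HalfIntegral.exists_isAdmissible ha hf.abscissaOfAbsConv_le,
    HalfIntegral.exists_isLogDerivExpansion ha hL, fun B hB b hb lam bf hexp => ?_⟩
  have h := HalfIntegral.hasFunctionalEquation ha (by positivity) hw hΛ hfe hbdd (fun _ => rfl) hL hB
  have hκ : ∀ n : ℤ, ((k : ℝ) + 1 / 2) / 2 ≠ n := fun n hn => by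
    have h1 : (2 * k + 1 : ℝ) = 4 * n := by linarith
    have h2 : 2 * (k : ℤ) + 1 = 4 * n := by exact_mod_cast h1
    omega
  refine ⟨fun T => HalfIntegral.finite_zerosIn hL.entire (h.hasModerateGrowth hκ).ne_zero _ _ _,
    fun x hx hx1 d hd => h.zeroSum_isBigO
      (c₀ := Complex.log (HalfIntegral.firstIndex (HalfIntegral.fourierCoeff f)))
      hκ hb hexp.one_le hexp.tendsto (fun s hs => ?_) hx hx1 hd⟩
  rw [← HalfIntegral.logDeriv_normalized ha hL hB hs]
  exact hexp.hasSum s hs
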